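/- **Setting.** Let $T>0$, let $\mathcal P_1(X)$ be the Borel probability measures on $X$ with finite first moment, with the Kantorovich–Rubinstein distance $d_1$, and let $\pi_1(x,v)=x$. Let $M_0\ge \tfrac12$ and let $L_0,g:\mathbb R^d\times\mathcal P_1(\mathbb R^{2d})\to\mathbb R$ be such that: * $L_0$ is continuous, $x\mapsto L_0(x,\mu)$ is $C^1$ with $|D_xL_0(x,\mu)|\le M_0$ for all $(x,\mu)$, and $|L_0(x,\mu_1)-L_0(x,\mu_2)|\le\theta(|x|)\,\omega_0(d_1(\mu_1,\mu_2))$ for some nondecreasing $\theta:\mathbb R_+\to\mathbb R_+$ and some modulus of continuity $\omega_0$; * $g(\cdot,\mu)$ is bounded and $C^1$ with $\tfrac12|D_xg(x,\mu)|\le M_0$ for all $(x,\mu)$, and $g(x,\cdot)$ is uniformly continuous, uniformly in $x$. Let $\mu_0$ be a probability measure on $\mathbb R^{2d}$ that is absolutely continuous with respect to Lebesgue measure and has compact support, and let $m_0=\pi_1\sharp\mu_0$. For $\varepsilon>0$ let $(u^\varepsilon,\mu^\varepsilon)$ be a solution of the mean field game system with control of acceleration, that is, $\mu^\varepsilon\in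 C([0,T];\mathcal P_1(\mathbb R^{2d}))$, $$u^\varepsilon(t,x,v)=\inf\Big\{\int_t^T\Big(\tfrac\varepsilon2|\ddot\gamma|^2+\tfrac12|\dot\gamma|^2+L_0(\gamma,\mu^\varepsilon_s)\Big)ds+g(\gamma(T),\mu^\varepsilon_T)\;:\;\gamma\in H^2(0,T;\mathbb R^d),\ \gamma(t)=x,\ \dot\gamma(t)=v\Big\},$$ and, for every $t\in[0,T]$, $\mu^\varepsilon_t$ is the image of $\mu_0$ under a flow, defined for $\mu_0$-a.e. initial point, of the system $\dot\gamma=v$, $\dot v=-\frac1\varepsilon D_vu^\varepsilon(t,\gamma,v)$. Let $\varepsilon_k>0$, $\varepsilon_k\to0$, and let $\mu^0\in C([0,T];\mathcal P_1(\mathbb R^{2d}))$ be a limit of $\mu^{\varepsilon_k}$ in the sense that $\sup_{t\in[\delta,T]}d_1(\mu^{\varepsilon_k}_t,\mu^0_t)\to0$ for every $\delta\in(0,T]$. Put $m^0_t=\pi_1\sharp\mu^0_t$ and $$u^0(t,x)=\inf\Big\{\int_t^T\Big(\tfrac12|\dot\gamma|^2+L_0(\gamma,\mu^0_s)\Big)ds+g(\gamma(T),\mu^0_T)\;:\;\gamma\in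 C^1([0,T];\mathbb R^d),\ \gamma(t)=x\Big\}.$$ **Proposition 5.5.** For every $t\in[0,T]$ the function $u^0(t,\cdot)$ is differentiable at $m^0_t$-a.e. point and $$\mu^0_t=\big(\mathrm{Id},\,-D_xu^0(t,\cdot)\big)\sharp m^0_t .$$ Moreover, $m^0\in C([0,T];\mathcal P_1(\mathbb R^d))$ solves $$\partial_tm^0_t-\operatorname{div}\big(m^0_t\,D_xu^0(t,x)\big)=0\ \text{ on }[0,T]\times\mathbb R^d,\qquad m^0_0=m_0,$$ in the sense of distributions: $D_xu^0(t,\cdot)$ is $m^0_t$-integrable for every $t\in[0,T]$, $t\mapsto\int|D_xu^0(t,x)|\,m^0_t(dx)$ is integrable on $(0,T)$, and for all $\psi\in C_c^\infty([0,T)\times\mathbb R^d)$ $$\int_0^T\!\!\int_{\mathbb R^d}\big(\partial_t\psi-\langle D_x\psi,D_xu^0\rangle\big)\,m^0_t(dx)\,dt+\int_{\mathbb R^d}\psi(0,x)\,m_0(dx)=0,$$ where the inner integral is integrable in $t$; and $m^0_0=m_0$. -/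

import Mathlib

open MeasureTheory Filter Topology Set
open scoped ContDiff

noncomputable section

/-- The Euclidean space `ℝᵈ`. -/
abbrev Space (d : ℕ) : Type := EuclideanSpace ℝ (Fin d)

/-- The Wasserstein space of order one: Borel probability measures with finite first moment. -/
structure P1 (X : Type*) [MetricSpace X] [MeasurableSpace X] where
  toMeasure : Measure X
  isProbabilityMeasure : IsProbabilityMeasure toMeasure
  integrable_dist : ∃ x₀ : X, Integrable (fun x => dist x₀ x) toMeasure

/-- The couplings (transport plans) of two measures. -/
def couplings {X : Type*} [MeasurableSpace X] (m m' : Measure X) : Set (Measure (X × X)) :=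
  {π | IsProbabilityMeasure π ∧ π.map Prod.fst = m ∧ π.map Prod.snd = m'}

/-- The Kantorovich-Rubinstein distance
`d₁(m, m') = inf { ∫ d(x, y) dπ(x, y) | π a coupling of m and m' }`.
On a product `X × Y` the distance is the maximum distance; for `ℝᵈ × ℝᵈ` it lies between
`1/√2` times the Euclidean distance and the Euclidean distance, and so does the resulting `d₁`. -/
def d1 {X : Type*} [MetricSpace X] [MeasurableSpace X] (m m' : P1 X) : ℝ :=
  sInf ((fun π : Measure (X × X) => ∫ z, dist z.1 z.2 ∂π) '' couplings m.toMeasure m'.toMeasure)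

/-- `m ∈ C([0,T]; P₁(X))`. -/
def ContinuousFlow {X : Type*} [MetricSpace X] [MeasurableSpace X] (T : ℝ) (m : ℝ → P1 X) : Prop :=
  ∀ t ∈ Icc 0 T, Tendsto (fun s => d1 (m s) (m t)) (𝓝[Icc 0 T] t) (𝓝 0)

/-- The space marginal `π₁ ♯ μ` of a measure on the phase space `ℝᵈ × ℝᵈ`. -/
def P1.spaceMarginal {d : ℕ} (μ : P1 (Space d × Space d)) : P1 (Space d) where
  toMeasure := μ.toMeasure.map Prod.fst
  isProbabilityMeasure := by
    have := μ.isProbabilityMeasure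
    exact Measure.isProbabilityMeasure_map measurable_fst.aemeasurable
  integrable_dist := by
    obtain ⟨z, hz⟩ := μ.integrable_dist
    refine ⟨z.1, ?_⟩
    rw [integrable_map_measure (by fun_prop) measurable_fst.aemeasurable]
    refine hz.mono (by fun_prop) (Eventually.of_forall fun y => ?_)
    simp only [Function.comp_apply, Real.norm_eq_abs, abs_of_nonneg dist_nonneg]
    exact le_max_left _ _

/-- Assumptions on the coupling `L₀ : ℝᵈ × P₁(ℝᵈ × ℝᵈ) → ℝ`. -/
structure CouplingAssumptions {d : ℕ} (M₀ : ℝ)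
    (L₀ : Space d → P1 (Space d × Space d) → ℝ) : Prop where
  /-- `L₀` is continuous in all variables; `P₁` is metrized by `d₁`, so sequences suffice. -/
  continuous : ∀ (x : ℕ → Space d) (x' : Space d) (μ : ℕ → P1 (Space d × Space d))
    (μ' : P1 (Space d × Space d)), Tendsto x atTop (𝓝 x') →
    Tendsto (fun n => d1 (μ n) μ') atTop (𝓝 0) →
    Tendsto (fun n => L₀ (x n) (μ n)) atTop (𝓝 (L₀ x' μ'))
  contDiff : ∀ μ, ContDiff ℝ 1 (fun x => L₀ x μ)
  modulus : ∃ θ ρ : ℝ → ℝ, MonotoneOn θ (Ici 0) ∧ (∀ r, 0 ≤ r → 0 ≤ θ r) ∧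
    MonotoneOn ρ (Ici 0) ∧ (∀ r, 0 ≤ r → 0 ≤ ρ r) ∧ ρ 0 = 0 ∧ ContinuousWithinAt ρ (Ici 0) 0 ∧
    ∀ x μ₁ μ₂, |L₀ x μ₁ - L₀ x μ₂| ≤ θ ‖x‖ * ρ (d1 μ₁ μ₂)
  gradient_bound : ∀ x μ, ‖gradient (fun y => L₀ y μ) x‖ ≤ M₀

/-- Assumptions on the terminal cost `g : ℝᵈ × P₁(ℝᵈ × ℝᵈ) → ℝ`. -/
structure TerminalAssumptions {d : ℕ} (M₀ : ℝ)
    (g : Space d → P1 (Space d × Space d) → ℝ) : Prop where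
  contDiff : ∀ μ, ContDiff ℝ 1 (fun x => g x μ)
  bounded : ∀ μ, ∃ C, ∀ x, |g x μ| ≤ C
  half_le : 1 / 2 ≤ M₀
  gradient_bound : ∀ x μ, (1 / 2) * ‖gradient (fun y => g y μ) x‖ ≤ M₀
  /-- `g(x, ·)` is uniformly continuous, uniformly with respect to the space variable `x`. -/
  uniformContinuous : ∀ η > 0, ∃ δ > 0, ∀ x μ₁ μ₂, d1 μ₁ μ₂ < δ → |g x μ₁ - g x μ₂| < η

/-- Assumptions on the initial measure: absolutely continuous with compact support. -/
structure InitialAssumptions {d : ℕ} (μ₀ : Measure (Space d × Space d)) : Prop where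
  isProbabilityMeasure : IsProbabilityMeasure μ₀
  absolutelyContinuous : μ₀ ≪ volume
  compactSupport : ∃ K : Set (Space d × Space d), IsCompact K ∧ μ₀ Kᶜ = 0

/-- `γ` is a `C¹` curve on `[0,T]` with velocity `w`. -/
structure IsC1Curve {d : ℕ} (T : ℝ) (γ w : ℝ → Space d) : Prop where
  hasDerivWithinAt : ∀ s ∈ Icc 0 T, HasDerivWithinAt γ (w s) (Icc 0 T) s
  continuousOn : ContinuousOn w (Icc 0 T)

/-- `γ ∈ H²(0,T; ℝᵈ)` with velocity `w` and weak second derivative `a ∈ L²`. -/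
structure IsH2Curve {d : ℕ} (T : ℝ) (γ w a : ℝ → Space d) : Prop where
  isC1Curve : IsC1Curve T γ w
  memLp : MemLp a 2 (volume.restrict (Icc 0 T))
  velocity_eq : ∀ s ∈ Icc 0 T, w s = w 0 + ∫ r in 0..s, a r

/-- The value function `u^ε` of the problem with control of acceleration: the infimum over
curves `γ` with `γ(t) = x`, `γ'(t) = v` of
`∫_t^T (ε/2 |γ''|² + 1/2 |γ'|² + L₀(γ, μ_s)) ds + g(γ(T), μ_T)`.
Curves outside `H²` have infinite cost and are left out of the infimum. -/
def accValue {d : ℕ} (T : ℝ) (L₀ g : Space d → P1 (Space d × Space d) → ℝ) (ε : ℝ)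
    (μ : ℝ → P1 (Space d × Space d)) (t : ℝ) (x v : Space d) : ℝ :=
  sInf {c | ∃ γ w a : ℝ → Space d, IsH2Curve T γ w a ∧ γ t = x ∧ w t = v ∧
    c = (∫ s in t..T, (ε / 2 * ‖a s‖ ^ 2 + 1 / 2 * ‖w s‖ ^ 2 + L₀ (γ s) (μ s)))
      + g (γ T) (μ T)}

/-- The limit value function `u⁰`: the infimum over `C¹` curves `γ` with `γ(t) = x` of
`∫_t^T (1/2 |γ'|² + L₀(γ, μ_s)) ds + g(γ(T), μ_T)`. -/
def limitValue {d : ℕ} (T : ℝ) (L₀ g : Space d → P1 (Space d × Space d) → ℝ)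
    (μ : ℝ → P1 (Space d × Space d)) (t : ℝ) (x : Space d) : ℝ :=
  sInf {c | ∃ γ w : ℝ → Space d, IsC1Curve T γ w ∧ γ t = x ∧
    c = (∫ s in t..T, (1 / 2 * ‖w s‖ ^ 2 + L₀ (γ s) (μ s))) + g (γ T) (μ T)}

/-- `(γ, w)` solves `γ' = w`, `w' = -(1/ε) D_v u(t, γ, w)` on `[0,T]` from `(x, v)`, in the sense
of Carathéodory: the derivative `D_v u` has to exist along the curve at almost every time. -/
structure IsFeedbackTrajectory {d : ℕ} (T ε : ℝ) (u : ℝ → Space d → Space d → ℝ)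
    (x v : Space d) (γ w : ℝ → Space d) : Prop where
  isC1Curve : IsC1Curve T γ w
  position_zero : γ 0 = x
  velocity_zero : w 0 = v
  differentiable : ∀ᵐ s ∂(volume.restrict (Icc 0 T)),
    DifferentiableAt ℝ (fun v' => u s (γ s) v') (w s)
  integrable : IntervalIntegrable (fun s => gradient (fun v' => u s (γ s) v') (w s)) volume 0 T
  velocity_eq : ∀ t ∈ Icc 0 T,
    w t = v + ∫ s in 0..t, -((1 / ε) • gradient (fun v' => u s (γ s) v') (w s))

/-- `(u^ε, μ^ε)`, with `u^ε = accValue T L₀ g ε μ`, is a solution of the mean field game system with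
control of acceleration: `u^ε` is the value function and `μ^ε_t` is the image of `μ₀` under the
flow of the optimal feedback. -/
structure IsAccSolution {d : ℕ} (T : ℝ) (L₀ g : Space d → P1 (Space d × Space d) → ℝ)
    (μ₀ : Measure (Space d × Space d)) (ε : ℝ) (μ : ℝ → P1 (Space d × Space d)) : Prop where
  continuousFlow : ContinuousFlow T μ
  flow : ∃ γ w : Space d × Space d → ℝ → Space d,
    (∀ᵐ z ∂μ₀, IsFeedbackTrajectory T ε (accValue T L₀ g ε μ) z.1 z.2 (γ z) (w z)) ∧
    ∀ t ∈ Icc 0 T, AEMeasurable (fun z => (γ z t, w z t)) μ₀ ∧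
      (μ t).toMeasure = μ₀.map (fun z => (γ z t, w z t))

/-- `m` solves `∂_t m + div(m b) = 0` on `[0,T] × ℝᵈ` with `m_0 = m₀` in the sense of distributions,
i.e. against all test functions `ψ ∈ C_c^∞([0,T) × ℝᵈ)`. The integrals of the weak formulation are
required to converge. -/
structure SolvesContinuityEquation {d : ℕ} (T : ℝ) (b : ℝ → Space d → Space d)
    (m : ℝ → P1 (Space d)) (m₀ : Measure (Space d)) : Prop where
  integrable_field : ∀ t ∈ Icc 0 T, Integrable (b t) (m t).toMeasure
  integrable_norm : IntervalIntegrable (fun t => ∫ x, ‖b t x‖ ∂(m t).toMeasure) volume 0 T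
  weak : ∀ ψ : ℝ × Space d → ℝ, ContDiff ℝ ∞ ψ → HasCompactSupport ψ →
    tsupport ψ ⊆ Iio T ×ˢ univ →
    IntervalIntegrable (fun t => ∫ x, (deriv (fun τ => ψ (τ, x)) t
      + inner ℝ (gradient (fun y => ψ (t, y)) x) (b t x)) ∂(m t).toMeasure) volume 0 T ∧
    (∫ t in 0..T, ∫ x, (deriv (fun τ => ψ (τ, x)) t
      + inner ℝ (gradient (fun y => ψ (t, y)) x) (b t x)) ∂(m t).toMeasure)
      + ∫ x, ψ (0, x) ∂m₀ = 0

end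

/-! The argument is Lagrangian. Trajectories of the feedback system are optimal for the problem with
control of acceleration, and optimal curves from a fixed starting point form, as ε → 0, a minimizing
sequence of the limit problem. The limit measures are therefore carried by pairs (γ(t), γ'(t)) with
γ a minimizer of the limit problem, and there the limit value function has gradient -γ'(t).

Optimality is `IsAccValue.cost_le_of_feedback`. The feedback law is known only at almost every time
and the value function is not known to be regular in time. The sum of the value and of the cost
accumulated so far has right difference quotients bounded above, so it differs from a monotone
function by a linear one. At almost every time its derivative is shown to be nonpositive, by
comparing the trajectory with almost optimal curves over short intervals.

Near-minimality is `tendsto_lagCost_of_accMinimizers`. An almost optimal H² competitor with the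
prescribed initial velocity exists, because an initial velocity can be corrected in a short layer at
small cost; for this fixed competitor the acceleration term disappears as ε → 0.

Compactness is `CostData.exists_subseq_minimizer`: minimizing sequences converge along subsequences
to minimizers, uniformly in position and in L² in velocity, the latter because the Euler-Lagrange
velocity of the limit curve can be used to build competitors. Minimizers need not be unique. Only
functionals with the same limit at every minimizer are used (`IsValue.tendsto_of_tendsto_lagCost`),
and there are two: the time integral of the distance to the closed set of all (t, γ(t), γ'(t)),
which tends to 0, and the time integral of the derivative of a test function ψ along the curve,
which tends to -ψ(0, x). Averaging over the initial measure and passing to the limit with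
`integral_eq_integral_of_curves`, the first gives concentration on minimizers, at every time by
continuity in time, and the second gives the continuity equation.

For t > 0 the value function is squeezed at γ(t) between two differentiable functions
(`IsValue.hasGradientAt`). At t = 0 the lower one is missing. There a Hölder bound on positions,
uniform in ε, shows that the marginal is the initial one, which is absolutely continuous, so that
Rademacher's theorem applies, and `IsValue.gradient_eq` identifies the gradient. -/

noncomputable section

/-! ### C¹ curves, running and terminal costs, coercivity. -/

section

variable {d : ℕ}

/-- `γ` is a `C¹` curve on the whole line with velocity `w`. -/
structure IsC1 (γ w : ℝ → Space d) : Prop where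
  continuous_velocity : Continuous w
  hasDerivAt : ∀ s, HasDerivAt γ (w s) s

namespace IsC1

variable {γ w β w' : ℝ → Space d}

theorem continuous (h : IsC1 γ w) : Continuous γ :=
  continuous_iff_continuousAt.2 fun s => (h.hasDerivAt s).continuousAt

theorem sub_eq_integral (h : IsC1 γ w) (a b : ℝ) : γ b - γ a = ∫ s in a..b, w s :=
  (intervalIntegral.integral_eq_sub_of_hasDerivAt (fun s _ => h.hasDerivAt s)
    (h.continuous_velocity.intervalIntegrable _ _)).symm

theorem add (h : IsC1 γ w) (h' : IsC1 β w') : IsC1 (fun s => γ s + β s) (fun s => w s + w' s) :=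
  ⟨h.continuous_velocity.add h'.continuous_velocity,
    fun s => (h.hasDerivAt s).add (h'.hasDerivAt s)⟩

theorem const_smul (h : IsC1 γ w) (c : ℝ) : IsC1 (fun s => c • γ s) (fun s => c • w s) :=
  ⟨h.continuous_velocity.const_smul c, fun s => (h.hasDerivAt s).const_smul c⟩

theorem add_const (h : IsC1 γ w) (y : Space d) : IsC1 (fun s => γ s + y) w :=
  ⟨h.continuous_velocity, fun s => (h.hasDerivAt s).add_const y⟩

theorem line (t : ℝ) (x v : Space d) : IsC1 (fun s => x + (s - t) • v) (fun _ => v) := by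
  refine ⟨continuous_const, fun s => ?_⟩
  have := (((hasDerivAt_id s).sub_const t).smul_const v).const_add x
  simpa using this

theorem of_integral (hw : Continuous w) (t : ℝ) (x : Space d) :
    IsC1 (fun s => x + ∫ r in t..s, w r) w :=
  ⟨hw, fun s => (hw.integral_hasStrictDerivAt t s).hasDerivAt.const_add x⟩

theorem norm_sub_le (h : IsC1 γ w) {a b : ℝ} (hab : a ≤ b) :
    ‖γ b - γ a‖ ≤ ∫ s in a..b, ‖w s‖ := by
  rw [h.sub_eq_integral]
  exact intervalIntegral.norm_integral_le_integral_norm hab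

end IsC1

/-- A running cost `ℓ` and a terminal cost `h`, both `C¹` and `M`-Lipschitz in space. -/
structure CostData (M : ℝ) (ℓ : ℝ → Space d → ℝ) (h : Space d → ℝ) : Prop where
  nonneg : 0 ≤ M
  continuous : Continuous (fun p : ℝ × Space d => ℓ p.1 p.2)
  contDiff : ∀ s, ContDiff ℝ 1 (ℓ s)
  lip : ∀ s x y, |ℓ s x - ℓ s y| ≤ M * ‖x - y‖
  contDiff_terminal : ContDiff ℝ 1 h
  lip_terminal : ∀ x y, |h x - h y| ≤ M * ‖x - y‖

/-- The cost of a curve `γ` with velocity `w` on `[t, T]`. -/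
def lagCost (T : ℝ) (ℓ : ℝ → Space d → ℝ) (h : Space d → ℝ) (t : ℝ) (γ w : ℝ → Space d) : ℝ :=
  (∫ s in t..T, (1 / 2 * ‖w s‖ ^ 2 + ℓ s (γ s))) + h (γ T)

namespace CostData

variable {M T : ℝ} {ℓ : ℝ → Space d → ℝ} {h : Space d → ℝ} {γ w : ℝ → Space d}

theorem continuous_comp (H : CostData M ℓ h) (hγ : Continuous γ) :
    Continuous (fun s => ℓ s (γ s)) :=
  H.continuous.comp (continuous_id.prodMk hγ)

theorem continuous_integrand (H : CostData M ℓ h) (hγ : IsC1 γ w) :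
    Continuous (fun s => 1 / 2 * ‖w s‖ ^ 2 + ℓ s (γ s)) := by
  have h1 := H.continuous_comp hγ.continuous
  exact (continuous_const.mul (hγ.continuous_velocity.norm.pow 2)).add h1

theorem abs_integral_sub_le (H : CostData M ℓ h) {γ β : ℝ → Space d} (hγ : Continuous γ)
    (hβ : Continuous β) {a b B : ℝ} (hab : a ≤ b) (hB : ∀ s ∈ Icc a b, ‖γ s - β s‖ ≤ B) :
    |(∫ s in a..b, ℓ s (γ s)) - ∫ s in a..b, ℓ s (β s)| ≤ M * B * (b - a) := by
  rw [← intervalIntegral.integral_sub ((H.continuous_comp hγ).intervalIntegrable _ _)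
    ((H.continuous_comp hβ).intervalIntegrable _ _)]
  have := intervalIntegral.norm_integral_le_of_norm_le_const (a := a) (b := b) (C := M * B)
    (f := fun s => ℓ s (γ s) - ℓ s (β s)) (fun s hs => by
      rw [uIoc_of_le hab] at hs
      exact (H.lip _ _ _).trans (mul_le_mul_of_nonneg_left (hB s ⟨hs.1.le, hs.2⟩) H.nonneg))
  rwa [abs_of_nonneg (sub_nonneg.2 hab)] at this

theorem norm_fderiv_le (H : CostData M ℓ h) (s : ℝ) (x : Space d) : ‖fderiv ℝ (ℓ s) x‖ ≤ M := by
  have : LipschitzWith (Real.toNNReal M) (ℓ s) := LipschitzWith.of_dist_le_mul fun a b => by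
    rw [Real.coe_toNNReal _ H.nonneg, Real.dist_eq, dist_eq_norm]; exact H.lip s a b
  simpa [Real.coe_toNNReal _ H.nonneg] using norm_fderiv_le_of_lipschitz ℝ this (x₀ := x)

theorem norm_fderiv_terminal_le (H : CostData M ℓ h) (x : Space d) : ‖fderiv ℝ h x‖ ≤ M := by
  have : LipschitzWith (Real.toNNReal M) h := LipschitzWith.of_dist_le_mul fun a b => by
    rw [Real.coe_toNNReal _ H.nonneg, Real.dist_eq, dist_eq_norm]; exact H.lip_terminal a b
  simpa [Real.coe_toNNReal _ H.nonneg] using norm_fderiv_le_of_lipschitz ℝ this (x₀ := x)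

theorem measurable_fderiv_comp (H : CostData M ℓ h) (hγ : Continuous γ) :
    Measurable (fun s => fderiv ℝ (ℓ s) (γ s)) := by
  have h1 : Measurable (fun p : ℝ × Space d => fderiv ℝ (ℓ p.1) p.2) :=
    measurable_fderiv_with_param ℝ (f := ℓ) H.continuous
  exact h1.comp (measurable_id.prodMk hγ.measurable)

/-- The Lipschitz bound on the running cost dominates, and in time the gradient only has to be
measurable. The linear maps `Λ s` cover the three perturbations needed later: a fixed direction, a
translation, and a shear that fixes the initial point. -/
theorem hasFDerivAt_integral (H : CostData M ℓ h) (hγ : Continuous γ)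
    {P : Type*} [NormedAddCommGroup P] [NormedSpace ℝ P] {Λ : ℝ → P →L[ℝ] Space d}
    (hΛ : Continuous Λ) (a b : ℝ) :
    IntervalIntegrable (fun s => (fderiv ℝ (ℓ s) (γ s)).comp (Λ s)) volume a b ∧
    HasFDerivAt (fun p => ∫ s in a..b, ℓ s (γ s + Λ s p))
      (∫ s in a..b, (fderiv ℝ (ℓ s) (γ s)).comp (Λ s)) 0 := by
  have hc : ∀ p, Continuous fun s => γ s + Λ s p := fun p =>
    hγ.add (hΛ.clm_apply continuous_const)
  refine intervalIntegral.hasFDerivAt_integral_of_dominated_loc_of_lip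
    (F := fun p s => ℓ s (γ s + Λ s p)) (s := univ) (bound := fun s => M * ‖Λ s‖) univ_mem
    (Eventually.of_forall fun p => (H.continuous_comp (hc p)).aestronglyMeasurable)
    ((H.continuous_comp (hc 0)).intervalIntegrable _ _) ?_ ?_ ?_ ?_
  · have h1 := (H.measurable_fderiv_comp hγ).stronglyMeasurable
    have h2 := hΛ.stronglyMeasurable
    have h3 : Continuous (fun q : (Space d →L[ℝ] ℝ) × (P →L[ℝ] Space d) => q.1.comp q.2) := by
      fun_prop
    exact (h3.comp_stronglyMeasurable (h1.prodMk h2)).aestronglyMeasurable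
  · refine Eventually.of_forall fun s _ => LipschitzOnWith.of_dist_le_mul fun p _ q _ => ?_
    rw [Real.coe_nnabs, abs_of_nonneg (mul_nonneg H.nonneg (norm_nonneg _)), Real.dist_eq,
      dist_eq_norm, mul_assoc]
    refine (H.lip _ _ _).trans (mul_le_mul_of_nonneg_left ?_ H.nonneg)
    rw [add_sub_add_left_eq_sub, ← map_sub]
    exact (Λ s).le_opNorm _
  · exact (continuous_const.mul hΛ.norm).intervalIntegrable _ _
  · refine Eventually.of_forall fun s _ => ?_
    have h1 : HasFDerivAt (ℓ s) (fderiv ℝ (ℓ s) (γ s)) (γ s + Λ s 0) := by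
      rw [map_zero, add_zero]
      exact ((H.contDiff s).differentiable one_ne_zero _).hasFDerivAt
    exact h1.comp (0 : P) ((Λ s).hasFDerivAt.const_add (γ s))

/-- Coercivity of the cost, relative to a curve with constant velocity. -/
theorem lagCost_line_le (H : CostData M ℓ h) (hγ : IsC1 γ w) {t : ℝ} (ht : t ∈ Icc 0 T)
    (v : Space d) :
    lagCost T ℓ h t (fun s => γ t + (s - t) • v) (fun _ => v) + 1 / 4 * ∫ s in t..T, ‖w s‖ ^ 2
      ≤ lagCost T ℓ h t γ w + (1 / 2 * ‖v‖ ^ 2 * T + M * (T + 1) * T * ‖v‖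
        + T * (M * (T + 1)) ^ 2) := by
  obtain ⟨h0, hT⟩ := ht
  have hM := H.nonneg
  have hl := IsC1.line t (γ t) v
  -- A uniform displacement by `B` changes the running and terminal costs together by at most `A *
  -- B`. Young's inequality A‖w‖ ≤ ‖w‖²/4 + A² then consumes half of the kinetic energy and leaves
  -- the other half on the left.
  set A := M * (T + 1) with hA
  have hT0 : 0 ≤ T := h0.trans hT
  have hA0 : 0 ≤ A := by positivity
  set B := (∫ s in t..T, ‖w s‖) + T * ‖v‖ with hB
  have hwi : ∀ a b, IntervalIntegrable (fun s => ‖w s‖) volume a b := fun a b =>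
    (hγ.continuous_velocity.norm).intervalIntegrable _ _
  have hw2 : ∀ a b, IntervalIntegrable (fun s => ‖w s‖ ^ 2) volume a b := fun a b =>
    (hγ.continuous_velocity.norm.pow 2).intervalIntegrable _ _
  have hBs : ∀ s ∈ Icc t T, ‖γ s - (γ t + (s - t) • v)‖ ≤ B := fun s hs => by
    have e : γ s - (γ t + (s - t) • v) = (γ s - γ t) - (s - t) • v := by abel
    rw [e]
    refine (norm_sub_le _ _).trans (add_le_add ((hγ.norm_sub_le hs.1).trans ?_) ?_)
    · exact intervalIntegral.integral_mono_interval le_rfl hs.1 hs.2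
        (Eventually.of_forall fun _ => norm_nonneg _) (hwi _ _)
    · rw [norm_smul, Real.norm_eq_abs, abs_of_nonneg (by linarith [hs.1])]
      exact mul_le_mul_of_nonneg_right (by linarith [hs.2]) (norm_nonneg _)
  have hB0 : 0 ≤ B := (norm_nonneg _).trans (hBs t ⟨le_rfl, hT⟩)
  have h1 := abs_le.1 (H.abs_integral_sub_le hγ.continuous hl.continuous hT hBs)
  have h2 := abs_le.1 ((H.lip_terminal (γ T) (γ t + (T - t) • v)).trans
    (mul_le_mul_of_nonneg_left (hBs T ⟨hT, le_rfl⟩) hM))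
  have h3 : M * B * (T - t) ≤ M * B * T := mul_le_mul_of_nonneg_left (by linarith) (by positivity)
  have h4 : ∫ s in t..T, (A * ‖w s‖) ≤ ∫ s in t..T, (1 / 4 * ‖w s‖ ^ 2 + A ^ 2) := by
    refine intervalIntegral.integral_mono_on hT ((hwi _ _).const_mul _)
      (((hw2 _ _).const_mul _).add intervalIntegrable_const) fun s _ => ?_
    nlinarith [sq_nonneg (‖w s‖ / 2 - A)]
  rw [intervalIntegral.integral_const_mul, intervalIntegral.integral_add
    ((hw2 _ _).const_mul _) intervalIntegrable_const, intervalIntegral.integral_const_mul,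
    intervalIntegral.integral_const, smul_eq_mul] at h4
  have h5 : (T - t) * A ^ 2 ≤ T * A ^ 2 := mul_le_mul_of_nonneg_right (by linarith) (sq_nonneg _)
  have h6 : 1 / 2 * ‖v‖ ^ 2 * (T - t) ≤ 1 / 2 * ‖v‖ ^ 2 * T :=
    mul_le_mul_of_nonneg_left (by linarith) (by positivity)
  unfold lagCost
  rw [intervalIntegral.integral_add ((hw2 _ _).const_mul _)
      ((H.continuous_comp hγ.continuous).intervalIntegrable _ _),
    intervalIntegral.integral_add intervalIntegrable_const
      ((H.continuous_comp hl.continuous).intervalIntegrable _ _),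
    intervalIntegral.integral_const, smul_eq_mul, intervalIntegral.integral_const_mul]
  have h7 : A * B = A * (∫ s in t..T, ‖w s‖) + A * T * ‖v‖ := by rw [hB]; ring
  have h8 : A * B = M * B * T + M * B := by rw [hA]; ring
  linarith [h1.1, h2.1]

end CostData

end

/-! ### Ascoli's theorem, integration by parts, the Euler-Lagrange velocity. -/

section

variable {d : ℕ}

/-- Arzelà-Ascoli with the common modulus `b`; the limit is continued by constants outside the
interval, to be continuous on the whole line. -/
theorem exists_subseq_tendstoUniformlyOn {T : ℝ} (hT : 0 ≤ T) {f : ℕ → ℝ → Space d} {R : ℝ}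
    {b : ℝ → ℝ} (hb : Tendsto b (𝓝 0) (𝓝 0)) (hR : ∀ n, ∀ t ∈ Icc 0 T, ‖f n t‖ ≤ R)
    (hf : ∀ n, ∀ s ∈ Icc 0 T, ∀ t ∈ Icc 0 T, ‖f n s - f n t‖ ≤ b |s - t|) :
    ∃ φ : ℕ → ℕ, StrictMono φ ∧ ∃ g : ℝ → Space d, Continuous g ∧
      TendstoUniformlyOn (fun k => f (φ k)) g atTop (Icc 0 T) := by
  have heq : UniformEquicontinuous (fun n (s : Icc (0 : ℝ) T) => f n s) :=
    Metric.uniformEquicontinuous_of_continuity_modulus b hb _ fun s t n => by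
      rw [dist_eq_norm]; exact hf n s s.2 t t.2
  have hc : ∀ n, Continuous (fun s : Icc (0 : ℝ) T => f n s) := fun n =>
    (heq.uniformContinuous n).continuous
  let F : ℕ → BoundedContinuousFunction (Icc (0 : ℝ) T) (Space d) := fun n =>
    BoundedContinuousFunction.mkOfCompact ⟨_, hc n⟩
  have hK : IsCompact (closure (range F)) := by
    refine BoundedContinuousFunction.arzela_ascoli (Metric.closedBall 0 R)
      (isCompact_closedBall _ _) _ ?_ ?_
    · rintro _ s ⟨n, rfl⟩
      rw [mem_closedBall_zero_iff]; exact hR n s s.2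
    · intro s U hU
      filter_upwards [heq.equicontinuous s U hU] with t ht
      rintro ⟨_, n, rfl⟩
      exact ht n
  obtain ⟨g, -, φ, hφ, hg⟩ := hK.tendsto_subseq (x := F) fun n => subset_closure ⟨n, rfl⟩
  refine ⟨φ, hφ, IccExtend hT g, g.continuous.Icc_extend', ?_⟩
  rw [BoundedContinuousFunction.tendsto_iff_tendstoUniformly] at hg
  rw [Metric.tendstoUniformlyOn_iff]
  intro η hη
  filter_upwards [Metric.tendstoUniformly_iff.1 hg η hη] with k hk s hs
  rw [IccExtend_of_mem hT _ hs]
  exact hk ⟨s, hs⟩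

/-- The boundary terms vanish because β does at 0 and the tail integral of `G` does at `T`. Since
`G` is merely bounded and measurable, its primitive is Lipschitz but not C¹, and the product rule
holds only almost everywhere. -/
theorem integral_inner_parts {T M : ℝ} (hT : 0 ≤ T) {G : ℝ → Space d} (hGm : Measurable G)
    (hG : ∀ s, ‖G s‖ ≤ M) {β u : ℝ → Space d} (hβ : IsC1 β u) (h0 : β 0 = 0) :
    ∫ t in 0..T, inner ℝ (∫ s in t..T, G s) (u t) = ∫ t in 0..T, inner ℝ (G t) (β t) := by
  have hGi : ∀ a b, IntervalIntegrable G volume a b := fun a b =>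
    (intervalIntegrable_const (c := M)).mono_fun hGm.aestronglyMeasurable
      (Eventually.of_forall fun s => (hG s).trans (le_abs_self M))
  have hM : 0 ≤ M := (norm_nonneg _).trans (hG 0)
  set I : ℝ → Space d := fun t => -∫ s in T..t, G s with hI
  have hIeq : ∀ t, (∫ s in t..T, G s) = I t := fun t => intervalIntegral.integral_symm _ _
  simp_rw [hIeq]
  have hIc : Continuous I := (intervalIntegral.continuous_primitive hGi T).neg
  have hi1 : IntervalIntegrable (fun t => inner ℝ (I t) (u t)) volume 0 T :=
    (hIc.inner hβ.continuous_velocity).intervalIntegrable _ _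
  obtain ⟨K, hK⟩ := (isCompact_Icc (a := (0 : ℝ)) (b := T)).exists_bound_of_continuousOn
    hβ.continuous.continuousOn
  obtain ⟨K', hK'⟩ := (isCompact_Icc (a := (0 : ℝ)) (b := T)).exists_bound_of_continuousOn
    hβ.continuous_velocity.continuousOn
  have hi2 : IntervalIntegrable (fun t => inner ℝ (G t) (β t)) volume 0 T := by
    refine (intervalIntegrable_const (c := M * K)).mono_fun
      (hGm.inner hβ.continuous.measurable).aestronglyMeasurable ?_
    filter_upwards [ae_restrict_mem measurableSet_uIoc] with t ht
    rw [uIoc_of_le hT] at ht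
    exact (norm_inner_le_norm _ _).trans
      ((mul_le_mul (hG t) (hK t ⟨ht.1.le, ht.2⟩) (norm_nonneg _) hM).trans (le_abs_self _))
  have hIlip : ∀ a b, ‖I a - I b‖ ≤ M * |a - b| := fun a b => by
    have : I a - I b = ∫ s in a..b, G s := by
      simp only [hI]
      rw [← intervalIntegral.integral_interval_sub_left (hGi T b) (hGi T a)]; abel
    rw [this, abs_sub_comm]
    exact intervalIntegral.norm_integral_le_of_norm_le_const fun s _ => hG s
  have hβlip : ∀ a ∈ Icc 0 T, ∀ b ∈ Icc 0 T, ‖β a - β b‖ ≤ K' * |a - b| := fun a ha b hb => by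
    rw [hβ.sub_eq_integral]
    refine intervalIntegral.norm_integral_le_of_norm_le_const fun s hs => hK' s ?_
    exact (uIcc_subset_Icc hb ha) (uIoc_subset_uIcc hs)
  have hac1 : AbsolutelyContinuousOnInterval (fun t => inner ℝ (I t) (β t)) 0 T := by
    refine LipschitzOnWith.absolutelyContinuousOnInterval
      (K := Real.toNNReal (M * K + M * T * K')) (LipschitzOnWith.of_dist_le_mul ?_)
    intro a ha b hb
    rw [uIcc_of_le hT] at ha hb
    have hK0 : 0 ≤ K := (norm_nonneg _).trans (hK a ha)
    have hK0' : 0 ≤ K' := (norm_nonneg _).trans (hK' a ha)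
    rw [Real.coe_toNNReal _ (by positivity), Real.dist_eq, Real.dist_eq]
    have e : inner ℝ (I a) (β a) - inner ℝ (I b) (β b)
        = inner ℝ (I a - I b) (β a) + inner ℝ (I b) (β a - β b) := by
      rw [inner_sub_left, inner_sub_right]; ring
    rw [e]
    have hIb : ‖I b‖ ≤ M * T := by
      have := hIlip b T
      rw [show I T = 0 by simp [hI], sub_zero] at this
      refine this.trans (mul_le_mul_of_nonneg_left ?_ hM)
      rw [abs_sub_comm, abs_of_nonneg (by linarith [hb.2])]; linarith [hb.1]
    calc |inner ℝ (I a - I b) (β a) + inner ℝ (I b) (β a - β b)|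
        ≤ ‖I a - I b‖ * ‖β a‖ + ‖I b‖ * ‖β a - β b‖ :=
          (abs_add_le _ _).trans (add_le_add (abs_real_inner_le_norm _ _)
            (abs_real_inner_le_norm _ _))
      _ ≤ (M * |a - b|) * K + (M * T) * (K' * |a - b|) := by
          gcongr
          · exact hIlip a b
          · exact hK a ha
          · exact hβlip a ha b hb
      _ = _ := by ring
  have hac2 := (hi2.sub hi1).absolutelyContinuousOnInterval_intervalIntegral (c := 0) (by simp)
  -- The product ⟨I, β⟩ plus the primitive of ⟨G, β⟩ - ⟨I, u⟩ is absolutely continuous with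
  -- derivative zero almost everywhere, hence constant; its values at 0 and `T` give the formula.
  obtain ⟨C, hC⟩ := (hac1.add hac2).const_of_ae_hasDerivAt_zero (by
    filter_upwards [(hGi 0 T).ae_hasDerivAt_integral, (hi2.sub hi1).ae_hasDerivAt_integral]
      with t h1 h2 ht
    have d1 : HasDerivAt I (-G t) t := (h1 ht T (by simp)).neg
    have d2 := h2 ht 0 (by simp)
    convert (d1.inner ℝ (hβ.hasDerivAt t)).add d2 using 1
    simp only [inner_neg_left]; ring)
  have e0 := hC 0 (by simp)
  have eT := hC T (by simp)
  have hIT : I T = 0 := by simp [hI]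
  simp only [Pi.add_apply, h0, hIT, inner_zero_left, inner_zero_right,
    intervalIntegral.integral_same] at e0 eT
  rw [intervalIntegral.integral_sub hi2 hi1] at eT
  linarith

/-- The velocity prescribed by the Euler-Lagrange equation along `γ`. -/
def eulerVelocity (T : ℝ) (ℓ : ℝ → Space d → ℝ) (h : Space d → ℝ) (γ : ℝ → Space d) (t : ℝ) :
    Space d :=
  -(∫ s in t..T, gradient (ℓ s) (γ s)) - gradient h (γ T)

namespace CostData

variable {M T : ℝ} {ℓ : ℝ → Space d → ℝ} {h : Space d → ℝ} {γ : ℝ → Space d}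

theorem norm_gradient_le (H : CostData M ℓ h) (s : ℝ) (x : Space d) :
    ‖gradient (ℓ s) x‖ ≤ M := by
  rw [gradient, LinearIsometryEquiv.norm_map]; exact H.norm_fderiv_le s x

theorem norm_gradient_terminal_le (H : CostData M ℓ h) (x : Space d) :
    ‖gradient h x‖ ≤ M := by
  rw [gradient, LinearIsometryEquiv.norm_map]; exact H.norm_fderiv_terminal_le x

theorem measurable_gradient_comp (H : CostData M ℓ h) (hγ : Continuous γ) :
    Measurable (fun s => gradient (ℓ s) (γ s)) :=
  (LinearIsometryEquiv.continuous _).measurable.comp (H.measurable_fderiv_comp hγ)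

theorem intervalIntegrable_gradient (H : CostData M ℓ h) (hγ : Continuous γ) (a b : ℝ) :
    IntervalIntegrable (fun s => gradient (ℓ s) (γ s)) volume a b :=
  (intervalIntegrable_const (c := M)).mono_fun (H.measurable_gradient_comp hγ).aestronglyMeasurable
    (Eventually.of_forall fun _ => (H.norm_gradient_le _ _).trans (le_abs_self M))

theorem continuous_eulerVelocity (H : CostData M ℓ h) (hγ : Continuous γ) :
    Continuous (eulerVelocity T ℓ h γ) := by
  have := intervalIntegral.continuous_primitive (H.intervalIntegrable_gradient hγ) T
  have e : eulerVelocity T ℓ h γ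
      = fun t => (∫ s in T..t, gradient (ℓ s) (γ s)) - gradient h (γ T) := by
    funext t; rw [eulerVelocity, intervalIntegral.integral_symm, neg_neg]
  rw [e]; fun_prop

end CostData

end

/-! ### Strong convergence of the velocities of minimizing sequences. -/

section

variable {d : ℕ}

namespace CostData

variable {M T : ℝ} {ℓ : ℝ → Space d → ℝ} {h : Space d → ℝ} {γ w : ℝ → Space d}

/-- The first variation of the potential part of the cost. -/
theorem hasDerivAt_potential (H : CostData M ℓ h) {γ β : ℝ → Space d} (hγ : Continuous γ)
    (hβ : Continuous β) :
    HasDerivAt (fun τ : ℝ => (∫ s in 0..T, ℓ s (γ s + τ • β s)) + h (γ T + τ • β T))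
      ((∫ s in 0..T, inner ℝ (gradient (ℓ s) (γ s)) (β s))
        + inner ℝ (gradient h (γ T)) (β T)) 0 := by
  have hΛ : Continuous fun s => ContinuousLinearMap.toSpanSingleton ℝ (β s) :=
    (ContinuousLinearMap.toSpanSingletonCLE (𝕜 := ℝ) (E := Space d)).continuous.comp hβ
  obtain ⟨hi, hd⟩ := H.hasFDerivAt_integral hγ hΛ 0 T
  have h1 := hd.hasDerivAt
  rw [ContinuousLinearMap.intervalIntegral_apply hi] at h1
  simp only [ContinuousLinearMap.comp_apply, ContinuousLinearMap.toSpanSingleton_apply,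
    one_smul] at h1
  have h2 : HasDerivAt (fun τ : ℝ => h (γ T + τ • β T)) (fderiv ℝ h (γ T) (β T)) 0 := by
    have hh : HasFDerivAt h (fderiv ℝ h (γ T)) (γ T + (0 : ℝ) • β T) := by
      rw [zero_smul, add_zero]
      exact (H.contDiff_terminal.differentiable one_ne_zero _).hasFDerivAt
    have := ((hasDerivAt_id (0 : ℝ)).smul_const (β T)).const_add (γ T)
    simp only [id, one_smul] at this
    exact hh.comp_hasDerivAt (0 : ℝ) this
  simp only [inner_gradient_left]
  exact h1.add h2

/-- A quantitative comparison of an almost minimizing velocity with the Euler-Lagrange velocity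
of a nearby curve. -/
theorem integral_sub_eulerVelocity_le (H : CostData M ℓ h) (hT : 0 ≤ T) {x : Space d}
    (hγ : Continuous γ) {σ u : ℝ → Space d} (hσ : IsC1 σ u) (h0 : σ 0 = x) {m : ℝ}
    (hm : ∀ β β', IsC1 β β' → β 0 = x → m ≤ lagCost T ℓ h 0 β β') {e : ℝ}
    (he : ∀ s ∈ Icc 0 T, ‖σ s - γ s‖ ≤ e) {τ : ℝ} (hτ : 0 ≤ τ) (hτ1 : τ ≤ 1) {β : ℝ → Space d}
    (hβ : ∀ s, β s = (∫ r in 0..s, eulerVelocity T ℓ h γ r) - (γ s - x)) :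
    τ / 2 * ∫ s in 0..T, ‖u s - eulerVelocity T ℓ h γ s‖ ^ 2 ≤
      (lagCost T ℓ h 0 σ u - m) + 4 * M * (T + 1) * e
      + (((∫ s in 0..T, ℓ s (γ s + τ • β s)) + h (γ T + τ • β T))
        - ((∫ s in 0..T, ℓ s (γ s)) + h (γ T))
        - τ * ((∫ s in 0..T, inner ℝ (gradient (ℓ s) (γ s)) (β s))
        + inner ℝ (gradient h (γ T)) (β T))) := by
  have hM := H.nonneg
  set W := eulerVelocity T ℓ h γ with hW
  have hWc : Continuous W := H.continuous_eulerVelocity hγ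
  have hT' : T ∈ Icc 0 T := ⟨hT, le_rfl⟩
  have he0 : 0 ≤ e := (norm_nonneg _).trans (he T hT')
  have hB := IsC1.of_integral hWc 0 x
  -- The competitor σ + τβ' has velocity u + τ(W - u), between the given velocity and the
  -- Euler-Lagrange one. It is not the perturbation `β` of the statement, which starts from `γ` and
  -- does not depend on σ, but the two differ by at most `e`.
  set β' : ℝ → Space d := fun s => (∫ r in 0..s, W r) - (σ s - x) with hβ'
  have hβc : IsC1 β' (fun s => W s - u s) := by
    have := hB.add (hσ.const_smul (-1))
    convert this using 2 with s s
    · simp only [hβ', neg_smul, one_smul]; abel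
    · simp only [neg_smul, one_smul]; abel
  have hβ0 : β' 0 = 0 := by simp [hβ', h0]
  have hβcont : Continuous β := by
    have : β = fun s => (x + ∫ r in 0..s, W r) - γ s := by funext s; rw [hβ]; abel
    rw [this]; exact hB.continuous.sub hγ
  have hcomp := hσ.add (hβc.const_smul τ)
  have hββ : ∀ s, β' s - β s = -(σ s - γ s) := fun s => by
    rw [hβ]; simp only [hβ']; abel
  have key := hm _ _ hcomp (by simp [hβ0, h0])
  unfold lagCost at key ⊢
  have hu2 : IntervalIntegrable (fun s => 1 / 2 * ‖u s‖ ^ 2) volume 0 T :=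
    (continuous_const.mul (hσ.continuous_velocity.norm.pow 2)).intervalIntegrable _ _
  have hc2 : IntervalIntegrable (fun s => 1 / 2 * ‖u s + τ • (W s - u s)‖ ^ 2) volume 0 T :=
    (continuous_const.mul (hcomp.continuous_velocity.norm.pow 2)).intervalIntegrable _ _
  have hWu : Continuous fun s => inner ℝ (W s) (W s - u s) :=
    hWc.inner (hWc.sub hσ.continuous_velocity)
  have hd2 : Continuous fun s => ‖u s - W s‖ ^ 2 := (hσ.continuous_velocity.sub hWc).norm.pow 2
  rw [intervalIntegral.integral_add hc2
    ((H.continuous_comp hcomp.continuous).intervalIntegrable _ _)] at key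
  rw [intervalIntegral.integral_add hu2
    ((H.continuous_comp hσ.continuous).intervalIntegrable _ _)]
  have hi1 : IntervalIntegrable (fun s => τ * inner ℝ (W s) (W s - u s)) volume 0 T :=
    (continuous_const.mul hWu).intervalIntegrable _ _
  have hi2 : IntervalIntegrable (fun s => τ / 2 * ‖u s - W s‖ ^ 2) volume 0 T :=
    (continuous_const.mul hd2).intervalIntegrable _ _
  have hi3 : IntervalIntegrable (fun s => τ * inner ℝ (W s) (W s - u s)
      - τ / 2 * ‖u s - W s‖ ^ 2) volume 0 T := hi1.sub hi2
  -- Expanding around `W` instead of `u` produces -τ‖W - u‖², of which τ ≤ 1 allows at most half to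
  -- be lost to the quadratic term.
  have hkin : ∫ s in 0..T, 1 / 2 * ‖u s + τ • (W s - u s)‖ ^ 2 ≤
      ∫ s in 0..T, (1 / 2 * ‖u s‖ ^ 2 + (τ * inner ℝ (W s) (W s - u s)
        - τ / 2 * ‖u s - W s‖ ^ 2)) := by
    refine intervalIntegral.integral_mono_on hT hc2 (hu2.add hi3)
      fun s _ => ?_
    have e1 : inner ℝ (W s) (W s - u s) = inner ℝ (u s) (W s - u s) + ‖W s - u s‖ ^ 2 := by
      rw [← real_inner_self_eq_norm_sq, ← inner_add_left]; congr 1; abel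
    rw [norm_add_sq_real, inner_smul_right, norm_smul, e1, norm_sub_rev (u s),
      Real.norm_eq_abs, abs_of_nonneg hτ]
    nlinarith [sq_nonneg ‖W s - u s‖, mul_nonneg hτ (sub_nonneg.2 hτ1)]
  rw [intervalIntegral.integral_add hu2 hi3, intervalIntegral.integral_sub hi1 hi2,
    intervalIntegral.integral_const_mul τ,
    intervalIntegral.integral_const_mul (τ / 2)] at hkin
  set G := fun s => gradient (ℓ s) (γ s) with hG
  set P := gradient h (γ T) with hP
  have hGm : Measurable G := H.measurable_gradient_comp hγ
  have hGM : ∀ s, ‖G s‖ ≤ M := fun s => H.norm_gradient_le _ _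
  have hPM : ‖P‖ ≤ M := H.norm_gradient_terminal_le _
  have hGint : ∀ {f : ℝ → Space d}, Continuous f →
      IntervalIntegrable (fun s => inner ℝ (G s) (f s)) volume 0 T := fun {f} hf => by
    refine (hf.norm.const_mul M |>.intervalIntegrable 0 T).mono_fun
      (hGm.inner hf.measurable).aestronglyMeasurable (Eventually.of_forall fun s => ?_)
    have h1 : (0 : ℝ) ≤ M * ‖f s‖ := by positivity
    change ‖inner ℝ (G s) (f s)‖ ≤ ‖M * ‖f s‖‖
    rw [Real.norm_of_nonneg h1]
    exact (norm_inner_le_norm _ _).trans (mul_le_mul_of_nonneg_right (hGM s) (norm_nonneg _))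
  -- By the choice of `W`, the linear part of the kinetic energy is minus the first variation of the
  -- potential part. The first-order terms cancel, up to replacing σ, β' by γ, β.
  have hparts : ∫ s in 0..T, inner ℝ (W s) (W s - u s)
      = -((∫ s in 0..T, inner ℝ (G s) (β' s)) + inner ℝ P (β' T)) := by
    rw [← integral_inner_parts hT hGm hGM hβc hβ0]
    have h1 : ∀ s, inner ℝ (W s) (W s - u s)
        = -(inner ℝ (∫ r in s..T, G r) (W s - u s)) - inner ℝ P (W s - u s) := fun s => by
      rw [← inner_neg_left, ← inner_sub_left]; rfl
    simp_rw [h1]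
    have hIc : Continuous fun s => ∫ r in s..T, G r :=
      (intervalIntegral.continuous_primitive (H.intervalIntegrable_gradient hγ) T).neg.congr
        fun s => (intervalIntegral.integral_symm _ _).symm
    rw [intervalIntegral.integral_sub, intervalIntegral.integral_neg]
    · have h2 : ∫ s in 0..T, inner ℝ P (W s - u s) = inner ℝ P (β' T) := by
        have h3 := hβc.sub_eq_integral 0 T
        rw [hβ0, sub_zero] at h3
        rw [h3]
        exact (innerSL ℝ P).intervalIntegral_comp_comm
          (hβc.continuous_velocity.intervalIntegrable _ _)
      rw [h2]; ring
    · exact ((hIc.inner hβc.continuous_velocity).neg).intervalIntegrable _ _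
    · exact (continuous_const.inner hβc.continuous_velocity).intervalIntegrable _ _
  have hnum : ∀ s ∈ Icc 0 T, ‖β' s - β s‖ ≤ e := fun s hs => by
    rw [hββ, norm_neg]; exact he s hs
  have hDdiff : |((∫ s in 0..T, inner ℝ (G s) (β' s)) + inner ℝ P (β' T))
      - ((∫ s in 0..T, inner ℝ (G s) (β s)) + inner ℝ P (β T))| ≤ M * (T + 1) * e := by
    rw [add_sub_add_comm, ← intervalIntegral.integral_sub (hGint hβc.continuous) (hGint hβcont),
      ← inner_sub_right]
    refine (abs_add_le _ _).trans ?_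
    have h1 : |∫ s in 0..T, (inner ℝ (G s) (β' s) - inner ℝ (G s) (β s))| ≤ M * e * |T - 0| := by
      rw [← Real.norm_eq_abs]
      refine intervalIntegral.norm_integral_le_of_norm_le_const fun s hs => ?_
      rw [uIoc_of_le hT] at hs
      rw [← inner_sub_right]
      exact (norm_inner_le_norm _ _).trans
        (mul_le_mul (hGM s) (hnum s ⟨hs.1.le, hs.2⟩) (norm_nonneg _) hM)
    have h2 : |inner ℝ P (β' T - β T)| ≤ M * e := (abs_real_inner_le_norm _ _).trans
        (mul_le_mul hPM (hnum T hT') (norm_nonneg _) hM)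
    rw [sub_zero, abs_of_nonneg hT] at h1
    linarith
  have hd : ∀ s ∈ Icc 0 T, ‖(σ s + τ • β' s) - (γ s + τ • β s)‖ ≤ e := fun s hs => by
    have e1 : (σ s + τ • β' s) - (γ s + τ • β s) = (1 - τ) • (σ s - γ s) := by
      have := hββ s
      have e2 : (σ s + τ • β' s) - (γ s + τ • β s) = (σ s - γ s) + τ • (β' s - β s) := by
        rw [smul_sub τ (β' s) (β s)]
        exact add_sub_add_comm (σ s) (τ • β' s) (γ s) (τ • β s)
      rw [e2, this, smul_neg, sub_smul, one_smul]; exact (sub_eq_add_neg _ _).symm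
    rw [e1, norm_smul, Real.norm_eq_abs, abs_of_nonneg (by linarith)]
    have := he s hs
    nlinarith [norm_nonneg (σ s - γ s)]
  have hc' : Continuous fun s => γ s + τ • β s := hγ.add (hβcont.const_smul τ)
  have p1 := abs_le.1 (H.abs_integral_sub_le hcomp.continuous hc' hT hd)
  have p2 := abs_le.1 (H.abs_integral_sub_le hσ.continuous hγ hT he)
  have p3 := abs_le.1 ((H.lip_terminal (σ T + τ • β' T) (γ T + τ • β T)).trans
    (mul_le_mul_of_nonneg_left (hd T hT') hM))
  have p4 := abs_le.1 ((H.lip_terminal (σ T) (γ T)).trans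
    (mul_le_mul_of_nonneg_left (he T hT') hM))
  have p5 := abs_le.1 hDdiff
  rw [hparts] at hkin
  set Dk := (∫ s in 0..T, inner ℝ (G s) (β' s)) + inner ℝ P (β' T)
  set D := (∫ s in 0..T, inner ℝ (G s) (β s)) + inner ℝ P (β T)
  have p6 : τ * (D - Dk) ≤ M * (T + 1) * e := by
    have : 0 ≤ M * (T + 1) * e := by positivity
    nlinarith [p5.1, p5.2]
  nlinarith [p1.1, p1.2, p2.1, p2.2, p3.1, p3.2, p4.1, p4.2]

/-- The velocities of an almost minimizing, uniformly convergent sequence of curves converge. -/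
theorem tendsto_integral_sub_eulerVelocity (H : CostData M ℓ h) (hT : 0 ≤ T) {x : Space d}
    (hγ : Continuous γ) {σ u : ℕ → ℝ → Space d} (hσ : ∀ k, IsC1 (σ k) (u k))
    (h0 : ∀ k, σ k 0 = x) {m : ℝ}
    (hm : ∀ β β', IsC1 β β' → β 0 = x → m ≤ lagCost T ℓ h 0 β β')
    (hlim : Tendsto (fun k => lagCost T ℓ h 0 (σ k) (u k)) atTop (𝓝 m))
    (hunif : TendstoUniformlyOn σ γ atTop (Icc 0 T)) :
    Tendsto (fun k => ∫ s in 0..T, ‖u k s - eulerVelocity T ℓ h γ s‖ ^ 2) atTop (𝓝 0) := by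
  have hM := H.nonneg
  set β : ℝ → Space d := fun s => (∫ r in 0..s, eulerVelocity T ℓ h γ r) - (γ s - x) with hβ
  have hβc : Continuous β := by
    have := (IsC1.of_integral (H.continuous_eulerVelocity (T := T) hγ) 0 0).continuous
    simp only [zero_add] at this
    exact this.sub (hγ.sub continuous_const)
  have hder := (H.hasDerivAt_potential (T := T) hγ hβc)
  rw [hasDerivAt_iff_isLittleO_nhds_zero] at hder
  have hnn : ∀ k, 0 ≤ ∫ s in 0..T, ‖u k s - eulerVelocity T ℓ h γ s‖ ^ 2 := fun k =>
    intervalIntegral.integral_nonneg hT fun s _ => sq_nonneg _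
  rw [Metric.tendsto_atTop']
  intro η hη
  obtain ⟨δ, hδ, hr⟩ := Metric.eventually_nhds_iff.1
    (hder.def (show (0 : ℝ) < η / 8 by positivity))
  -- The order of choices matters: τ makes the Taylor remainder of the potential at most τη/8; then
  -- the distance `e`, and then the excess of cost, are made small compared with this fixed τη.
  set τ := min (δ / 2) 1 with hτ
  have hτ0 : 0 < τ := by positivity
  have hrτ := hr (y := τ) (by
    rw [dist_zero_right, Real.norm_eq_abs, abs_of_pos hτ0]
    exact (min_le_left _ _).trans_lt (by linarith))
  simp only [zero_add, zero_smul, add_zero, smul_eq_mul, Real.norm_eq_abs, abs_of_pos hτ0] at hrτ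
  have hrτ' := (abs_le.1 hrτ).2
  set e := τ * η / (32 * (M + 1) * (T + 1)) with he
  have he0 : 0 < e := by positivity
  have heM : 4 * M * (T + 1) * e ≤ τ * η / 8 := by
    have : 32 * (M + 1) * (T + 1) * e = τ * η := by rw [he]; field_simp
    nlinarith [mul_pos (show (0 : ℝ) < T + 1 by positivity) he0]
  have hev := (Metric.tendstoUniformlyOn_iff.1 hunif e he0).and
    (hlim.eventually (gt_mem_nhds (show m < m + τ * η / 8 by
      have := mul_pos hτ0 hη; linarith)))
  obtain ⟨N, hN⟩ := eventually_atTop.1 hev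
  refine ⟨N, fun k hk => ?_⟩
  obtain ⟨hk1, hk2⟩ := hN k hk.le
  have := H.integral_sub_eulerVelocity_le hT hγ (hσ k) (h0 k) hm (e := e)
    (fun s hs => by rw [← dist_eq_norm, dist_comm]; exact (hk1 s hs).le) hτ0.le
    (min_le_right _ _) (β := β) (fun s => rfl)
  rw [Real.dist_eq, sub_zero, abs_of_nonneg (hnn k)]
  set S := ∫ s in 0..T, ‖u k s - eulerVelocity T ℓ h γ s‖ ^ 2
  have : τ * S < τ * η := by nlinarith
  exact lt_of_mul_lt_mul_left this hτ0.le

end CostData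

end

/-! ### The direct method and the Euler-Lagrange equation. -/

section

variable {d : ℕ}

theorem sq_integral_le_mul_integral_sq {f : ℝ → ℝ} {a b : ℝ} (hab : a ≤ b)
    (hf : IntervalIntegrable f volume a b) (hf2 : IntervalIntegrable (fun s => f s ^ 2) volume a b) :
    (∫ s in a..b, f s) ^ 2 ≤ (b - a) * ∫ s in a..b, f s ^ 2 := by
  rcases hab.eq_or_lt with rfl | hlt
  · simp
  set A := ∫ s in a..b, f s with hA
  have h0 : 0 ≤ ∫ s in a..b, ((b - a) ^ 2 * f s ^ 2 - 2 * (b - a) * A * f s + A ^ 2) :=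
    intervalIntegral.integral_nonneg hab fun s _ => by
      have := sq_nonneg ((b - a) * f s - A); nlinarith
  have i1 := hf2.const_mul ((b - a) ^ 2)
  have i2 := hf.const_mul (2 * (b - a) * A)
  rw [intervalIntegral.integral_add (i1.sub i2) intervalIntegrable_const,
    intervalIntegral.integral_sub i1 i2, intervalIntegral.integral_const_mul,
    intervalIntegral.integral_const_mul, intervalIntegral.integral_const, smul_eq_mul, ← hA] at h0
  have h1 : 0 ≤ (b - a) * ((b - a) * (∫ s in a..b, f s ^ 2) - A ^ 2) := by nlinarith
  have := nonneg_of_mul_nonneg_right h1 (sub_pos.2 hlt)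
  linarith

namespace IsC1

variable {γ w β w' : ℝ → Space d}

theorem sub (h : IsC1 γ w) (h' : IsC1 β w') :
    IsC1 (fun s => γ s - β s) (fun s => w s - w' s) :=
  ⟨h.continuous_velocity.sub h'.continuous_velocity,
    fun s => (h.hasDerivAt s).sub (h'.hasDerivAt s)⟩

theorem intervalIntegrable_sq (h : IsC1 γ w) (a b : ℝ) :
    IntervalIntegrable (fun s => ‖w s‖ ^ 2) volume a b :=
  (h.continuous_velocity.norm.pow 2).intervalIntegrable _ _

theorem integral_norm_le_sqrt (h : Continuous w) {a b : ℝ} (hab : a ≤ b) :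
    ∫ s in a..b, ‖w s‖ ≤ √((b - a) * ∫ s in a..b, ‖w s‖ ^ 2) :=
  Real.le_sqrt_of_sq_le (sq_integral_le_mul_integral_sq hab
    (h.norm.intervalIntegrable _ _) ((h.norm.pow 2).intervalIntegrable _ _))

theorem norm_sub_le_sqrt (h : IsC1 γ w) {T Q : ℝ} (hQ : ∫ s in 0..T, ‖w s‖ ^ 2 ≤ Q) {s t : ℝ}
    (hs : s ∈ Icc 0 T) (ht : t ∈ Icc 0 T) : ‖γ s - γ t‖ ≤ √(|s - t| * Q) := by
  wlog hst : s ≤ t generalizing s t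
  · rw [norm_sub_rev, abs_sub_comm]; exact this ht hs (le_of_not_ge hst)
  rw [norm_sub_rev, abs_sub_comm, abs_of_nonneg (sub_nonneg.2 hst)]
  refine ((h.norm_sub_le hst).trans (integral_norm_le_sqrt h.continuous_velocity hst)).trans
    (Real.sqrt_le_sqrt (mul_le_mul_of_nonneg_left (le_trans ?_ hQ) (sub_nonneg.2 hst)))
  exact intervalIntegral.integral_mono_interval hs.1 hst ht.2
    (Eventually.of_forall fun _ => sq_nonneg _)
    ((h.continuous_velocity.norm.pow 2).intervalIntegrable _ _)

end IsC1

/-- `γ` minimizes the cost among all `C¹` curves with the same initial point. -/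
structure IsMinimizer (T : ℝ) (ℓ : ℝ → Space d → ℝ) (h : Space d → ℝ) (γ w : ℝ → Space d) :
    Prop where
  isC1 : IsC1 γ w
  le : ∀ β β', IsC1 β β' → β 0 = γ 0 → lagCost T ℓ h 0 γ w ≤ lagCost T ℓ h 0 β β'

theorem eulerVelocity_congr {T : ℝ} (hT : 0 ≤ T) {ℓ : ℝ → Space d → ℝ} {h : Space d → ℝ}
    {γ σ : ℝ → Space d} (hγ : ∀ s ∈ Icc 0 T, γ s = σ s) {t : ℝ} (ht : t ∈ Icc 0 T) :
    eulerVelocity T ℓ h γ t = eulerVelocity T ℓ h σ t := by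
  unfold eulerVelocity
  rw [hγ T ⟨hT, le_rfl⟩, intervalIntegral.integral_congr fun s hs => ?_]
  rw [uIcc_of_le ht.2] at hs
  simp only [hγ s ⟨ht.1.trans hs.1, hs.2⟩]

namespace CostData

variable {M T : ℝ} {ℓ : ℝ → Space d → ℝ} {h : Space d → ℝ} {γ w : ℝ → Space d}

/-- The potential terms are Lipschitz in the position. For the kinetic term, ‖u‖² - ‖w‖² = ‖u - w‖²
+ 2⟨w, u - w⟩ with `w` bounded on the interval, so that Cauchy-Schwarz suffices. -/
theorem tendsto_lagCost (H : CostData M ℓ h) (hT : 0 ≤ T) (hγ : IsC1 γ w)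
    {σ u : ℕ → ℝ → Space d} (hσ : ∀ k, IsC1 (σ k) (u k))
    (hunif : TendstoUniformlyOn σ γ atTop (Icc 0 T))
    (hL2 : Tendsto (fun k => ∫ s in 0..T, ‖u k s - w s‖ ^ 2) atTop (𝓝 0)) :
    Tendsto (fun k => lagCost T ℓ h 0 (σ k) (u k)) atTop (𝓝 (lagCost T ℓ h 0 γ w)) := by
  have hL2' : Tendsto (fun k => ∫ s in 0..T, ‖u k s‖ ^ 2) atTop
      (𝓝 (∫ s in 0..T, ‖w s‖ ^ 2)) := by
    obtain ⟨K, hK⟩ := (isCompact_Icc (a := (0 : ℝ)) (b := T)).exists_bound_of_continuousOn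
      hγ.continuous_velocity.continuousOn
    rw [tendsto_iff_dist_tendsto_zero]
    have hz : Tendsto (fun k => (∫ s in 0..T, ‖u k s - w s‖ ^ 2)
        + 2 * K * √((T - 0) * ∫ s in 0..T, ‖u k s - w s‖ ^ 2)) atTop (𝓝 0) := by
      have := hL2.add (((hL2.const_mul (T - 0)).sqrt).const_mul (2 * K))
      simpa using this
    refine squeeze_zero (fun _ => dist_nonneg) (fun k => ?_) hz
    have hc := (hσ k).sub hγ
    have hd := hc.continuous_velocity
    rw [Real.dist_eq, ← intervalIntegral.integral_sub
      ((hσ k).intervalIntegrable_sq _ _) (hγ.intervalIntegrable_sq _ _)]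
    refine (intervalIntegral.abs_integral_le_integral_abs hT).trans ?_
    have i1 : IntervalIntegrable (fun s => ‖u k s - w s‖ ^ 2) volume 0 T :=
      (hd.norm.pow 2).intervalIntegrable _ _
    have i2 : IntervalIntegrable (fun s => 2 * K * ‖u k s - w s‖) volume 0 T :=
      (continuous_const.mul hd.norm).intervalIntegrable _ _
    refine (intervalIntegral.integral_mono_on hT ?_ (i1.add i2) fun s hs => ?_).trans ?_
    · exact (((hσ k).continuous_velocity.norm.pow 2).sub
        (hγ.continuous_velocity.norm.pow 2)).abs.intervalIntegrable _ _
    · have e1 : ‖u k s‖ ^ 2 - ‖w s‖ ^ 2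
          = ‖u k s - w s‖ ^ 2 + 2 * inner ℝ (w s) (u k s - w s) := by
        have := norm_add_sq_real (w s) (u k s - w s)
        rw [add_sub_cancel] at this; linarith
      rw [e1]
      refine (abs_add_le _ _).trans (add_le_add (abs_of_nonneg (sq_nonneg _)).le ?_)
      rw [abs_mul, abs_two, mul_assoc]
      exact mul_le_mul_of_nonneg_left ((abs_real_inner_le_norm _ _).trans
        (mul_le_mul_of_nonneg_right (hK s hs) (norm_nonneg _))) zero_le_two
    · have hK0 : 0 ≤ K := (norm_nonneg _).trans (hK T ⟨hT, le_rfl⟩)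
      rw [intervalIntegral.integral_add i1 i2, intervalIntegral.integral_const_mul]
      exact add_le_add_right (mul_le_mul_of_nonneg_left
        (IsC1.integral_norm_le_sqrt hd hT) (by positivity)) _
  have hpot : Tendsto (fun k => ∫ s in 0..T, ℓ s (σ k s)) atTop (𝓝 (∫ s in 0..T, ℓ s (γ s))) := by
    rw [Metric.tendsto_atTop']
    intro η hη
    have he : 0 < η / ((M + 1) * (T + 1)) := by have := H.nonneg; positivity
    obtain ⟨N, hN⟩ := eventually_atTop.1 (Metric.tendstoUniformlyOn_iff.1 hunif _ he)
    refine ⟨N, fun k hk => ?_⟩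
    rw [Real.dist_eq]
    refine (H.abs_integral_sub_le (hσ k).continuous hγ.continuous hT
      (B := η / ((M + 1) * (T + 1))) fun s hs => ?_).trans_lt ?_
    · rw [← dist_eq_norm, dist_comm]; exact (hN k hk.le s hs).le
    · have hM := H.nonneg
      rw [sub_zero, mul_div_assoc', div_mul_eq_mul_div, div_lt_iff₀ (by positivity)]
      nlinarith [mul_nonneg hM hT, mul_nonneg hη.le hM, mul_nonneg hη.le hT]
  have hter : Tendsto (fun k => h (σ k T)) atTop (𝓝 (h (γ T))) :=
    (H.contDiff_terminal.continuous.tendsto _).comp (hunif.tendsto_at ⟨hT, le_rfl⟩)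
  have e : ∀ {β β' : ℝ → Space d}, IsC1 β β' → lagCost T ℓ h 0 β β'
      = 1 / 2 * (∫ s in 0..T, ‖β' s‖ ^ 2) + (∫ s in 0..T, ℓ s (β s)) + h (β T) :=
    fun {β β'} hβ => by
      unfold lagCost
      rw [intervalIntegral.integral_add
        ((hβ.intervalIntegrable_sq _ _).const_mul _)
        ((H.continuous_comp hβ.continuous).intervalIntegrable _ _),
        intervalIntegral.integral_const_mul]
  rw [e hγ]
  simp_rw [fun k => e (hσ k)]
  exact ((hL2'.const_mul _).add hpot).add hter

/-- Minimizing sequences of curves with a fixed initial point are relatively compact. -/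
theorem exists_subseq_minimizer (H : CostData M ℓ h) (hT : 0 ≤ T) {x : Space d}
    {σ u : ℕ → ℝ → Space d} (hσ : ∀ k, IsC1 (σ k) (u k))
    (h0 : ∀ k, σ k 0 = x) {m : ℝ}
    (hm : ∀ β β', IsC1 β β' → β 0 = x → m ≤ lagCost T ℓ h 0 β β')
    (hlim : Tendsto (fun k => lagCost T ℓ h 0 (σ k) (u k)) atTop (𝓝 m)) :
    ∃ φ : ℕ → ℕ, StrictMono φ ∧ ∃ γ w, IsMinimizer T ℓ h γ w ∧ γ 0 = x ∧
      (∀ t ∈ Icc 0 T, w t = eulerVelocity T ℓ h γ t) ∧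
      TendstoUniformlyOn (fun k => σ (φ k)) γ atTop (Icc 0 T) ∧
      Tendsto (fun k => ∫ s in 0..T, ‖u (φ k) s - w s‖ ^ 2) atTop (𝓝 0) := by
  obtain ⟨B, hB⟩ := hlim.bddAbove_range
  have hB : ∀ k, lagCost T ℓ h 0 (σ k) (u k) ≤ B := fun k => hB ⟨k, rfl⟩
  -- The energy bound comes from coercivity relative to the constant curve at `x`, whose cost is at
  -- least `m`.
  set Q := 4 * (B - m + T * (M * (T + 1)) ^ 2) with hQ
  have hQk : ∀ k, ∫ s in 0..T, ‖u k s‖ ^ 2 ≤ Q := fun k => by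
    have h1 := H.lagCost_line_le (hσ k) (t := 0) (T := T) ⟨le_rfl, hT⟩ 0
    have h2 := hm _ _ (IsC1.line 0 (σ k 0) 0) (by simp [h0])
    have h3 := hB k
    simp only [norm_zero] at h1
    rw [hQ]; linarith
  have hmod : Tendsto (fun r : ℝ => √(r * Q)) (𝓝 0) (𝓝 0) := by
    have : Continuous fun r : ℝ => √(r * Q) := by fun_prop
    simpa using this.tendsto 0
  have h0T : (0 : ℝ) ∈ Icc 0 T := ⟨le_rfl, hT⟩
  obtain ⟨φ, hφ, g, hg, hunif⟩ := exists_subseq_tendstoUniformlyOn hT (f := σ)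
    (R := √(T * Q) + ‖x‖) hmod (fun k t ht => by
      have h1 := (hσ k).norm_sub_le_sqrt (hQk k) ht h0T
      rw [h0, sub_zero, abs_of_nonneg ht.1] at h1
      have hQ0 : 0 ≤ Q := (intervalIntegral.integral_nonneg hT fun s _ => sq_nonneg _).trans
        (hQk 0)
      have h2 : √(t * Q) ≤ √(T * Q) :=
        Real.sqrt_le_sqrt (mul_le_mul_of_nonneg_right ht.2 hQ0)
      have h3 := norm_sub_norm_le (σ k t) x
      linarith) (fun k s hs t ht => (hσ k).norm_sub_le_sqrt (hQk k) hs ht)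
  have hlim' := hlim.comp hφ.tendsto_atTop
  have hL2 := H.tendsto_integral_sub_eulerVelocity hT hg (σ := fun k => σ (φ k))
    (u := fun k => u (φ k)) (fun k => hσ _) (fun k => h0 _) hm hlim' hunif
  set W := eulerVelocity T ℓ h g with hW
  have hγ := IsC1.of_integral (H.continuous_eulerVelocity (T := T) hg) 0 x
  -- The Ascoli limit `g` is only continuous, so it is replaced by the curve with velocity `W`. The
  -- two agree on [0, T], because the velocities converge to `W` in L² and hence the positions to
  -- this integral.
  set γ : ℝ → Space d := fun s => x + ∫ r in 0..s, W r with hγdef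
  have hγ0 : γ 0 = x := by simp [hγdef]
  have heq : ∀ t ∈ Icc 0 T, g t = γ t := fun t ht => by
    refine tendsto_nhds_unique (hunif.tendsto_at ht) ?_
    rw [tendsto_iff_norm_sub_tendsto_zero]
    have hz : Tendsto (fun k => √(|t - 0| * ∫ s in 0..T, ‖u (φ k) s - W s‖ ^ 2)) atTop (𝓝 0) := by
      simpa using (hL2.const_mul (|t - 0|)).sqrt
    refine squeeze_zero (fun _ => norm_nonneg _) (fun k => ?_) hz
    have := ((hσ (φ k)).sub hγ).norm_sub_le_sqrt (T := T) le_rfl ht h0T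
    simpa [h0, hγ0] using this
  have hunif' : TendstoUniformlyOn (fun k => σ (φ k)) γ atTop (Icc 0 T) :=
    hunif.congr_right heq
  have hval : lagCost T ℓ h 0 γ W = m := tendsto_nhds_unique
    (H.tendsto_lagCost hT hγ (fun k => hσ (φ k)) hunif' hL2) hlim'
  refine ⟨φ, hφ, γ, W, ⟨hγ, fun β β' hβ hβ0 => ?_⟩, hγ0, fun t ht => ?_, hunif', hL2⟩
  · rw [hval]; exact hm β β' hβ (hβ0.trans hγ0)
  · exact eulerVelocity_congr hT heq ht

theorem lagCost_bddBelow (H : CostData M ℓ h) {t : ℝ} (ht : t ∈ Icc 0 T) (x : Space d) :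
    BddBelow {c | ∃ γ w : ℝ → Space d, IsC1 γ w ∧ γ t = x ∧ c = lagCost T ℓ h t γ w} := by
  refine ⟨lagCost T ℓ h t (fun s => x + (s - t) • (0 : Space d)) (fun _ => 0)
    - T * (M * (T + 1)) ^ 2, ?_⟩
  rintro _ ⟨γ, w, hγ, rfl, rfl⟩
  have h1 := H.lagCost_line_le hγ ht 0
  have h2 : 0 ≤ ∫ s in t..T, ‖w s‖ ^ 2 :=
    intervalIntegral.integral_nonneg ht.2 fun _ _ => sq_nonneg _
  simp only [norm_zero] at h1
  linarith

/-- The infimum is attained within C¹ although bounded energy alone gives no such regularity: limits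
of minimizing sequences have the continuous Euler-Lagrange velocity. -/
theorem exists_minimizer (H : CostData M ℓ h) (hT : 0 ≤ T) (x : Space d) :
    ∃ γ w, IsMinimizer T ℓ h γ w ∧ γ 0 = x := by
  set S := {c | ∃ γ w : ℝ → Space d, IsC1 γ w ∧ γ 0 = x ∧ c = lagCost T ℓ h 0 γ w} with hS
  have hb : BddBelow S := H.lagCost_bddBelow ⟨le_rfl, hT⟩ x
  have hne : S.Nonempty := ⟨_, _, _, IsC1.line 0 x 0, by simp, rfl⟩
  obtain ⟨c, -, hc, hcS⟩ := exists_seq_tendsto_sInf hne hb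
  choose σ u hσ h0 hval using hcS
  obtain ⟨-, -, γ, w, hmin, hx, -⟩ := H.exists_subseq_minimizer hT hσ h0 (m := sInf S)
    (fun β β' hβ hβ0 => csInf_le hb ⟨β, β', hβ, hβ0, rfl⟩) (by simpa only [← hval] using hc)
  exact ⟨γ, w, hmin, hx⟩

/-- The Euler-Lagrange equation. -/
theorem velocity_eq (H : CostData M ℓ h) (hT : 0 < T) (hγ : IsMinimizer T ℓ h γ w) {t : ℝ}
    (ht : t ∈ Icc 0 T) : w t = eulerVelocity T ℓ h γ t := by
  -- Compactness is applied to the constant sequence γ: the limit σ satisfies the equation by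
  -- construction and must coincide with γ on [0, T].
  obtain ⟨-, -, σ, u, hmin, -, hu, hunif, -⟩ := H.exists_subseq_minimizer hT.le (x := γ 0)
    (fun _ : ℕ => hγ.isC1) (fun _ => rfl) hγ.le tendsto_const_nhds
  have heq : ∀ s ∈ Icc 0 T, γ s = σ s := fun s hs =>
    tendsto_nhds_unique tendsto_const_nhds (hunif.tendsto_at hs)
  rw [eulerVelocity_congr hT.le heq ht, ← hu t ht]
  have h1 := (hγ.isC1.hasDerivAt t).hasDerivWithinAt (s := Icc 0 T)
  have h2 := ((hmin.isC1.hasDerivAt t).hasDerivWithinAt (s := Icc 0 T)).congr heq (heq t ht)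
  exact (uniqueDiffOn_Icc hT t ht).eq_deriv _ h1 h2

theorem norm_velocity_le (H : CostData M ℓ h) (hT : 0 < T) (hγ : IsMinimizer T ℓ h γ w) {t : ℝ}
    (ht : t ∈ Icc 0 T) : ‖w t‖ ≤ M * (T + 1) := by
  rw [H.velocity_eq hT hγ ht, eulerVelocity]
  refine (norm_sub_le _ _).trans ?_
  rw [norm_neg]
  have h1 := intervalIntegral.norm_integral_le_of_norm_le_const (a := t) (b := T) (C := M)
    (f := fun s => gradient (ℓ s) (γ s)) fun s _ => H.norm_gradient_le s (γ s)
  have h2 := H.norm_gradient_terminal_le (γ T)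
  rw [abs_of_nonneg (by linarith [ht.2])] at h1
  have h3 : M * (T - t) ≤ M * T := mul_le_mul_of_nonneg_left (by linarith [ht.1]) H.nonneg
  linarith

end CostData

end

/-! ### Smoothing of corners and dynamic programming. -/

section

variable {d : ℕ}

namespace IsC1

variable {γ w γ₁ w₁ γ₂ w₂ : ℝ → Space d}

/-- A localized change of the velocity. -/
theorem add_bump (hγ : IsC1 γ w) {κ : ℝ → ℝ} (hκ : Continuous κ) (t : ℝ) (c : Space d) :
    IsC1 (fun s => γ s + (∫ r in t..s, κ r) • c) (fun s => w s + κ s • c) :=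
  ⟨hγ.continuous_velocity.add (hκ.smul continuous_const), fun s =>
    (hγ.hasDerivAt s).add ((hκ.integral_hasStrictDerivAt t s).hasDerivAt.smul_const c)⟩

theorem exists_glue (h₁ : IsC1 γ₁ w₁) (h₂ : IsC1 γ₂ w₂) {t : ℝ} (hp : γ₁ t = γ₂ t)
    (hv : w₁ t = w₂ t) : ∃ σ u, IsC1 σ u ∧ (∀ s ≤ t, σ s = γ₁ s ∧ u s = w₁ s) ∧
      ∀ s, t ≤ s → σ s = γ₂ s ∧ u s = w₂ s := by
  set u : ℝ → Space d := fun s => if s ≤ t then w₁ s else w₂ s with hu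
  have huc : Continuous u := h₁.continuous_velocity.if_le h₂.continuous_velocity continuous_id
    continuous_const (by rintro s rfl; exact hv)
  have hu1 : ∀ s ≤ t, u s = w₁ s := fun s hs => if_pos hs
  have hu2 : ∀ s, t ≤ s → u s = w₂ s := fun s hs => by
    rcases hs.eq_or_lt with rfl | hlt
    · rw [hu1 _ le_rfl, hv]
    · exact if_neg (not_le.2 hlt)
  refine ⟨fun s => γ₁ t + ∫ r in t..s, u r, u, of_integral huc t _,
    fun s hs => ⟨?_, hu1 s hs⟩, fun s hs => ⟨?_, hu2 s hs⟩⟩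
  · have h3 : ∫ r in t..s, u r = ∫ r in t..s, w₁ r := intervalIntegral.integral_congr fun r hr => by
      rw [uIcc_of_ge hs] at hr; exact hu1 r hr.2
    simp only [h3, ← h₁.sub_eq_integral]; abel
  · have h3 : ∫ r in t..s, u r = ∫ r in t..s, w₂ r := intervalIntegral.integral_congr fun r hr => by
      rw [uIcc_of_le hs] at hr; exact hu2 r hr.1
    simp only [h3, ← h₂.sub_eq_integral, hp]; abel

end IsC1

namespace CostData

variable {M T : ℝ} {ℓ : ℝ → Space d → ℝ} {h : Space d → ℝ} {γ w : ℝ → Space d}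

/-- A profile with values in [0, 1] and integral at most δ displaces the curve by at most δ‖c‖ and
changes the kinetic energy by O(δ). It serves for an exponential profile (corners, initial layers)
and for an affine one (variation of the initial velocity in the acceleration problem). -/
theorem lagCost_add_bump_le (H : CostData M ℓ h) (hγ : IsC1 γ w) {t : ℝ} (ht : t ∈ Icc 0 T)
    {κ : ℝ → ℝ} (hκc : Continuous κ) (hκ0 : ∀ s ∈ Icc t T, 0 ≤ κ s) (hκ1 : ∀ s ∈ Icc t T, κ s ≤ 1)
    {δ : ℝ} (hκi : ∫ s in t..T, κ s ≤ δ) {K : ℝ} (hK0 : 0 ≤ K)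
    (hK : ∀ s ∈ Icc t T, κ s * ‖w s‖ ≤ κ s * K) (c : Space d) :
    lagCost T ℓ h t (fun s => γ s + (∫ r in t..s, κ r) • c) (fun s => w s + κ s • c)
      ≤ lagCost T ℓ h t γ w + (K * ‖c‖ + 1 / 2 * ‖c‖ ^ 2 + M * ‖c‖ * (T + 1)) * δ := by
  have hM := H.nonneg
  have hT : 0 ≤ T := ht.1.trans ht.2
  have hγ' := hγ.add_bump hκc t c
  have hδ : 0 ≤ δ := (intervalIntegral.integral_nonneg ht.2 hκ0).trans hκi
  have hdist : ∀ s ∈ Icc t T, ‖(γ s + (∫ r in t..s, κ r) • c) - γ s‖ ≤ δ * ‖c‖ := fun s hs => by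
    have h1 : 0 ≤ ∫ r in t..s, κ r := intervalIntegral.integral_nonneg hs.1 fun r hr =>
      hκ0 r ⟨hr.1, hr.2.trans hs.2⟩
    have h2 : 0 ≤ ∫ r in s..T, κ r := intervalIntegral.integral_nonneg hs.2 fun r hr =>
      hκ0 r ⟨hs.1.trans hr.1, hr.2⟩
    have h3 := intervalIntegral.integral_add_adjacent_intervals (μ := volume)
      (hκc.intervalIntegrable t s) (hκc.intervalIntegrable s T)
    rw [add_sub_cancel_left, norm_smul, Real.norm_eq_abs, abs_of_nonneg h1]
    exact mul_le_mul_of_nonneg_right (by linarith) (norm_nonneg _)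
  have h1 := (abs_le.1 (H.abs_integral_sub_le hγ'.continuous hγ.continuous ht.2 hdist)).2
  have h2 := (abs_le.1 ((H.lip_terminal _ _).trans
    (mul_le_mul_of_nonneg_left (hdist T ⟨ht.2, le_rfl⟩) hM))).2
  have h3 : M * (δ * ‖c‖) * (T - t) ≤ M * (δ * ‖c‖) * T :=
    mul_le_mul_of_nonneg_left (by linarith [ht.1]) (by positivity)
  have i1 := (hγ.intervalIntegrable_sq t T).const_mul (1 / 2)
  have i2 := (hγ'.intervalIntegrable_sq t T).const_mul (1 / 2)
  have i3 : IntervalIntegrable (fun s => (K * ‖c‖ + 1 / 2 * ‖c‖ ^ 2) * κ s) volume t T :=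
    (continuous_const.mul hκc).intervalIntegrable _ _
  have h4 : ∫ s in t..T, 1 / 2 * ‖w s + κ s • c‖ ^ 2
      ≤ ∫ s in t..T, (1 / 2 * ‖w s‖ ^ 2 + (K * ‖c‖ + 1 / 2 * ‖c‖ ^ 2) * κ s) := by
    refine intervalIntegral.integral_mono_on ht.2 i2 (i1.add i3) fun s hs => ?_
    rw [norm_add_sq_real, inner_smul_right, norm_smul, Real.norm_eq_abs, abs_of_nonneg (hκ0 s hs)]
    have e1 := mul_le_mul_of_nonneg_left (real_inner_le_norm (w s) c) (hκ0 s hs)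
    have e2 := mul_le_mul_of_nonneg_right (hK s hs) (norm_nonneg c)
    have e3 : (κ s * ‖c‖) ^ 2 ≤ κ s * ‖c‖ ^ 2 := by
      rw [mul_pow]; refine mul_le_mul_of_nonneg_right ?_ (sq_nonneg _)
      nlinarith [hκ0 s hs, hκ1 s hs]
    linarith
  rw [intervalIntegral.integral_add i1 i3, intervalIntegral.integral_const_mul _ κ] at h4
  have h5 : (K * ‖c‖ + 1 / 2 * ‖c‖ ^ 2) * (∫ s in t..T, κ s)
      ≤ (K * ‖c‖ + 1 / 2 * ‖c‖ ^ 2) * δ := mul_le_mul_of_nonneg_left hκi (by positivity)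
  unfold lagCost
  rw [intervalIntegral.integral_add i1
      ((H.continuous_comp hγ.continuous).intervalIntegrable _ _),
    intervalIntegral.integral_add i2
      ((H.continuous_comp hγ'.continuous).intervalIntegrable _ _)]
  linarith

/-- A jump of the velocity at time `t` can be smoothed out at an arbitrarily small price. -/
theorem lagCost_exp_bump_le (H : CostData M ℓ h) (hγ : IsC1 γ w) {t : ℝ} (ht : t ∈ Icc 0 T)
    (c : Space d) : ∃ C, ∀ δ, 0 < δ →
    lagCost T ℓ h t (fun s => γ s + (∫ r in t..s, Real.exp (-(r - t) / δ)) • c)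
      (fun s => w s + Real.exp (-(s - t) / δ) • c) ≤ lagCost T ℓ h t γ w + C * δ := by
  have hT : 0 ≤ T := ht.1.trans ht.2
  obtain ⟨K, hK⟩ := (isCompact_Icc (a := (0 : ℝ)) (b := T)).exists_bound_of_continuousOn
    hγ.continuous_velocity.continuousOn
  have hK0 : 0 ≤ K := (norm_nonneg _).trans (hK T ⟨hT, le_rfl⟩)
  refine ⟨K * ‖c‖ + 1 / 2 * ‖c‖ ^ 2 + M * ‖c‖ * (T + 1), fun δ hδ => ?_⟩
  set κ : ℝ → ℝ := fun s => Real.exp (-(s - t) / δ) with hκ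
  have hκc : Continuous κ := by simp only [hκ]; fun_prop
  have hκ0 : ∀ s, 0 ≤ κ s := fun s => (Real.exp_pos _).le
  refine H.lagCost_add_bump_le hγ ht hκc (fun s _ => hκ0 s) (fun s hs => ?_) ?_ hK0
    (fun s hs => mul_le_mul_of_nonneg_left (hK s ⟨ht.1.trans hs.1, hs.2⟩) (hκ0 s)) c
  · refine Real.exp_le_one_iff.2 (div_nonpos_of_nonpos_of_nonneg ?_ hδ.le)
    linarith [hs.1]
  · have hd : ∀ s, HasDerivAt (fun s => -δ * κ s) (κ s) s := fun s => by
      have h2 : HasDerivAt (fun s => -(s - t) / δ) (-1 / δ) s :=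
        (((hasDerivAt_id s).sub_const t).neg).div_const δ
      refine (h2.exp.const_mul (-δ)).congr_deriv ?_
      change _ = Real.exp (-(s - t) / δ)
      field_simp
    rw [intervalIntegral.integral_eq_sub_of_hasDerivAt (fun s _ => hd s)
      (hκc.intervalIntegrable _ _)]
    have : κ t = 1 := by simp [hκ]
    rw [this]; nlinarith [hκ0 T]

theorem lagCost_split (H : CostData M ℓ h) (hγ : IsC1 γ w) (r t : ℝ) :
    lagCost T ℓ h r γ w
      = (∫ s in r..t, (1 / 2 * ‖w s‖ ^ 2 + ℓ s (γ s))) + lagCost T ℓ h t γ w := by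
  have hc := H.continuous_integrand hγ
  unfold lagCost
  rw [← intervalIntegral.integral_add_adjacent_intervals (hc.intervalIntegrable r t)
    (hc.intervalIntegrable t T), add_assoc]

/-- Curves with corners do not lower the infimum of the cost. -/
theorem le_of_corner (H : CostData M ℓ h) {γ₁ w₁ γ₂ w₂ : ℝ → Space d} (h₁ : IsC1 γ₁ w₁)
    (h₂ : IsC1 γ₂ w₂) {t : ℝ} (ht : t ∈ Icc 0 T) (hp : γ₁ t = γ₂ t) {m : ℝ}
    (hm : ∀ β β', IsC1 β β' → β 0 = γ₁ 0 → m ≤ lagCost T ℓ h 0 β β') :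
    m ≤ (∫ s in 0..t, (1 / 2 * ‖w₁ s‖ ^ 2 + ℓ s (γ₁ s))) + lagCost T ℓ h t γ₂ w₂ := by
  obtain ⟨C, hC⟩ := H.lagCost_exp_bump_le h₂ ht (w₁ t - w₂ t)
  refine le_of_forall_pos_le_add fun η hη => ?_
  set δ := η / (|C| + 1) with hδdef
  have hδ : 0 < δ := by positivity
  have hCδ : C * δ ≤ η := by
    have h3 : (|C| + 1) * δ = η := by rw [hδdef]; field_simp
    nlinarith [le_abs_self C]
  -- The exponential profile equals 1 at `t`, so adding the velocity jump to the second curve makes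
  -- both velocities agree there; the position at `t` is unchanged.
  obtain ⟨σ, u, hσ, hl, hr⟩ := h₁.exists_glue (h₂.add_bump
    (κ := fun s => Real.exp (-(s - t) / δ)) (by fun_prop) t (w₁ t - w₂ t)) (t := t)
    (by simpa using hp) (by simp)
  have key := hm σ u hσ (hl 0 ht.1).1
  rw [H.lagCost_split hσ 0 t] at key
  have e1 : ∫ s in 0..t, (1 / 2 * ‖u s‖ ^ 2 + ℓ s (σ s))
      = ∫ s in 0..t, (1 / 2 * ‖w₁ s‖ ^ 2 + ℓ s (γ₁ s)) :=
    intervalIntegral.integral_congr fun s hs => by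
      rw [uIcc_of_le ht.1] at hs; simp only [(hl s hs.2).1, (hl s hs.2).2]
  have e2 : lagCost T ℓ h t σ u = lagCost T ℓ h t
      (fun s => γ₂ s + (∫ r in t..s, Real.exp (-(r - t) / δ)) • (w₁ t - w₂ t))
      (fun s => w₂ s + Real.exp (-(s - t) / δ) • (w₁ t - w₂ t)) := by
    unfold lagCost
    rw [(hr T ht.2).1]
    congr 1
    refine intervalIntegral.integral_congr fun s hs => ?_
    rw [uIcc_of_le ht.2] at hs; simp only [(hr s hs.1).1, (hr s hs.1).2]
  rw [e1, e2] at key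
  have := hC δ hδ
  linarith

end CostData

/-- `V` is the value function of the problem with costs `ℓ` and `h`. -/
def IsValue (T : ℝ) (ℓ : ℝ → Space d → ℝ) (h : Space d → ℝ) (V : ℝ → Space d → ℝ) : Prop :=
  ∀ t ∈ Icc 0 T, ∀ x,
    IsGLB {c | ∃ γ w : ℝ → Space d, IsC1 γ w ∧ γ t = x ∧ c = lagCost T ℓ h t γ w} (V t x)

namespace IsValue

variable {M T : ℝ} {ℓ : ℝ → Space d → ℝ} {h : Space d → ℝ} {γ w : ℝ → Space d}
  {V : ℝ → Space d → ℝ}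

theorem le (hV : IsValue T ℓ h V) {t : ℝ} (ht : t ∈ Icc 0 T) (hγ : IsC1 γ w) :
    V t (γ t) ≤ lagCost T ℓ h t γ w :=
  (hV t ht _).1 ⟨γ, w, hγ, rfl, rfl⟩

theorem eq_of_isMinimizer (hV : IsValue T ℓ h V) (hT : 0 ≤ T) (hγ : IsMinimizer T ℓ h γ w) :
    V 0 (γ 0) = lagCost T ℓ h 0 γ w :=
  le_antisymm (hV.le ⟨le_rfl, hT⟩ hγ.isC1) ((hV 0 ⟨le_rfl, hT⟩ _).2 (by
    rintro _ ⟨β, β', hβ, h0, rfl⟩; exact hγ.le β β' hβ h0))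

theorem isMinimizer (hV : IsValue T ℓ h V) (hT : 0 ≤ T) (hγ : IsC1 γ w)
    (hle : lagCost T ℓ h 0 γ w ≤ V 0 (γ 0)) : IsMinimizer T ℓ h γ w :=
  ⟨hγ, fun β β' hβ h0 => hle.trans (by rw [← h0]; exact hV.le ⟨le_rfl, hT⟩ hβ)⟩

/-- One half of the dynamic programming principle. -/
theorem le_add (hV : IsValue T ℓ h V) (H : CostData M ℓ h) {t : ℝ} (ht : t ∈ Icc 0 T)
    (hγ : IsC1 γ w) :
    V 0 (γ 0) ≤ (∫ s in 0..t, (1 / 2 * ‖w s‖ ^ 2 + ℓ s (γ s))) + V t (γ t) := by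
  rw [← sub_le_iff_le_add']
  refine (hV t ht _).2 ?_
  rintro _ ⟨β, β', hβ, hβt, rfl⟩
  rw [sub_le_iff_le_add']
  refine H.le_of_corner hγ hβ ht hβt.symm fun σ u hσ h0 => ?_
  rw [← h0]; exact hV.le ⟨le_rfl, ht.1.trans ht.2⟩ hσ

/-- If the tail of a minimizer could be improved, following the minimizer up to `t` and a better
curve afterwards would contradict optimality; the corner at `t` is harmless. -/
theorem eq_lagCost (hV : IsValue T ℓ h V) (H : CostData M ℓ h) (hγ : IsMinimizer T ℓ h γ w)
    {t : ℝ} (ht : t ∈ Icc 0 T) : V t (γ t) = lagCost T ℓ h t γ w := by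
  refine le_antisymm (hV.le ht hγ.isC1) ?_
  have h1 := hV.le_add H ht hγ.isC1
  rw [hV.eq_of_isMinimizer (ht.1.trans ht.2) hγ, H.lagCost_split hγ.isC1 0 t] at h1
  linarith

end IsValue

end

/-! ### Differentiability of the value function along minimizers. -/

section

variable {d : ℕ}

/-- The difference of the two barriers has a minimum at the contact point, so their derivatives
agree there and the function between them inherits the common first-order expansion. -/
theorem hasFDerivAt_of_le_of_le {E : Type*} [NormedAddCommGroup E] [NormedSpace ℝ E]
    {f A B : E → ℝ} {A' B' : E →L[ℝ] ℝ} {x : E} (hA : HasFDerivAt A A' x)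
    (hB : HasFDerivAt B B' x) (hAf : ∀ y, A y ≤ f y) (hfB : ∀ y, f y ≤ B y) (hAx : A x = f x)
    (hBx : B x = f x) : HasFDerivAt f B' x := by
  have hAB : A' = B' := by
    have hmin : IsLocalMin (fun y => B y - A y) x := Eventually.of_forall fun y => by
      change B x - A x ≤ B y - A y
      rw [hAx, hBx, sub_self, sub_nonneg]; exact (hAf y).trans (hfB y)
    exact (sub_eq_zero.1 (hmin.hasFDerivAt_eq_zero (hB.sub hA))).symm
  subst hAB
  rw [hasFDerivAt_iff_isLittleO, Asymptotics.isLittleO_iff] at hA hB ⊢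
  intro c hc
  filter_upwards [hA hc, hB hc] with y h1 h2
  rw [Real.norm_eq_abs, abs_le] at h1 h2 ⊢
  rw [hAx] at h1; rw [hBx] at h2
  exact ⟨by linarith [hAf y], by linarith [hfB y]⟩

namespace CostData

variable {M T : ℝ} {ℓ : ℝ → Space d → ℝ} {h : Space d → ℝ} {γ w : ℝ → Space d}

/-- The upper barrier: translating the tail of a minimizer gives a competitor from every nearby
point. Kinetic energy does not change, so the derivative is the integral of the spatial gradients,
that is, minus the Euler-Lagrange velocity. -/
theorem hasFDerivAt_lagCost_add_const (H : CostData M ℓ h) (hγ : IsC1 γ w) (t : ℝ) :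
    HasFDerivAt (fun p => lagCost T ℓ h t (fun s => γ s + p) w)
      (innerSL ℝ (-eulerVelocity T ℓ h γ t)) 0 := by
  obtain ⟨hi, h1⟩ := H.hasFDerivAt_integral hγ.continuous
    (Λ := fun _ => ContinuousLinearMap.id ℝ (Space d)) continuous_const t T
  simp only [ContinuousLinearMap.id_apply, ContinuousLinearMap.comp_id] at h1 hi
  have h2 : HasFDerivAt (fun p => h (γ T + p)) (fderiv ℝ h (γ T)) 0 := by
    rw [hasFDerivAt_comp_add_left, add_zero]
    exact (H.contDiff_terminal.differentiable one_ne_zero _).hasFDerivAt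
  have e1 : ∀ p, lagCost T ℓ h t (fun s => γ s + p) w = (∫ s in t..T, 1 / 2 * ‖w s‖ ^ 2)
      + ((∫ s in t..T, ℓ s (γ s + p)) + h (γ T + p)) := fun p => by
    unfold lagCost
    rw [intervalIntegral.integral_add ((hγ.intervalIntegrable_sq _ _).const_mul _)
      ((H.continuous_comp (hγ.add_const p).continuous).intervalIntegrable _ _), add_assoc]
  simp_rw [e1]
  refine ((h1.add h2).const_add _).congr_fderiv ?_
  ext y
  have e2 : inner ℝ (∫ s in t..T, gradient (ℓ s) (γ s)) y
      = ∫ s in t..T, inner ℝ (gradient (ℓ s) (γ s)) y := by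
    rw [real_inner_comm]
    have := (innerSL ℝ y).intervalIntegral_comp_comm
      (H.intervalIntegrable_gradient hγ.continuous t T)
    simp only [innerSL_apply_apply] at this
    rw [← this]
    exact intervalIntegral.integral_congr fun s _ => real_inner_comm _ _
  simp only [eulerVelocity, add_apply, innerSL_apply_apply, neg_sub,
    sub_neg_eq_add, inner_add_left, e2]
  rw [ContinuousLinearMap.intervalIntegral_apply hi, inner_gradient_left, add_comm]
  simp only [inner_gradient_left]

/-- The lower barrier: the shear keeps the initial point and moves the point at time `t` by `p`, so
dynamic programming from time 0 bounds the value at the moved point from below. The value of the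
derivative is not needed, since the upper barrier determines it. -/
theorem differentiableAt_integral_shear (H : CostData M ℓ h) (hγ : IsC1 γ w) (t : ℝ) :
    DifferentiableAt ℝ (fun p : Space d => ∫ s in 0..t,
      (1 / 2 * ‖w s + (1 / t) • p‖ ^ 2 + ℓ s (γ s + (s / t) • p))) 0 := by
  have hΛ : Continuous fun s : ℝ => (s / t) • ContinuousLinearMap.id ℝ (Space d) := by fun_prop
  obtain ⟨-, h1⟩ := H.hasFDerivAt_integral hγ.continuous hΛ 0 t
  simp only [smul_apply, ContinuousLinearMap.id_apply] at h1
  have hw := hγ.continuous_velocity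
  have e1 : ∀ p : Space d, ∫ s in 0..t,
      (1 / 2 * ‖w s + (1 / t) • p‖ ^ 2 + ℓ s (γ s + (s / t) • p))
      = ((∫ s in 0..t, 1 / 2 * ‖w s‖ ^ 2) + inner ℝ (∫ s in 0..t, w s) ((1 / t) • p)
        + t * (1 / 2 * ‖(1 / t) • p‖ ^ 2)) + ∫ s in 0..t, ℓ s (γ s + (s / t) • p) := fun p => by
    have hc : Continuous fun s => γ s + (s / t) • p := by have := hγ.continuous; fun_prop
    have hw1 : Continuous fun s => w s + (1 / t) • p := by fun_prop
    have i1 : IntervalIntegrable (fun s => 1 / 2 * ‖w s + (1 / t) • p‖ ^ 2) volume 0 t :=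
      (continuous_const.mul (hw1.norm.pow 2)).intervalIntegrable _ _
    have i2 : IntervalIntegrable (fun s => 1 / 2 * ‖w s‖ ^ 2) volume 0 t :=
      (hγ.intervalIntegrable_sq _ _).const_mul _
    have i3 : IntervalIntegrable (fun s => inner ℝ (w s) ((1 / t) • p)) volume 0 t :=
      (hw.inner continuous_const).intervalIntegrable _ _
    rw [intervalIntegral.integral_add i1 ((H.continuous_comp hc).intervalIntegrable _ _)]
    congr 1
    have e2 : inner ℝ (∫ s in 0..t, w s) ((1 / t) • p)
        = ∫ s in 0..t, inner ℝ (w s) ((1 / t) • p) := by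
      rw [real_inner_comm]
      have := (innerSL ℝ ((1 / t) • p)).intervalIntegral_comp_comm
        (hw.intervalIntegrable (μ := volume) 0 t)
      simp only [innerSL_apply_apply] at this
      rw [← this]
      exact intervalIntegral.integral_congr fun s _ => real_inner_comm _ _
    rw [e2, ← intervalIntegral.integral_add i2 i3]
    have e3 : t * (1 / 2 * ‖(1 / t) • p‖ ^ 2) = ∫ _ in 0..t, (1 / 2 * ‖(1 / t) • p‖ ^ 2) := by
      rw [intervalIntegral.integral_const, smul_eq_mul, sub_zero]
    rw [e3, ← intervalIntegral.integral_add (i2.add i3) intervalIntegrable_const]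
    refine intervalIntegral.integral_congr fun s _ => ?_
    simp only [norm_add_sq_real]; ring
  simp_rw [e1]
  refine DifferentiableAt.add ?_ h1.differentiableAt
  have hd : DifferentiableAt ℝ (fun p : Space d => (1 / t) • p) 0 := by fun_prop
  have hsq : DifferentiableAt ℝ (fun p : Space d => ‖(1 / t) • p‖ ^ 2) 0 := hd.norm_sq ℝ
  exact ((differentiableAt_const _).add ((differentiableAt_const _).inner ℝ hd)).add
    ((hsq.const_mul _).const_mul _)

theorem lagCost_add_const_le (H : CostData M ℓ h) (hγ : IsC1 γ w) {t : ℝ} (ht : t ∈ Icc 0 T)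
    (p : Space d) :
    lagCost T ℓ h t (fun s => γ s + p) w ≤ lagCost T ℓ h t γ w + M * (T + 1) * ‖p‖ := by
  have hM := H.nonneg
  have h1 := (abs_le.1 (H.abs_integral_sub_le (hγ.add_const p).continuous hγ.continuous ht.2
    (B := ‖p‖) fun s _ => by rw [add_sub_cancel_left])).2
  have h2 := (abs_le.1 (H.lip_terminal (γ T + p) (γ T))).2
  rw [add_sub_cancel_left] at h2
  have i1 := (hγ.intervalIntegrable_sq t T).const_mul (1 / 2)
  have h3 : M * ‖p‖ * (T - t) ≤ M * ‖p‖ * T :=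
    mul_le_mul_of_nonneg_left (by linarith [ht.1]) (by positivity)
  unfold lagCost
  rw [intervalIntegral.integral_add i1
      ((H.continuous_comp hγ.continuous).intervalIntegrable _ _),
    intervalIntegral.integral_add i1
      ((H.continuous_comp (hγ.add_const p).continuous).intervalIntegrable _ _)]
  linarith

theorem norm_eulerVelocity_sub_le (H : CostData M ℓ h) (hγ : Continuous γ) (s t : ℝ) :
    ‖eulerVelocity T ℓ h γ s - eulerVelocity T ℓ h γ t‖ ≤ M * |s - t| := by
  have e : eulerVelocity T ℓ h γ s - eulerVelocity T ℓ h γ t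
      = ∫ r in t..s, gradient (ℓ r) (γ r) := by
    simp only [eulerVelocity]
    rw [← intervalIntegral.integral_add_adjacent_intervals
      (H.intervalIntegrable_gradient hγ t s) (H.intervalIntegrable_gradient hγ s T)]
    abel
  rw [e]
  exact intervalIntegral.norm_integral_le_of_norm_le_const fun r _ => H.norm_gradient_le _ _

end CostData

namespace IsValue

variable {M T : ℝ} {ℓ : ℝ → Space d → ℝ} {h : Space d → ℝ} {γ w : ℝ → Space d}
  {V : ℝ → Space d → ℝ}

theorem lipschitzWith (hV : IsValue T ℓ h V) (H : CostData M ℓ h) {t : ℝ} (ht : t ∈ Icc 0 T) :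
    LipschitzWith (Real.toNNReal (M * (T + 1))) (V t) := by
  have hT : 0 ≤ T := ht.1.trans ht.2
  have hM := H.nonneg
  have key : ∀ x y, V t x ≤ V t y + M * (T + 1) * ‖x - y‖ := fun x y => by
    rw [← sub_le_iff_le_add]
    refine (hV t ht y).2 ?_
    rintro _ ⟨γ, w, hγ, rfl, rfl⟩
    have h1 := hV.le ht (hγ.add_const (x - γ t))
    have h2 := H.lagCost_add_const_le hγ ht (x - γ t)
    simp only [add_sub_cancel] at h1
    linarith
  refine LipschitzWith.of_dist_le_mul fun x y => ?_
  rw [Real.coe_toNNReal _ (by positivity), Real.dist_eq, dist_eq_norm, abs_le]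
  have h1 := key x y
  have h2 := key y x
  rw [norm_sub_rev] at h2
  exact ⟨by linarith, by linarith⟩

/-- The value function is differentiable in the interior of a minimizer. -/
theorem hasGradientAt (hV : IsValue T ℓ h V) (H : CostData M ℓ h) (hγ : IsMinimizer T ℓ h γ w)
    {t : ℝ} (ht : t ∈ Ioc 0 T) : HasGradientAt (V t) (-w t) (γ t) := by
  have htI : t ∈ Icc 0 T := Ioc_subset_Icc_self ht
  have hT : 0 < T := ht.1.trans_le ht.2
  have hC := hγ.isC1
  have hB := H.hasFDerivAt_lagCost_add_const (T := T) hC t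
  obtain ⟨A', hA⟩ := H.differentiableAt_integral_shear hC t
  have hA2 := hA.const_sub (V 0 (γ 0))
  have h0t : V 0 (γ 0) - (∫ s in 0..t, (1 / 2 * ‖w s‖ ^ 2 + ℓ s (γ s))) = V t (γ t) := by
    rw [hV.eq_lagCost H hγ htI, hV.eq_of_isMinimizer hT.le hγ, H.lagCost_split hC 0 t]; ring
  have key : HasFDerivAt (fun p => V t (γ t + p)) (innerSL ℝ (-eulerVelocity T ℓ h γ t)) 0 := by
    refine hasFDerivAt_of_le_of_le hA2 hB (fun p => ?_) (fun p => hV.le htI (hC.add_const p)) ?_ ?_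
    -- This is where t > 0 is used: the initial part of the curve has time to absorb the
    -- displacement.
    · have hl : IsC1 (fun s => γ s + (s / t) • p) (fun s => w s + (1 / t) • p) := by
        have := hC.add (IsC1.line 0 0 ((1 / t) • p))
        convert this using 2 with s
        rw [zero_add, sub_zero, smul_smul, mul_one_div]
      have h1 := hV.le_add H htI hl
      simp only [zero_div, zero_smul, add_zero, div_self ht.1.ne', one_smul] at h1
      linarith
    · simp only [smul_zero, add_zero]; exact h0t
    · simp only [add_zero]; exact (hV.eq_lagCost H hγ htI).symm
  rw [hasFDerivAt_comp_add_left, add_zero, ← H.velocity_eq hT hγ htI] at key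
  exact key

/-- At time 0 only the upper barrier exists. With differentiability assumed, the value function
serves as its own lower barrier. -/
theorem gradient_eq (hV : IsValue T ℓ h V) (H : CostData M ℓ h) (hT : 0 < T)
    (hγ : IsMinimizer T ℓ h γ w) (hd : DifferentiableAt ℝ (V 0) (γ 0)) :
    gradient (V 0) (γ 0) = -w 0 := by
  have h0 : (0 : ℝ) ∈ Icc 0 T := ⟨le_rfl, hT.le⟩
  have hC := hγ.isC1
  have hB := H.hasFDerivAt_lagCost_add_const (T := T) hC 0
  have hf : HasFDerivAt (fun p => V 0 (γ 0 + p)) (fderiv ℝ (V 0) (γ 0)) 0 := by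
    rw [hasFDerivAt_comp_add_left, add_zero]; exact hd.hasFDerivAt
  have key := hasFDerivAt_of_le_of_le hf hB (fun p => le_rfl)
    (fun p => hV.le h0 (hC.add_const p)) rfl
    (by simp only [add_zero]; exact (hV.eq_lagCost H hγ h0).symm)
  rw [hasFDerivAt_comp_add_left, add_zero, ← H.velocity_eq hT hγ h0] at key
  exact HasGradientAt.gradient key

end IsValue

/-- The closed set of all `(t, γ(t), γ'(t))` where `γ` is a minimizer. -/
def minimizerGraph (T : ℝ) (ℓ : ℝ → Space d → ℝ) (h : Space d → ℝ) :
    Set (ℝ × (Space d × Space d)) :=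
  {q | q.1 ∈ Icc 0 T ∧ ∃ γ w, IsMinimizer T ℓ h γ w ∧ γ q.1 = q.2.1 ∧ w q.1 = q.2.2}

/-- Minimizers have speed at most M(T + 1), so Ascoli applies even though the initial points vary.
The Euler-Lagrange formula turns uniform convergence of positions into pointwise convergence of
velocities, and both positions and velocities are uniformly Lipschitz in time, which handles the
moving time. Closedness lets a vanishing distance be read as membership. -/
theorem isClosed_minimizerGraph {M T : ℝ} {ℓ : ℝ → Space d → ℝ} {h : Space d → ℝ}
    {V : ℝ → Space d → ℝ} (hV : IsValue T ℓ h V) (H : CostData M ℓ h) (hT : 0 < T) :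
    IsClosed (minimizerGraph T ℓ h) := by
  refine IsSeqClosed.isClosed fun q q' hq hlim => ?_
  have hM := H.nonneg
  have ht : q'.1 ∈ Icc 0 T :=
    isClosed_Icc.mem_of_tendsto (hlim.fst_nhds) (Eventually.of_forall fun n => (hq n).1)
  choose hqI γ w hmin hγq hwq using hq
  set R := M * (T + 1) with hR
  have hR0 : 0 ≤ R := by positivity
  have hlipγ : ∀ n, ∀ s ∈ Icc 0 T, ∀ t ∈ Icc 0 T, ‖γ n s - γ n t‖ ≤ R * |s - t| :=
    fun n s hs t ht => by
      rw [(hmin n).isC1.sub_eq_integral]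
      exact intervalIntegral.norm_integral_le_of_norm_le_const fun r hr =>
        H.norm_velocity_le hT (hmin n) ((uIcc_subset_Icc ht hs) (uIoc_subset_uIcc hr))
  obtain ⟨B, hB⟩ := (hlim.snd_nhds.fst_nhds).norm.bddAbove_range
  have hbd : ∀ n, ∀ t ∈ Icc 0 T, ‖γ n t‖ ≤ B + R * T := fun n t ht => by
    have h1 := hlipγ n t ht _ (hqI n)
    have h2 : ‖γ n (q n).1‖ ≤ B := by rw [hγq n]; exact hB ⟨n, rfl⟩
    have h3 : |t - (q n).1| ≤ T := abs_le.2 ⟨by linarith [ht.1, (hqI n).2],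
      by linarith [ht.2, (hqI n).1]⟩
    have h4 := mul_le_mul_of_nonneg_left h3 hR0
    have h5 := norm_sub_norm_le (γ n t) (γ n (q n).1)
    linarith
  have hmod : Tendsto (fun r : ℝ => R * r) (𝓝 0) (𝓝 0) := by
    simpa using (continuous_const_mul R).tendsto 0
  obtain ⟨φ, hφ, g, hg, hunif⟩ := exists_subseq_tendstoUniformlyOn hT.le hmod hbd hlipγ
  set W := eulerVelocity T ℓ h g with hW
  have hWc : Continuous W := H.continuous_eulerVelocity hg
  have hwW : ∀ t ∈ Icc 0 T, Tendsto (fun n => w (φ n) t) atTop (𝓝 (W t)) := fun t ht => by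
    have e : ∀ n, w (φ n) t = eulerVelocity T ℓ h (γ (φ n)) t := fun n =>
      H.velocity_eq hT (hmin _) ht
    simp_rw [e]
    refine Tendsto.sub (Tendsto.neg ?_) ?_
    · refine intervalIntegral.tendsto_integral_filter_of_dominated_convergence (fun _ => M)
        (Eventually.of_forall fun n =>
          (H.measurable_gradient_comp (hmin _).isC1.continuous).aestronglyMeasurable)
        (Eventually.of_forall fun n => Eventually.of_forall fun s _ => H.norm_gradient_le _ _)
        intervalIntegrable_const (Eventually.of_forall fun s hs => ?_)
      rw [uIoc_of_le ht.2] at hs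
      have hc : Continuous (gradient (ℓ s)) := (LinearIsometryEquiv.continuous _).comp
        ((H.contDiff s).continuous_fderiv one_ne_zero)
      exact (hc.tendsto _).comp (hunif.tendsto_at ⟨ht.1.trans hs.1.le, hs.2⟩)
    · have hc : Continuous (gradient h) := (LinearIsometryEquiv.continuous _).comp
        (H.contDiff_terminal.continuous_fderiv one_ne_zero)
      exact (hc.tendsto _).comp (hunif.tendsto_at ⟨hT.le, le_rfl⟩)
  have hγ := IsC1.of_integral hWc 0 (g 0)
  set σ : ℝ → Space d := fun s => g 0 + ∫ r in 0..s, W r with hσ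
  have h0T : (0 : ℝ) ∈ Icc 0 T := ⟨le_rfl, hT.le⟩
  have heq : ∀ t ∈ Icc 0 T, g t = σ t := fun t ht => by
    refine tendsto_nhds_unique (hunif.tendsto_at ht) ?_
    have e : ∀ n, γ (φ n) t = γ (φ n) 0 + ∫ r in 0..t, w (φ n) r := fun n => by
      rw [← (hmin _).isC1.sub_eq_integral]; abel
    simp_rw [e]
    refine (hunif.tendsto_at h0T).add
      (intervalIntegral.tendsto_integral_filter_of_dominated_convergence (fun _ => R)
        (Eventually.of_forall fun n => (hmin _).isC1.continuous_velocity.aestronglyMeasurable)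
        (Eventually.of_forall fun n => Eventually.of_forall fun s hs => ?_)
        intervalIntegrable_const (Eventually.of_forall fun s hs => ?_)) <;>
    rw [uIoc_of_le ht.1] at hs
    · exact H.norm_velocity_le hT (hmin _) ⟨hs.1.le, hs.2.trans ht.2⟩
    · exact hwW s ⟨hs.1.le, hs.2.trans ht.2⟩
  have hunif' : TendstoUniformlyOn (fun k => γ (φ k)) σ atTop (Icc 0 T) := hunif.congr_right heq
  have hWR : ∀ t ∈ Icc 0 T, ‖W t‖ ≤ R := fun t ht =>
    le_of_tendsto (hwW t ht).norm (Eventually.of_forall fun n => H.norm_velocity_le hT (hmin _) ht)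
  have hL2 : Tendsto (fun k => ∫ s in 0..T, ‖w (φ k) s - W s‖ ^ 2) atTop (𝓝 0) := by
    have := intervalIntegral.tendsto_integral_filter_of_dominated_convergence (a := 0) (b := T)
      (μ := volume) (F := fun k s => ‖w (φ k) s - W s‖ ^ 2) (f := fun _ => 0) (l := atTop)
      (fun _ => (2 * R) ^ 2)
      (Eventually.of_forall fun n =>
        (((hmin _).isC1.continuous_velocity.sub hWc).norm.pow 2).aestronglyMeasurable)
      (Eventually.of_forall fun n => Eventually.of_forall fun s hs => by
        rw [uIoc_of_le hT.le] at hs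
        rw [Real.norm_of_nonneg (sq_nonneg _)]
        refine pow_le_pow_left₀ (norm_nonneg _) ((norm_sub_le _ _).trans ?_) 2
        have h1 := H.norm_velocity_le hT (hmin (φ n)) ⟨hs.1.le, hs.2⟩
        have h2 := hWR s ⟨hs.1.le, hs.2⟩
        linarith)
      intervalIntegrable_const
      (Eventually.of_forall fun s hs => by
        rw [uIoc_of_le hT.le] at hs
        have h1 := ((hwW s ⟨hs.1.le, hs.2⟩).sub_const (W s)).norm.pow 2
        simpa using h1)
    simpa using this
  -- The costs tend to the cost of σ and, by continuity of `V 0`, also to `V 0 (σ 0)`; hence σ is a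
  -- minimizer.
  have hval := H.tendsto_lagCost hT.le hγ (fun k => (hmin (φ k)).isC1) hunif' hL2
  have hVc : Continuous (V 0) := (hV.lipschitzWith H h0T).continuous
  have hval' : Tendsto (fun k => lagCost T ℓ h 0 (γ (φ k)) (w (φ k))) atTop (𝓝 (V 0 (σ 0))) := by
    simp_rw [← fun k => hV.eq_of_isMinimizer hT.le (hmin (φ k))]
    exact (hVc.tendsto _).comp (hunif'.tendsto_at h0T)
  have hmin' : IsMinimizer T ℓ h σ W :=
    hV.isMinimizer hT.le hγ (tendsto_nhds_unique hval hval').le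
  have htn : Tendsto (fun n => |(q (φ n)).1 - q'.1|) atTop (𝓝 0) := by
    have := ((hlim.comp hφ.tendsto_atTop).fst_nhds.sub_const q'.1).abs
    simpa using this
  refine ⟨ht, σ, W, hmin', ?_, ?_⟩
  · refine tendsto_nhds_unique (f := fun n => γ (φ n) (q (φ n)).1) (l := atTop) ?_
      (by simp_rw [hγq]; exact (hlim.comp hφ.tendsto_atTop).snd_nhds.fst_nhds)
    have h1 := hunif'.tendsto_at ht
    have h2 : Tendsto (fun n => γ (φ n) (q (φ n)).1 - γ (φ n) q'.1) atTop (𝓝 0) := by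
      refine squeeze_zero_norm (fun n => hlipγ _ _ (hqI _) _ ht) ?_
      simpa using htn.const_mul R
    simpa using h2.add h1
  · refine tendsto_nhds_unique (f := fun n => w (φ n) (q (φ n)).1) (l := atTop) ?_
      (by simp_rw [hwq]; exact (hlim.comp hφ.tendsto_atTop).snd_nhds.snd_nhds)
    have h1 := hwW _ ht
    have h2 : Tendsto (fun n => w (φ n) (q (φ n)).1 - w (φ n) q'.1) atTop (𝓝 0) := by
      refine squeeze_zero_norm (a := fun n => M * |(q (φ n)).1 - q'.1|) (fun n => ?_) ?_
      · rw [H.velocity_eq hT (hmin _) (hqI _), H.velocity_eq hT (hmin _) ht]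
        exact H.norm_eulerVelocity_sub_le (hmin _).isC1.continuous _ _
      · simpa using htn.const_mul M
    simpa using h2.add h1

end

/-! ### H² curves and the value function with control of acceleration. -/

section

variable {d : ℕ}

/-- A `C¹` curve on the line which is `H²` on `[0, T]` with acceleration `a`. -/
structure IsH2 (T : ℝ) (γ w a : ℝ → Space d) : Prop where
  isC1 : IsC1 γ w
  memLp : MemLp a 2 (volume.restrict (Icc 0 T))
  velocity_eq : ∀ s ∈ Icc 0 T, w s = w 0 + ∫ r in 0..s, a r

namespace IsH2

variable {T : ℝ} {γ w a : ℝ → Space d}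

theorem intervalIntegrable (hγ : IsH2 T γ w a) {s t : ℝ} (hs : s ∈ Icc 0 T) (ht : t ∈ Icc 0 T) :
    IntervalIntegrable a volume s t := by
  have h1 : IntegrableOn a (Icc 0 T) := hγ.memLp.integrable one_le_two
  exact (h1.mono_set (uIcc_subset_Icc hs ht)).intervalIntegrable

theorem intervalIntegrable_sq (hγ : IsH2 T γ w a) {s t : ℝ} (hs : s ∈ Icc 0 T)
    (ht : t ∈ Icc 0 T) : IntervalIntegrable (fun r => ‖a r‖ ^ 2) volume s t := by
  have h1 : IntegrableOn (fun r => ‖a r‖ ^ 2) (Icc 0 T) :=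
    hγ.memLp.integrable_norm_pow two_ne_zero
  exact (h1.mono_set (uIcc_subset_Icc hs ht)).intervalIntegrable

theorem velocity_sub (hγ : IsH2 T γ w a) {s t : ℝ} (hs : s ∈ Icc 0 T) (ht : t ∈ Icc 0 T) :
    w t - w s = ∫ r in s..t, a r := by
  have h0 : (0 : ℝ) ∈ Icc 0 T := ⟨le_rfl, hs.1.trans hs.2⟩
  rw [hγ.velocity_eq t ht, hγ.velocity_eq s hs, add_sub_add_left_eq_sub,
    intervalIntegral.integral_interval_sub_left (hγ.intervalIntegrable h0 ht)
      (hγ.intervalIntegrable h0 hs)]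

theorem norm_velocity_sub_le (hγ : IsH2 T γ w a) {s t : ℝ} (hs : s ∈ Icc 0 T) (ht : t ∈ Icc 0 T)
    (hst : s ≤ t) : ‖w t - w s‖ ≤ √((t - s) * ∫ r in s..t, ‖a r‖ ^ 2) := by
  rw [hγ.velocity_sub hs ht]
  exact (intervalIntegral.norm_integral_le_integral_norm hst).trans (Real.le_sqrt_of_sq_le
    (sq_integral_le_mul_integral_sq hst (hγ.intervalIntegrable hs ht).norm
      (hγ.intervalIntegrable_sq hs ht)))

theorem line (T t : ℝ) (x v : Space d) :
    IsH2 T (fun s => x + (s - t) • v) (fun _ => v) (fun _ => 0) :=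
  ⟨IsC1.line t x v, memLp_const 0, fun s _ => by simp⟩

theorem add_line (hγ : IsH2 T γ w a) (t : ℝ) (x v : Space d) :
    IsH2 T (fun s => γ s + (x + (s - t) • v)) (fun s => w s + v) a :=
  ⟨hγ.isC1.add (IsC1.line t x v), hγ.memLp, fun s hs => by rw [hγ.velocity_eq s hs]; abel⟩

theorem add_bump (hγ : IsH2 T γ w a) {κ κ' : ℝ → ℝ} (hκ : Continuous κ)
    (hκ' : MemLp κ' 2 (volume.restrict (Icc 0 T)))
    (hκκ' : ∀ s ∈ Icc 0 T, κ s = κ 0 + ∫ r in 0..s, κ' r) (t : ℝ) (c : Space d) :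
    IsH2 T (fun s => γ s + (∫ r in t..s, κ r) • c) (fun s => w s + κ s • c)
      (fun s => a s + κ' s • c) := by
  have hκc : MemLp (fun s => κ' s • c) 2 (volume.restrict (Icc 0 T)) :=
    ((ContinuousLinearMap.toSpanSingleton ℝ c).comp_memLp' hκ')
  refine ⟨hγ.isC1.add_bump hκ t c, hγ.memLp.add hκc, fun s hs => ?_⟩
  have h0 : (0 : ℝ) ∈ Icc 0 T := ⟨le_rfl, hs.1.trans hs.2⟩
  have h1 : IntegrableOn (fun s => κ' s • c) (Icc 0 T) := hκc.integrable one_le_two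
  rw [intervalIntegral.integral_add (hγ.intervalIntegrable h0 hs)
    (h1.mono_set (uIcc_subset_Icc h0 hs)).intervalIntegrable, intervalIntegral.integral_smul_const,
    hγ.velocity_eq s hs, hκκ' s hs, add_smul]
  abel

end IsH2

/-- `U` is the value function of the problem with control of acceleration. -/
def IsAccValue (T ε : ℝ) (ℓ : ℝ → Space d → ℝ) (h : Space d → ℝ)
    (U : ℝ → Space d → Space d → ℝ) : Prop :=
  ∀ t ∈ Icc 0 T, ∀ x v,
    IsGLB {c | ∃ γ w a : ℝ → Space d, IsH2 T γ w a ∧ γ t = x ∧ w t = v ∧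
      c = ε / 2 * (∫ s in t..T, ‖a s‖ ^ 2) + lagCost T ℓ h t γ w} (U t x v)

/-- The energy bound of almost minimizers starting with speed `r`. -/
def energyBound (T M r : ℝ) : ℝ :=
  1 / 2 * r ^ 2 * T + M * (T + 1) * T * r + T * (M * (T + 1)) ^ 2 + 1

/-- The Lipschitz constant of the value function on velocities bounded by `r`. -/
def accLip (T M r : ℝ) : ℝ :=
  T + energyBound T M r + r * T + M * (T + 1) * (T + 1)

theorem energyBound_mono {T M : ℝ} (hT : 0 ≤ T) (hM : 0 ≤ M) {r r' : ℝ} (h0 : 0 ≤ r)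
    (hr : r ≤ r') : energyBound T M r ≤ energyBound T M r' := by
  unfold energyBound; gcongr

theorem energyBound_nonneg {T M : ℝ} (hT : 0 ≤ T) (hM : 0 ≤ M) {r : ℝ} (h0 : 0 ≤ r) :
    0 ≤ energyBound T M r := by
  unfold energyBound; positivity

theorem accLip_nonneg {T M : ℝ} (hT : 0 ≤ T) (hM : 0 ≤ M) {r : ℝ} (h0 : 0 ≤ r) :
    0 ≤ accLip T M r := by
  have := energyBound_nonneg hT hM h0
  unfold accLip; positivity

namespace CostData

variable {M T ε : ℝ} {ℓ : ℝ → Space d → ℝ} {h : Space d → ℝ} {γ w a : ℝ → Space d}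

/-- Curves costing at most one more than the straight line have bounded energy. -/
theorem energy_le (H : CostData M ℓ h) (hγ : IsC1 γ w) {t : ℝ} (ht : t ∈ Icc 0 T) {v : Space d}
    {e : ℝ} (hle : e + lagCost T ℓ h t γ w
      ≤ lagCost T ℓ h t (fun s => γ t + (s - t) • v) (fun _ => v) + 1) :
    e + 1 / 4 * ∫ s in t..T, ‖w s‖ ^ 2 ≤ energyBound T M ‖v‖ := by
  have := H.lagCost_line_le hγ ht v
  unfold energyBound
  linarith

end CostData

namespace IsAccValue

variable {M T ε : ℝ} {ℓ : ℝ → Space d → ℝ} {h : Space d → ℝ} {γ w a : ℝ → Space d}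
  {U : ℝ → Space d → Space d → ℝ}

theorem le (hU : IsAccValue T ε ℓ h U) {t : ℝ} (ht : t ∈ Icc 0 T) (hγ : IsH2 T γ w a) :
    U t (γ t) (w t) ≤ ε / 2 * (∫ s in t..T, ‖a s‖ ^ 2) + lagCost T ℓ h t γ w :=
  (hU t ht _ _).1 ⟨γ, w, a, hγ, rfl, rfl, rfl⟩

theorem exists_lt (hU : IsAccValue T ε ℓ h U) {t : ℝ} (ht : t ∈ Icc 0 T) (x v : Space d)
    {η : ℝ} (hη : 0 < η) : ∃ γ w a : ℝ → Space d, IsH2 T γ w a ∧ γ t = x ∧ w t = v ∧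
      ε / 2 * (∫ s in t..T, ‖a s‖ ^ 2) + lagCost T ℓ h t γ w < U t x v + η := by
  obtain ⟨_, ⟨γ, w, a, h1, h2, h3, rfl⟩, -, h4⟩ :=
    (hU t ht x v).exists_between (lt_add_of_pos_right _ hη)
  exact ⟨γ, w, a, h1, h2, h3, h4⟩

theorem energy_le (hU : IsAccValue T ε ℓ h U) (H : CostData M ℓ h) {t : ℝ} (ht : t ∈ Icc 0 T)
    (hγ : IsH2 T γ w a) (hle : ε / 2 * (∫ s in t..T, ‖a s‖ ^ 2) + lagCost T ℓ h t γ w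
      ≤ U t (γ t) (w t) + 1) :
    ε / 2 * (∫ s in t..T, ‖a s‖ ^ 2) + 1 / 4 * ∫ s in t..T, ‖w s‖ ^ 2
      ≤ energyBound T M ‖w t‖ := by
  refine H.energy_le hγ.isC1 ht (hle.trans (add_le_add_left ?_ 1))
  have := hU.le ht (IsH2.line T t (γ t) (w t))
  simpa using this

/-- Adding an affine motion to an almost optimal curve corrects the initial position and velocity
without touching the acceleration. The ε-term therefore cancels, and the constant does not depend on
ε. -/
theorem le_add_accLip (hU : IsAccValue T ε ℓ h U) (H : CostData M ℓ h) (hε : 0 ≤ ε) {t : ℝ}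
    (ht : t ∈ Icc 0 T) {r : ℝ} (x x' : Space d) {v v' : Space d} (hv : ‖v‖ ≤ r) (hv' : ‖v'‖ ≤ r) :
    U t x' v' ≤ U t x v + accLip T M r * (‖x' - x‖ + ‖v' - v‖) := by
  have hT : 0 ≤ T := ht.1.trans ht.2
  have hM := H.nonneg
  have hr : 0 ≤ r := (norm_nonneg _).trans hv
  refine le_of_forall_pos_le_add fun η hη => ?_
  obtain ⟨γ, w, a, hγ, rfl, rfl, hlt⟩ := hU.exists_lt ht x v (show 0 < min η 1 by positivity)
  have hen := hU.energy_le H ht hγ (hlt.le.trans (add_le_add_right (min_le_right _ _) _))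
  set y := x' - γ t
  set k := v' - w t with hk
  have hcomp := hU.le ht (hγ.add_line t y k)
  simp only [sub_self, zero_smul, add_zero, y, hk, add_sub_cancel] at hcomp
  rw [← hk] at hcomp
  have hγ' := hγ.isC1
  have hγ2 := (hγ.add_line t y k).isC1
  have hB : ∀ s ∈ Icc t T, ‖(γ s + (y + (s - t) • k)) - γ s‖ ≤ ‖y‖ + T * ‖k‖ := fun s hs => by
    rw [add_sub_cancel_left]
    refine (norm_add_le _ _).trans (add_le_add_right ?_ _)
    rw [norm_smul, Real.norm_eq_abs, abs_of_nonneg (by linarith [hs.1])]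
    exact mul_le_mul_of_nonneg_right (by linarith [hs.2, ht.1]) (norm_nonneg _)
  have h1 := (abs_le.1 (H.abs_integral_sub_le hγ2.continuous hγ'.continuous ht.2 hB)).2
  have h2 := (abs_le.1 ((H.lip_terminal _ _).trans
    (mul_le_mul_of_nonneg_left (hB T ⟨ht.2, le_rfl⟩) hM))).2
  have h3 : M * (‖y‖ + T * ‖k‖) * (T - t) ≤ M * (‖y‖ + T * ‖k‖) * T :=
    mul_le_mul_of_nonneg_left (by linarith [ht.1]) (by positivity)
  have i1 := (hγ'.intervalIntegrable_sq t T).const_mul (1 / 2)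
  have i2 := (hγ2.intervalIntegrable_sq t T).const_mul (1 / 2)
  have i4 := (hγ'.intervalIntegrable_sq t T).const_mul (1 / 4)
  have i3 : IntervalIntegrable (fun s => ‖k‖ * (1 / 4 * ‖w s‖ ^ 2 + (1 + r))) volume t T :=
    (i4.add intervalIntegrable_const).const_mul _
  have hk2 : ‖k‖ ≤ 2 * r := (norm_sub_le _ _).trans (by linarith)
  have h4 : ∫ s in t..T, 1 / 2 * ‖w s + k‖ ^ 2
      ≤ ∫ s in t..T, (1 / 2 * ‖w s‖ ^ 2 + ‖k‖ * (1 / 4 * ‖w s‖ ^ 2 + (1 + r))) := by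
    refine intervalIntegral.integral_mono_on ht.2 i2 (i1.add i3) fun s _ => ?_
    rw [norm_add_sq_real]
    have e1 := real_inner_le_norm (w s) k
    have e2 : ‖w s‖ * ‖k‖ ≤ (1 / 4 * ‖w s‖ ^ 2 + 1) * ‖k‖ :=
      mul_le_mul_of_nonneg_right (by nlinarith [sq_nonneg (‖w s‖ / 2 - 1)]) (norm_nonneg _)
    have e3 : ‖k‖ ^ 2 ≤ 2 * r * ‖k‖ := by
      rw [sq]; exact mul_le_mul_of_nonneg_right hk2 (norm_nonneg _)
    linarith
  rw [intervalIntegral.integral_add i1 i3, intervalIntegral.integral_const_mul ‖k‖,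
    intervalIntegral.integral_add i4 intervalIntegrable_const, intervalIntegral.integral_const,
    intervalIntegral.integral_const_mul (1 / 4), smul_eq_mul] at h4
  have h5 : 1 / 4 * (∫ s in t..T, ‖w s‖ ^ 2) ≤ energyBound T M r := by
    have h6 : 0 ≤ ε / 2 * ∫ s in t..T, ‖a s‖ ^ 2 :=
      mul_nonneg (by positivity) (intervalIntegral.integral_nonneg ht.2 fun _ _ => sq_nonneg _)
    linarith [energyBound_mono hT hM (norm_nonneg (w t)) hv]
  have h7 : ‖k‖ * (1 / 4 * (∫ s in t..T, ‖w s‖ ^ 2) + (T - t) * (1 + r))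
      ≤ ‖k‖ * (energyBound T M r + T * (1 + r)) := by
    refine mul_le_mul_of_nonneg_left (add_le_add h5 ?_) (norm_nonneg _)
    exact mul_le_mul_of_nonneg_right (by linarith [ht.1]) (by positivity)
  have h8 : ‖k‖ * (energyBound T M r + T * (1 + r)) + M * (‖y‖ + T * ‖k‖) * (T + 1)
      ≤ accLip T M r * (‖y‖ + ‖k‖) := by
    have e0 := energyBound_nonneg hT hM hr
    have e1 : 0 ≤ (T + energyBound T M r + r * T) * ‖y‖ := by positivity
    have e2 : 0 ≤ M * (T + 1) * T * ‖y‖ := by positivity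
    have e3 : 0 ≤ M * (T + 1) * ‖k‖ := by positivity
    unfold accLip
    nlinarith
  unfold lagCost at hcomp hlt
  rw [intervalIntegral.integral_add i2
      ((H.continuous_comp hγ2.continuous).intervalIntegrable _ _)] at hcomp
  rw [intervalIntegral.integral_add i1
      ((H.continuous_comp hγ'.continuous).intervalIntegrable _ _)] at hlt
  have h9 := min_le_left η 1
  linarith

theorem norm_gradient_le (hU : IsAccValue T ε ℓ h U) (H : CostData M ℓ h) (hε : 0 ≤ ε) {t : ℝ}
    (ht : t ∈ Icc 0 T) {r : ℝ} (x : Space d) {v : Space d} (hv : ‖v‖ < r) :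
    ‖gradient (U t x) v‖ ≤ accLip T M r := by
  have hT : 0 ≤ T := ht.1.trans ht.2
  rw [gradient, LinearIsometryEquiv.norm_map]
  refine norm_fderiv_le_of_lip' ℝ (accLip_nonneg hT H.nonneg ((norm_nonneg _).trans hv.le)) ?_
  filter_upwards [(continuous_norm.tendsto v).eventually (gt_mem_nhds hv)] with v' hv'
  rw [Real.norm_eq_abs, abs_le]
  have h1 := hU.le_add_accLip H hε ht x x hv.le hv'.le
  have h2 := hU.le_add_accLip H hε ht x x hv'.le hv.le
  simp only [sub_self, norm_zero, zero_add] at h1 h2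
  rw [norm_sub_rev v v'] at h2
  exact ⟨by linarith, by linarith⟩

end IsAccValue

end

/-! ### Short-time comparison with almost optimal curves. -/

section

variable {d : ℕ}

/-- A continuous function which is `1` before `s`, `0` after `s + δ`, and affine in between. -/
theorem exists_affine_cutoff {T s δ : ℝ} (hs : 0 ≤ s) (hδ : 0 < δ) :
    ∃ κ : ℝ → ℝ, Continuous κ ∧ MemLp ((Ioc s (s + δ)).indicator fun _ => -(1 / δ)) 2
        (volume.restrict (Icc 0 T)) ∧
      (∀ r ∈ Icc 0 T, κ r = κ 0 + ∫ q in 0..r, (Ioc s (s + δ)).indicator (fun _ => -(1 / δ)) q) ∧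
      κ s = 1 ∧ (∀ r ∈ Icc s (s + δ), κ r ∈ Icc (0 : ℝ) 1) ∧ ∀ r, s + δ ≤ r → κ r = 0 := by
  set ψ : ℝ → ℝ := (Ioc s (s + δ)).indicator fun _ => -(1 / δ) with hψ
  have hψi : ∀ a b, IntervalIntegrable ψ volume a b := fun a b =>
    ((integrable_indicator_iff measurableSet_Ioc).2
      (integrableOn_const measure_Ioc_lt_top.ne)).intervalIntegrable
  have h1 : ∀ r ∈ Icc 0 s, ∫ q in 0..r, ψ q = 0 := fun r hr => by
    rw [intervalIntegral.integral_congr (g := fun _ => (0 : ℝ)) fun q hq => ?_]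
    · simp
    · rw [uIcc_of_le hr.1] at hq
      exact indicator_of_notMem (fun h => not_le.2 h.1 (hq.2.trans hr.2)) _
  have h2 : ∀ r ∈ Icc s (s + δ), ∫ q in s..r, ψ q = -((r - s) / δ) := fun r hr => by
    have hmem : ∀ q ∈ Ioc s r, ψ q = -(1 / δ) := fun q hq =>
      indicator_of_mem (show q ∈ Ioc s (s + δ) from ⟨hq.1, hq.2.trans hr.2⟩) _
    rw [intervalIntegral.integral_of_le hr.1, setIntegral_congr_fun measurableSet_Ioc hmem,
      ← intervalIntegral.integral_of_le hr.1, intervalIntegral.integral_const, smul_eq_mul]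
    ring
  have h3 : ∀ r, s + δ ≤ r → ∫ q in (s + δ)..r, ψ q = 0 := fun r hr => by
    rw [intervalIntegral.integral_of_le hr, setIntegral_congr_fun measurableSet_Ioc
      (g := fun _ => (0 : ℝ)) fun q hq => indicator_of_notMem (fun h => not_le.2 hq.1 h.2) _]
    simp
  have hs1 : ∫ q in 0..s, ψ q = 0 := h1 s ⟨hs, le_rfl⟩
  have hmid : ∀ r ∈ Icc s (s + δ), 1 + ∫ q in 0..r, ψ q = 1 - (r - s) / δ := fun r hr => by
    rw [← intervalIntegral.integral_add_adjacent_intervals (hψi 0 s) (hψi s r), hs1, h2 r hr]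
    ring
  refine ⟨fun r => 1 + ∫ q in 0..r, ψ q, ?_, ?_, fun r _ => by simp, by simp [hs1],
    fun r hr => ?_, fun r hr => ?_⟩
  · exact continuous_const.add (intervalIntegral.continuous_primitive hψi 0)
  · exact (memLp_const (-(1 / δ))).indicator measurableSet_Ioc
  · simp only [hmid r hr]
    have h4 : 0 ≤ (r - s) / δ := div_nonneg (by linarith [hr.1]) hδ.le
    have h5 : (r - s) / δ ≤ 1 := (div_le_one hδ).2 (by linarith [hr.2])
    exact ⟨by linarith, by linarith⟩
  · have h4 := hmid (s + δ) ⟨by linarith, le_rfl⟩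
    rw [add_sub_cancel_left, div_self hδ.ne', sub_self] at h4
    have h5 := intervalIntegral.integral_add_adjacent_intervals (hψi 0 (s + δ)) (hψi (s + δ) r)
    rw [h3 r hr, add_zero] at h5
    change 1 + ∫ q in 0..r, ψ q = 0
    rw [← h5]; exact h4

namespace IsAccValue

variable {M T ε : ℝ} {ℓ : ℝ → Space d → ℝ} {h : Space d → ℝ} {γ w a : ℝ → Space d}
  {U : ℝ → Space d → Space d → ℝ}

/-- Comparison of a curve with an almost optimal one over a short time interval. The vector `b` is
the mean acceleration of the latter. -/
theorem exists_step (hU : IsAccValue T ε ℓ h U) (H : CostData M ℓ h) (hε : 0 < ε) (hT : 0 ≤ T)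
    (hγ : IsH2 T γ w a) {A R : ℝ} (hA : ∀ s ∈ Icc 0 T, ‖a s‖ ≤ A) (hR : ∀ s ∈ Icc 0 T, ‖w s‖ ≤ R) :
    ∃ D L N : ℝ, 0 ≤ D ∧ 0 ≤ L ∧ 0 ≤ N ∧ ∀ s δ, 0 ≤ s → 0 < δ → s + δ ≤ T → ∃ b : Space d,
      (U (s + δ) (γ (s + δ)) (w (s + δ)) + (∫ r in s..(s + δ), (1 / 2 * ‖w r‖ ^ 2 + ℓ r (γ r)))
        ≤ U s (γ s) (w s) + δ ^ 2 + D * (δ * √δ) - δ * (ε / 2 * ‖b‖ ^ 2)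
          + L * ‖(∫ r in s..(s + δ), a r) - δ • b‖) ∧
      ∀ k, U s (γ s) (w s + k) ≤ U s (γ s) (w s) + δ ^ 2 - ε * inner ℝ b k
        + ε * ‖k‖ ^ 2 / (2 * δ) + N * δ * (‖k‖ + ‖k‖ ^ 2) := by
  have hM := H.nonneg
  have h0T : (0 : ℝ) ∈ Icc 0 T := ⟨le_rfl, hT⟩
  have hA0 : 0 ≤ A := (norm_nonneg _).trans (hA 0 h0T)
  have hR0 : 0 ≤ R := (norm_nonneg _).trans (hR 0 h0T)
  set Q := 2 / ε * energyBound T M R with hQ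
  have hQ0 : 0 ≤ Q := mul_nonneg (by positivity) (energyBound_nonneg hT hM hR0)
  set R2 := R + √(T * Q) with hR2
  have hR20 : 0 ≤ R2 := by positivity
  set L := accLip T M R2 with hL
  have hL0 : 0 ≤ L := accLip_nonneg hT hM hR20
  set D1 := √Q + √T * A with hD1
  have hD10 : 0 ≤ D1 := by positivity
  refine ⟨(R + M * T + L) * D1, L, R2 + 1 / 2 + M * (T + 1), by positivity, hL0, by positivity,
    fun s δ hs0 hδ hsδ => ?_⟩
  have hs : s ∈ Icc 0 T := ⟨hs0, by linarith⟩
  set s' := s + δ with hs'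
  have hss' : s ≤ s' := by linarith
  have hs'T : s' ∈ Icc 0 T := ⟨by linarith, hsδ⟩
  have hTT : T ∈ Icc 0 T := ⟨hT, le_rfl⟩
  -- Optimality up to δ² is enough, since the estimates will be divided by δ. The cap 1 keeps the
  -- energy bound uniform in `s` and δ.
  obtain ⟨σ, u, α, hσ, hσs, hus, hlt⟩ := hU.exists_lt hs (γ s) (w s)
    (show 0 < min (δ ^ 2) 1 by positivity)
  have hen := hU.energy_le H hs hσ (by
    rw [hσs, hus]; exact hlt.le.trans (add_le_add_right (min_le_right _ _) _))
  have hlt' := hlt.le.trans (add_le_add_right (min_le_left (δ ^ 2) 1) _)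
  have hαQ : ∫ r in s..T, ‖α r‖ ^ 2 ≤ Q := by
    have h1 : 0 ≤ ∫ r in s..T, ‖u r‖ ^ 2 :=
      intervalIntegral.integral_nonneg hs.2 fun _ _ => sq_nonneg _
    have h2 : ε / 2 * (∫ r in s..T, ‖α r‖ ^ 2) ≤ energyBound T M R := by
      have := energyBound_mono hT hM (norm_nonneg _) (hR s hs)
      rw [hus] at hen; linarith
    calc ∫ r in s..T, ‖α r‖ ^ 2 = 2 / ε * (ε / 2 * ∫ r in s..T, ‖α r‖ ^ 2) := by field_simp
      _ ≤ Q := mul_le_mul_of_nonneg_left h2 (by positivity)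
  have hu_sub : ∀ r ∈ Icc s T, ‖u r - w s‖ ≤ √((r - s) * Q) := fun r hr => by
    have hrT : r ∈ Icc 0 T := ⟨hs0.trans hr.1, hr.2⟩
    rw [← hus]
    refine (hσ.norm_velocity_sub_le hs hrT hr.1).trans (Real.sqrt_le_sqrt
      (mul_le_mul_of_nonneg_left (le_trans ?_ hαQ) (by linarith [hr.1])))
    exact intervalIntegral.integral_mono_interval le_rfl hr.1 hr.2
      (Eventually.of_forall fun _ => sq_nonneg _) (hσ.intervalIntegrable_sq hs hTT)
  have huR : ∀ r ∈ Icc s T, ‖u r‖ ≤ R2 := fun r hr => by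
    have h1 := hu_sub r hr
    have h2 : √((r - s) * Q) ≤ √(T * Q) :=
      Real.sqrt_le_sqrt (mul_le_mul_of_nonneg_right (by linarith [hr.2]) hQ0)
    have h3 := norm_sub_norm_le (u r) (w s)
    have h4 := hR s hs
    linarith
  have huw : ∀ r ∈ Icc s s', ‖u r - w r‖ ≤ √δ * D1 := fun r hr => by
    have hrT : r ∈ Icc 0 T := ⟨hs0.trans hr.1, hr.2.trans hsδ⟩
    have hrδ : r - s ≤ δ := by linarith [hr.2]
    have h1 := hu_sub r ⟨hr.1, hr.2.trans hsδ⟩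
    have h2 : √((r - s) * Q) ≤ √δ * √Q := by
      rw [← Real.sqrt_mul hδ.le]
      exact Real.sqrt_le_sqrt (mul_le_mul_of_nonneg_right hrδ hQ0)
    have h3 : ‖w r - w s‖ ≤ √δ * (√T * A) := by
      rw [hγ.velocity_sub hs hrT]
      refine (intervalIntegral.norm_integral_le_of_norm_le_const (C := A) fun q hq => hA q
        ((uIcc_subset_Icc hs hrT) (uIoc_subset_uIcc hq))).trans ?_
      rw [abs_of_nonneg (by linarith [hr.1]), mul_comm, ← mul_assoc]
      refine mul_le_mul_of_nonneg_right ?_ hA0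
      calc r - s ≤ δ := hrδ
        _ = √δ * √δ := (Real.mul_self_sqrt hδ.le).symm
        _ ≤ √δ * √T := mul_le_mul_of_nonneg_left (Real.sqrt_le_sqrt (by linarith))
          (Real.sqrt_nonneg _)
    have e : u r - w r = (u r - w s) - (w r - w s) := by abel
    rw [e, hD1, mul_add]
    exact (norm_sub_le _ _).trans (add_le_add (h1.trans h2) h3)
  have hpos : ∀ r ∈ Icc s s', ‖σ r - γ r‖ ≤ δ * (√δ * D1) := fun r hr => by
    have h1 := (hσ.isC1.sub hγ.isC1).sub_eq_integral s r
    simp only [hσs, sub_self, sub_zero] at h1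
    rw [h1]
    refine (intervalIntegral.norm_integral_le_of_norm_le_const (C := √δ * D1) fun q hq => ?_).trans
      ?_
    · rw [uIoc_of_le hr.1] at hq
      exact huw q ⟨hq.1.le, hq.2.trans hr.2⟩
    · rw [abs_of_nonneg (by linarith [hr.1]), mul_comm]
      exact mul_le_mul_of_nonneg_right (by linarith [hr.2]) (by positivity)
  set b : Space d := (1 / δ) • ∫ r in s..s', α r with hb
  have hδb : δ • b = ∫ r in s..s', α r := by
    rw [hb, smul_smul, mul_one_div_cancel hδ.ne', one_smul]
  have hsplit := H.lagCost_split (T := T) hσ.isC1 s s'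
  have hαsplit := intervalIntegral.integral_add_adjacent_intervals
    (hσ.intervalIntegrable_sq hs hs'T) (hσ.intervalIntegrable_sq hs'T hTT)
  refine ⟨b, ?_, fun k => ?_⟩
  -- The tail of σ is admissible from time s + δ; the Lipschitz bound then moves its endpoint to
  -- that of γ. Positions differ by O(δ√δ), velocities by the difference of the integrated
  -- accelerations, and ∫‖α‖² ≥ δ‖b‖² by Cauchy-Schwarz.
  · have h1 := hU.le_add_accLip H hε.le hs'T (r := R2) (σ s') (γ s') (huR s' ⟨hss', hsδ⟩)
      ((hR s' hs'T).trans (le_add_of_nonneg_right (Real.sqrt_nonneg _)))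
    have h2 := hU.le hs'T hσ
    have h3 : ‖γ s' - σ s'‖ ≤ δ * (√δ * D1) := by
      rw [norm_sub_rev]; exact hpos s' ⟨hss', le_rfl⟩
    have h4 : w s' - u s' = (∫ r in s..s', a r) - δ • b := by
      rw [hδb, ← hγ.velocity_sub hs hs'T, ← hσ.velocity_sub hs hs'T, hus]; abel
    rw [h4] at h1
    have h5 : δ * ‖b‖ ^ 2 ≤ ∫ r in s..s', ‖α r‖ ^ 2 := by
      have e1 : (δ * ‖b‖) ^ 2 ≤ δ * ∫ r in s..s', ‖α r‖ ^ 2 := by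
        have e2 : δ * ‖b‖ = ‖∫ r in s..s', α r‖ := by
          have := congrArg norm hδb
          rwa [norm_smul, Real.norm_of_nonneg hδ.le] at this
        rw [e2]
        have e3 := sq_integral_le_mul_integral_sq hss' (hσ.intervalIntegrable hs hs'T).norm
          (hσ.intervalIntegrable_sq hs hs'T)
        rw [show s' - s = δ by rw [hs']; ring] at e3
        exact (pow_le_pow_left₀ (norm_nonneg _)
          (intervalIntegral.norm_integral_le_integral_norm hss') 2).trans e3
      have e4 : δ * (δ * ‖b‖ ^ 2) ≤ δ * ∫ r in s..s', ‖α r‖ ^ 2 := by linarith [e1]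
      exact le_of_mul_le_mul_left e4 hδ
    have cγ := H.continuous_integrand hγ.isC1
    have cσ := H.continuous_integrand hσ.isC1
    have h6 : ∫ r in s..s', ((1 / 2 * ‖w r‖ ^ 2 + ℓ r (γ r)) - (R + M * T) * (√δ * D1))
        ≤ ∫ r in s..s', (1 / 2 * ‖u r‖ ^ 2 + ℓ r (σ r)) := by
      refine intervalIntegral.integral_mono_on hss' ((cγ.intervalIntegrable _ _).sub
        intervalIntegrable_const) (cσ.intervalIntegrable _ _) fun r hr => ?_
      have e1 := (abs_le.1 ((H.lip r (σ r) (γ r)).trans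
        (mul_le_mul_of_nonneg_left (hpos r hr) hM))).1
      have e2 : M * (δ * (√δ * D1)) ≤ M * T * (√δ * D1) := by
        rw [mul_assoc]
        exact mul_le_mul_of_nonneg_left (mul_le_mul_of_nonneg_right (by linarith)
          (by positivity)) hM
      have e3 : ‖u r‖ ^ 2 = ‖w r‖ ^ 2 + 2 * inner ℝ (w r) (u r - w r) + ‖u r - w r‖ ^ 2 := by
        rw [← norm_add_sq_real]; congr 2; abel
      have e4 := (abs_le.1 (abs_real_inner_le_norm (w r) (u r - w r))).1
      have e5 : ‖w r‖ * ‖u r - w r‖ ≤ R * (√δ * D1) :=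
        mul_le_mul (hR r ⟨hs0.trans hr.1, hr.2.trans hsδ⟩) (huw r hr) (norm_nonneg _) hR0
      nlinarith [sq_nonneg ‖u r - w r‖]
    rw [intervalIntegral.integral_sub (cγ.intervalIntegrable _ _) intervalIntegrable_const,
      intervalIntegral.integral_const, smul_eq_mul, show s' - s = δ by rw [hs']; ring] at h6
    have h7 := mul_le_mul_of_nonneg_left h3 hL0
    have h8 := mul_le_mul_of_nonneg_left h5 (show 0 ≤ ε / 2 by positivity)
    rw [hsplit, ← hαsplit] at hlt'
    linarith
  -- The initial velocity is raised by `k` and brought back over time δ by the constant extra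
  -- acceleration -k/δ. Its cross term with α involves only the mean acceleration `b`.
  · obtain ⟨κ, hκc, hκ2, hκκ', hκs, hκ01, hκ0⟩ := exists_affine_cutoff (T := T) hs0 hδ
    set ψ : ℝ → ℝ := (Ioc s (s + δ)).indicator fun _ => -(1 / δ) with hψ
    have hcomp := hσ.add_bump hκc hκ2 hκκ' s k
    have hκI : ∀ r ∈ Icc s T, κ r ∈ Icc (0 : ℝ) 1 := fun r hr => by
      rcases le_total r s' with h | h
      · exact hκ01 r ⟨hr.1, h⟩
      · rw [hκ0 r h]; exact ⟨le_rfl, zero_le_one⟩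
    have hκint : ∫ r in s..T, κ r ≤ δ := by
      rw [← intervalIntegral.integral_add_adjacent_intervals (hκc.intervalIntegrable s s')
        (hκc.intervalIntegrable s' T)]
      have e1 : ∫ r in s'..T, κ r = 0 := by
        rw [intervalIntegral.integral_congr (g := fun _ => (0 : ℝ)) fun r hr => ?_]
        · simp
        · rw [uIcc_of_le hsδ] at hr; exact hκ0 r hr.1
      have e2 : ∫ r in s..s', κ r ≤ ∫ _ in s..s', (1 : ℝ) :=
        intervalIntegral.integral_mono_on hss' (hκc.intervalIntegrable _ _)
          intervalIntegrable_const fun r hr => (hκ01 r hr).2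
      rw [intervalIntegral.integral_const, smul_eq_mul, mul_one] at e2
      linarith
    have h1 := H.lagCost_add_bump_le hσ.isC1 hs hκc (fun r hr => (hκI r hr).1)
      (fun r hr => (hκI r hr).2) hκint hR20
      (fun r hr => mul_le_mul_of_nonneg_left (huR r hr) (hκI r hr).1) k
    have h2 := hU.le hs hcomp
    simp only [intervalIntegral.integral_same, zero_smul, add_zero, hκs, one_smul, hσs, hus] at h2
    have h3 : ∫ r in s..T, ‖α r + ψ r • k‖ ^ 2
        = (∫ r in s..T, ‖α r‖ ^ 2) - 2 * inner ℝ b k + ‖k‖ ^ 2 / δ := by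
      rw [← intervalIntegral.integral_add_adjacent_intervals
        (hcomp.intervalIntegrable_sq hs hs'T) (hcomp.intervalIntegrable_sq hs'T hTT), ← hαsplit]
      have e1 : ∫ r in s'..T, ‖α r + ψ r • k‖ ^ 2 = ∫ r in s'..T, ‖α r‖ ^ 2 := by
        rw [intervalIntegral.integral_of_le hsδ, intervalIntegral.integral_of_le hsδ]
        refine setIntegral_congr_fun measurableSet_Ioc fun r hr => ?_
        have : ψ r = 0 := indicator_of_notMem (fun h => not_le.2 hr.1 h.2) _
        simp [this]
      have e2 : ∫ r in s..s', ‖α r + ψ r • k‖ ^ 2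
          = ∫ r in s..s', (‖α r‖ ^ 2 - 2 / δ * inner ℝ k (α r) + ‖k‖ ^ 2 / δ ^ 2) := by
        rw [intervalIntegral.integral_of_le hss', intervalIntegral.integral_of_le hss']
        refine setIntegral_congr_fun measurableSet_Ioc fun r hr => ?_
        have : ψ r = -(1 / δ) := indicator_of_mem hr _
        simp only [this]
        rw [norm_add_sq_real, inner_smul_right, norm_smul, norm_neg,
          Real.norm_of_nonneg (by positivity), real_inner_comm]
        field_simp
        ring
      have i1 := hσ.intervalIntegrable_sq hs hs'T
      have i2 : IntervalIntegrable (fun r => inner ℝ k (α r)) volume s s' :=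
        ⟨(innerSL ℝ k).integrable_comp (hσ.intervalIntegrable hs hs'T).1,
          (innerSL ℝ k).integrable_comp (hσ.intervalIntegrable hs hs'T).2⟩
      have e3 : ∫ r in s..s', inner ℝ k (α r) = δ * inner ℝ b k := by
        have := (innerSL ℝ k).intervalIntegral_comp_comm (hσ.intervalIntegrable hs hs'T)
        simp only [innerSL_apply_apply] at this
        rw [this, hδb.symm, inner_smul_right, real_inner_comm]
      rw [e1, e2, intervalIntegral.integral_add (i1.sub (i2.const_mul _)) intervalIntegrable_const,
        intervalIntegral.integral_sub i1 (i2.const_mul _), intervalIntegral.integral_const_mul, e3,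
        intervalIntegral.integral_const, smul_eq_mul, show s' - s = δ by rw [hs']; ring]
      field_simp
      ring
    rw [h3] at h2
    have h4 : ε / 2 * ((∫ r in s..T, ‖α r‖ ^ 2) - 2 * inner ℝ b k + ‖k‖ ^ 2 / δ)
        = ε / 2 * (∫ r in s..T, ‖α r‖ ^ 2) - ε * inner ℝ b k + ε * ‖k‖ ^ 2 / (2 * δ) := by
      field_simp
    have h5 : (R2 * ‖k‖ + 1 / 2 * ‖k‖ ^ 2 + M * ‖k‖ * (T + 1)) * δ
        ≤ (R2 + 1 / 2 + M * (T + 1)) * δ * (‖k‖ + ‖k‖ ^ 2) := by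
      have e1 : 0 ≤ (1 / 2 * ‖k‖ + (R2 + M * (T + 1)) * ‖k‖ ^ 2) * δ := by positivity
      linarith
    linarith
end IsAccValue

end

/-! ### Optimality of feedback trajectories. -/

section

variable {d : ℕ}

/-- Differentiability bounds f(v + k) from below by its linear part, the assumption bounds it from
above by a linear part with slope -εb(δ). The two slopes must merge as δ → 0: this recovers the
feedback law for the mean acceleration of almost optimal curves. -/
theorem tendsto_of_variation {f : Space d → ℝ} {p v : Space d} (hf : HasGradientAt f p v)
    {ε N : ℝ} (hε : 0 < ε) {b : ℝ → Space d}
    (hb : ∀ᶠ δ in 𝓝[>] (0 : ℝ), ∀ k, f (v + k) ≤ f v + δ ^ 2 - ε * inner ℝ (b δ) k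
      + ε * ‖k‖ ^ 2 / (2 * δ) + N * δ * (‖k‖ + ‖k‖ ^ 2)) :
    Tendsto b (𝓝[>] 0) (𝓝 (-((1 / ε) • p))) := by
  set a := -((1 / ε) • p) with ha
  have hpa : ∀ k, inner ℝ p k = -(ε * inner ℝ a k) := fun k => by
    rw [ha, inner_neg_left, inner_smul_left]
    simp only [RCLike.conj_to_real]
    field_simp
  rw [Metric.tendsto_nhds]
  intro e he
  set η := ε * e / (2 * (1 + ε)) with hη
  have hη0 : 0 < η := by positivity
  have hηe : η * (1 + ε / 2) < ε * e * (3 / 4) := by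
    have h1 : η * (2 * (1 + ε)) = ε * e := by rw [hη]; field_simp
    have h2 : 0 < ε * e := by positivity
    nlinarith [mul_pos hη0 hε]
  have hlo := (hf.hasFDerivAt.isLittleO).def hη0
  obtain ⟨ρ, hρ, hlo⟩ := Metric.eventually_nhds_iff.1 hlo
  have hc1 : Continuous fun δ : ℝ => δ / η + N * δ * (1 + δ * η) := by fun_prop
  have h1 : ∀ᶠ δ in 𝓝[>] (0 : ℝ), δ / η + N * δ * (1 + δ * η) < ε * e / 4 := by
    refine nhdsWithin_le_nhds ((hc1.tendsto 0).eventually (gt_mem_nhds ?_))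
    simp only [zero_div, mul_zero, zero_mul, add_zero]; positivity
  have hc2 : Continuous fun δ : ℝ => δ * η := by fun_prop
  have h2 : ∀ᶠ δ in 𝓝[>] (0 : ℝ), δ * η < ρ := by
    refine nhdsWithin_le_nhds ((hc2.tendsto 0).eventually (gt_mem_nhds ?_))
    simpa using hρ
  filter_upwards [hb, h1, h2, self_mem_nhdsWithin] with δ hδ h1 h2 hδ0
  have hδ0 : 0 < δ := hδ0
  rw [dist_eq_norm]
  set q := b δ - a with hq
  by_cases hq0 : q = 0
  · rw [hq0, norm_zero]; exact he
  have hqn : 0 < ‖q‖ := norm_pos_iff.2 hq0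
  -- The length δη makes every error small after division by δη: the term δ² contributes δ/η, the
  -- quadratic term εη/2, and the error of differentiability η.
  set k := (δ * η / ‖q‖) • q with hk
  have hkn : ‖k‖ = δ * η := by
    rw [hk, norm_smul, Real.norm_of_nonneg (by positivity)]; field_simp
  have hqk : inner ℝ q k = δ * η * ‖q‖ := by
    rw [hk, inner_smul_right, real_inner_self_eq_norm_sq]; field_simp
  have h3 := hlo (y := v + k) (by rw [dist_eq_norm, add_sub_cancel_left, hkn]; exact h2)
  simp only [add_sub_cancel_left, InnerProductSpace.toDual_apply_apply, hpa, hkn] at h3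
  have h4 := (abs_le.1 h3).1
  have h5 := hδ k
  rw [hkn] at h5
  have h6 : inner ℝ (b δ) k = inner ℝ a k + δ * η * ‖q‖ := by
    rw [← hqk, hq, inner_sub_left]; ring
  rw [h6] at h5
  have h7 : δ * η * (ε * ‖q‖) ≤ δ * η * (η * (1 + ε / 2) + (δ / η + N * δ * (1 + δ * η))) := by
    have e1 : δ * η * (η * (1 + ε / 2) + (δ / η + N * δ * (1 + δ * η)))
        = η * (δ * η) + δ ^ 2 + ε * (δ * η) ^ 2 / (2 * δ) + N * δ * (δ * η + (δ * η) ^ 2) := by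
      field_simp
      ring
    rw [e1]; linarith
  have h8 := le_of_mul_le_mul_left h7 (by positivity)
  have h9 : ε * ‖q‖ < ε * e := by linarith
  exact lt_of_mul_lt_mul_left h9 hε.le

namespace IsAccValue

variable {M T ε : ℝ} {ℓ : ℝ → Space d → ℝ} {h : Space d → ℝ} {γ w : ℝ → Space d}
  {U : ℝ → Space d → Space d → ℝ}

/-- A C¹ curve has bounded velocity on [0, T] and the value function is Lipschitz on bounded
velocities, so integrability of the feedback improves to boundedness. -/
theorem isH2_of_feedback (hU : IsAccValue T ε ℓ h U) (H : CostData M ℓ h) (hε : 0 < ε)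
    (hT : 0 ≤ T) (hγ : IsC1 γ w)
    (hi : IntervalIntegrable (fun s => gradient (U s (γ s)) (w s)) volume 0 T)
    (hv : ∀ t ∈ Icc 0 T, w t = w 0 + ∫ s in 0..t, -((1 / ε) • gradient (U s (γ s)) (w s))) :
    IsH2 T γ w (fun s => -((1 / ε) • gradient (U s (γ s)) (w s))) ∧
      ∃ A R : ℝ, (∀ s ∈ Icc 0 T, ‖-((1 / ε) • gradient (U s (γ s)) (w s))‖ ≤ A) ∧
        ∀ s ∈ Icc 0 T, ‖w s‖ ≤ R := by
  obtain ⟨R, hR⟩ := (isCompact_Icc (a := (0 : ℝ)) (b := T)).exists_bound_of_continuousOn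
    hγ.continuous_velocity.continuousOn
  have hA : ∀ s ∈ Icc 0 T,
      ‖-((1 / ε) • gradient (U s (γ s)) (w s))‖ ≤ 1 / ε * accLip T M (R + 1) := fun s hs => by
    rw [norm_neg, norm_smul, Real.norm_of_nonneg (by positivity)]
    exact mul_le_mul_of_nonneg_left (hU.norm_gradient_le H hε.le hs _
      ((hR s hs).trans_lt (lt_add_one R))) (by positivity)
  refine ⟨⟨hγ, ?_, hv⟩, _, R, hA, hR⟩
  have hm : AEStronglyMeasurable (fun s => -((1 / ε) • gradient (U s (γ s)) (w s)))
      (volume.restrict (Icc 0 T)) := by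
    rw [intervalIntegrable_iff_integrableOn_Icc_of_le hT] at hi
    exact (hi.aestronglyMeasurable.const_smul (1 / ε)).neg
  exact MemLp.of_bound hm _ ((ae_restrict_mem measurableSet_Icc).mono hA)

/-- A trajectory of the optimal feedback is optimal. -/
theorem cost_le_of_feedback (hU : IsAccValue T ε ℓ h U) (H : CostData M ℓ h) (hε : 0 < ε)
    (hT : 0 < T) (hγ : IsC1 γ w)
    (hd : ∀ᵐ s ∂(volume.restrict (Icc 0 T)), DifferentiableAt ℝ (U s (γ s)) (w s))
    (hi : IntervalIntegrable (fun s => gradient (U s (γ s)) (w s)) volume 0 T)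
    (hv : ∀ t ∈ Icc 0 T, w t = w 0 + ∫ s in 0..t, -((1 / ε) • gradient (U s (γ s)) (w s))) :
    ε / 2 * (∫ s in 0..T, ‖-((1 / ε) • gradient (U s (γ s)) (w s))‖ ^ 2)
      + lagCost T ℓ h 0 γ w ≤ U 0 (γ 0) (w 0) := by
  obtain ⟨hH2, A, R, hA, hR⟩ := hU.isH2_of_feedback H hε hT.le hγ hi hv
  set a : ℝ → Space d := fun s => -((1 / ε) • gradient (U s (γ s)) (w s)) with ha
  obtain ⟨D, L, N, hD, hL, hN, hstep⟩ := hU.exists_step H hε hT.le hH2 hA hR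
  have h0T : (0 : ℝ) ∈ Icc 0 T := ⟨le_rfl, hT.le⟩
  have hTT : T ∈ Icc 0 T := ⟨hT.le, le_rfl⟩
  have hA0 : 0 ≤ A := (norm_nonneg _).trans (hA 0 h0T)
  have hc := H.continuous_integrand hγ
  set c : ℝ → ℝ := fun r => 1 / 2 * ‖w r‖ ^ 2 + ℓ r (γ r) with hcdef
  -- The claim amounts to F(T) ≤ F(0). As `U` is not known to be regular in time, `F` is controlled
  -- only through its right increments.
  set F : ℝ → ℝ := fun s => U s (γ s) (w s) + (∫ r in 0..s, c r)
    + ε / 2 * ∫ r in 0..s, ‖a r‖ ^ 2 with hF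
  have hinc : ∀ s δ, 0 ≤ s → 0 < δ → s + δ ≤ T → F (s + δ) - F s
      = U (s + δ) (γ (s + δ)) (w (s + δ)) + (∫ r in s..(s + δ), c r) - U s (γ s) (w s)
        + ε / 2 * ∫ r in s..(s + δ), ‖a r‖ ^ 2 := fun s δ hs hδ hsδ => by
    have hsI : s ∈ Icc 0 T := ⟨hs, by linarith⟩
    have hsI' : s + δ ∈ Icc 0 T := ⟨by linarith, hsδ⟩
    simp only [hF]
    rw [← intervalIntegral.integral_add_adjacent_intervals (hc.intervalIntegrable 0 s)
      (hc.intervalIntegrable s (s + δ)), ← intervalIntegral.integral_add_adjacent_intervals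
      (hH2.intervalIntegrable_sq h0T hsI) (hH2.intervalIntegrable_sq hsI hsI')]
    ring
  set C := T + D * √T + L ^ 2 / (2 * ε) + L * A + ε / 2 * A ^ 2 with hC
  have hFC : ∀ s δ, 0 ≤ s → 0 < δ → s + δ ≤ T → F (s + δ) - F s ≤ C * δ := fun s δ hs hδ hsδ => by
    obtain ⟨b, hb, -⟩ := hstep s δ hs hδ hsδ
    have hsI : s ∈ Icc 0 T := ⟨hs, by linarith⟩
    have hsI' : s + δ ∈ Icc 0 T := ⟨by linarith, hsδ⟩
    have hsub : ∀ q ∈ uIoc s (s + δ), q ∈ Icc 0 T := fun q hq =>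
      (uIcc_subset_Icc hsI hsI') (uIoc_subset_uIcc hq)
    have h1 := intervalIntegral.norm_integral_le_of_norm_le_const (f := a) (C := A)
      fun q hq => hA q (hsub q hq)
    have h2 := intervalIntegral.norm_integral_le_of_norm_le_const (f := fun q => ‖a q‖ ^ 2)
      (C := A ^ 2) fun q hq => by
        rw [Real.norm_of_nonneg (sq_nonneg _)]
        exact pow_le_pow_left₀ (norm_nonneg _) (hA q (hsub q hq)) 2
    rw [add_sub_cancel_left, abs_of_pos hδ] at h1 h2
    have h3 := (Real.le_norm_self _).trans h2
    have h4 : ‖(∫ r in s..(s + δ), a r) - δ • b‖ ≤ A * δ + δ * ‖b‖ := by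
      refine (norm_sub_le _ _).trans (add_le_add h1 ?_)
      rw [norm_smul, Real.norm_of_nonneg hδ.le]
    have h5 := mul_le_mul_of_nonneg_left h4 hL
    -- No bound on the mean acceleration is at hand here; its quadratic cost absorbs the linear
    -- term.
    have h6 : L * ‖b‖ - ε / 2 * ‖b‖ ^ 2 ≤ L ^ 2 / (2 * ε) := by
      rw [le_div_iff₀ (by positivity)]
      nlinarith [sq_nonneg (L - ε * ‖b‖)]
    have h7 := mul_le_mul_of_nonneg_left h6 hδ.le
    have h8 : δ ^ 2 ≤ T * δ := by rw [sq]; exact mul_le_mul_of_nonneg_right (by linarith) hδ.le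
    have h9 : D * (δ * √δ) ≤ D * √T * δ := by
      have : D * (δ * √δ) ≤ D * (δ * √T) := mul_le_mul_of_nonneg_left
        (mul_le_mul_of_nonneg_left (Real.sqrt_le_sqrt (by linarith)) hδ.le) hD
      linarith
    have h10 := mul_le_mul_of_nonneg_left h3 (show 0 ≤ ε / 2 by positivity)
    rw [hinc s δ hs hδ hsδ, hC]
    linarith
  set G : ℝ → ℝ := fun s => C * s - F s with hG
  have hmono : MonotoneOn G (Icc 0 T) := fun s hs t ht hst => by
    rcases hst.eq_or_lt with rfl | hlt
    · exact le_rfl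
    have := hFC s (t - s) hs.1 (sub_pos.2 hlt) (by linarith [ht.2])
    rw [add_sub_cancel] at this
    simp only [hG]; linarith
  have hae : ∀ᵐ s ∂(volume.restrict (Icc 0 T)), C ≤ deriv G s := by
    have h1 := (hH2.intervalIntegrable h0T hTT).ae_hasDerivAt_integral
    have h2 := (hH2.intervalIntegrable_sq h0T hTT).ae_hasDerivAt_integral
    have h3 := hmono.ae_differentiableWithinAt_of_mem
    have h4 : ∀ᵐ s : ℝ, s ≠ 0 := by simp [ae_iff, measure_singleton]
    have h5 : ∀ᵐ s : ℝ, s ≠ T := by simp [ae_iff, measure_singleton]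
    rw [ae_restrict_iff' measurableSet_Icc] at hd ⊢
    filter_upwards [hd, h1, h2, h3, h4, h5] with s hd h1 h2 h3 h4 h5 hs
    have hs0 : 0 < s := lt_of_le_of_ne hs.1 (Ne.symm h4)
    have hsT : s < T := lt_of_le_of_ne hs.2 h5
    have hu : s ∈ uIcc 0 T := by rwa [uIcc_of_le hT.le]
    have hG' := ((h3 hs).differentiableAt (Icc_mem_nhds hs0 hsT)).hasDerivAt
    have hslope := hG'.tendsto_slope_zero_right
    have hA1 := (h1 hu s hu).tendsto_slope_zero_right
    have hA2 := (h2 hu s hu).tendsto_slope_zero_right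
    simp only [intervalIntegral.integral_same, sub_zero] at hA1 hA2
    have hsm : ∀ᶠ δ in 𝓝[>] (0 : ℝ), 0 < δ ∧ s + δ ≤ T := by
      filter_upwards [self_mem_nhdsWithin, nhdsWithin_le_nhds (gt_mem_nhds (sub_pos.2 hsT))]
        with δ h h'
      exact ⟨h, by linarith⟩
    have hex : ∀ δ, ∃ b : Space d, 0 < δ → s + δ ≤ T → _ := fun δ => by
      by_cases hδ : 0 < δ ∧ s + δ ≤ T
      · obtain ⟨b, hb⟩ := hstep s δ hs.1 hδ.1 hδ.2
        exact ⟨b, fun _ _ => hb⟩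
      · exact ⟨0, fun h h' => absurd ⟨h, h'⟩ hδ⟩
    choose b hb using hex
    -- Where the feedback law holds, almost optimal curves have asymptotically the same acceleration
    -- as the trajectory. The gain ε‖b‖²/2 and the spent cost ε‖a‖²/2 then balance, so F' ≤ 0.
    have hb_lim : Tendsto b (𝓝[>] 0) (𝓝 (a s)) := by
      refine tendsto_of_variation (hd hs).hasGradientAt hε (N := N) ?_
      filter_upwards [hsm] with δ hδ
      exact (hb δ hδ.1 hδ.2).2
    have hid : Tendsto (fun δ : ℝ => δ) (𝓝[>] 0) (𝓝 0) := nhdsWithin_le_nhds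
    have hsq : Tendsto (fun δ : ℝ => √δ) (𝓝[>] 0) (𝓝 0) := by
      have := (Real.continuous_sqrt.tendsto 0).comp hid
      rwa [Real.sqrt_zero] at this
    have hE : Tendsto (fun δ : ℝ => C - (δ + D * √δ - ε / 2 * ‖b δ‖ ^ 2
        + L * ‖δ⁻¹ • (∫ r in s..(s + δ), a r) - b δ‖
        + ε / 2 * (δ⁻¹ • ∫ r in s..(s + δ), ‖a r‖ ^ 2))) (𝓝[>] 0) (𝓝 C) := by
      have := tendsto_const_nhds (x := C).sub ((((hid.add (hsq.const_mul D)).sub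
        ((hb_lim.norm.pow 2).const_mul (ε / 2))).add ((hA1.sub hb_lim).norm.const_mul L)).add
          (hA2.const_mul (ε / 2)))
      simpa using this
    refine le_of_tendsto_of_tendsto hE hslope ?_
    filter_upwards [hsm] with δ ⟨hδ, hδT⟩
    have e1 := (hb δ hδ hδT).1
    have e2 := hinc s δ hs.1 hδ hδT
    have e3 : ‖(∫ r in s..(s + δ), a r) - δ • b δ‖
        = δ * ‖δ⁻¹ • (∫ r in s..(s + δ), a r) - b δ‖ := by
      rw [← Real.norm_of_nonneg hδ.le, ← norm_smul, smul_sub, Real.norm_of_nonneg hδ.le,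
        smul_inv_smul₀ hδ.ne']
    rw [e3] at e1
    simp only [smul_eq_mul, hG]
    rw [← sub_nonneg]
    have e4 : δ⁻¹ * (C * (s + δ) - F (s + δ) - (C * s - F s)) = C - δ⁻¹ * (F (s + δ) - F s) := by
      field_simp; ring
    rw [e4, e2]
    have e5 := mul_le_mul_of_nonneg_left e1 (inv_pos.2 hδ).le
    have e6 : δ⁻¹ * (U s (γ s) (w s) + δ ^ 2 + D * (δ * √δ) - δ * (ε / 2 * ‖b δ‖ ^ 2)
        + L * (δ * ‖δ⁻¹ • (∫ r in s..(s + δ), a r) - b δ‖))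
        = δ⁻¹ * U s (γ s) (w s) + (δ + D * √δ - ε / 2 * ‖b δ‖ ^ 2
          + L * ‖δ⁻¹ • (∫ r in s..(s + δ), a r) - b δ‖) := by
      linear_combination (δ + D * √δ - ε / 2 * ‖b δ‖ ^ 2
        + L * ‖δ⁻¹ • (∫ r in s..(s + δ), a r) - b δ‖) * inv_mul_cancel₀ hδ.ne'
    rw [e6] at e5
    linarith
  have huI : MonotoneOn G (uIcc 0 T) := by rwa [uIcc_of_le hT.le]
  have hGi := huI.intervalIntegrable_deriv
  -- For a monotone function the integral of the derivative is at most the increment. This is the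
  -- direction needed, so absolute continuity of `F` plays no role.
  have hGle := huI.intervalIntegral_deriv_mem_uIcc
  have hG0 : 0 ≤ G T - G 0 := sub_nonneg.2 (hmono h0T hTT hT.le)
  rw [uIcc_of_le hG0] at hGle
  have hCT := intervalIntegral.integral_mono_ae_restrict hT.le intervalIntegrable_const hGi hae
  rw [intervalIntegral.integral_const, smul_eq_mul, sub_zero] at hCT
  have hend : h (γ T) ≤ U T (γ T) (w T) := (hU T hTT _ _).2 (by
    rintro _ ⟨β, u, α, -, h1, -, rfl⟩
    simp [lagCost, h1])
  have hfin : F T ≤ F 0 := by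
    have e : G T - G 0 = C * T - F T + F 0 := by simp only [hG]; ring
    have hCT : T * C ≤ ∫ s in 0..T, deriv G s := hCT
    linarith [hGle.2]
  simp only [hF, intervalIntegral.integral_same, mul_zero, add_zero] at hfin
  unfold lagCost
  linarith

end IsAccValue

end

/-! ### From flows of measures to costs and value functions. -/

section

variable {d : ℕ}

/-- The projection of `s` to the time interval `[0, T]`. -/
def clampTime (T s : ℝ) : ℝ := max 0 (min s T)

theorem continuous_clampTime (T : ℝ) : Continuous (clampTime T) :=
  continuous_const.max (continuous_id.min continuous_const)

theorem clampTime_mem {T : ℝ} (hT : 0 ≤ T) (s : ℝ) : clampTime T s ∈ Icc 0 T :=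
  ⟨le_max_left _ _, max_le hT (min_le_right _ _)⟩

theorem clampTime_of_mem {T s : ℝ} (hs : s ∈ Icc 0 T) : clampTime T s = s := by
  rw [clampTime, min_eq_left hs.2, max_eq_right hs.1]

/-- The running cost along a flow of measures. -/
def flowCost (T : ℝ) (L₀ : Space d → P1 (Space d × Space d) → ℝ)
    (μ : ℝ → P1 (Space d × Space d)) (s : ℝ) (x : Space d) : ℝ :=
  L₀ x (μ (clampTime T s))

theorem flowCost_of_mem {T s : ℝ} (L₀ : Space d → P1 (Space d × Space d) → ℝ)
    (μ : ℝ → P1 (Space d × Space d)) (hs : s ∈ Icc 0 T) (x : Space d) :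
    flowCost T L₀ μ s x = L₀ x (μ s) := by
  rw [flowCost, clampTime_of_mem hs]

theorem abs_sub_le_of_norm_gradient_le {f : Space d → ℝ} {C : ℝ} (hf : Differentiable ℝ f)
    (hC : ∀ x, ‖gradient f x‖ ≤ C) (x y : Space d) : |f x - f y| ≤ C * ‖x - y‖ := by
  refine convex_univ.norm_image_sub_le_of_norm_fderiv_le (𝕜 := ℝ) (fun z _ => hf z)
    (fun z _ => ?_) (mem_univ y) (mem_univ x)
  have := hC z
  rwa [gradient, LinearIsometryEquiv.norm_map] at this

/-- The factor 2 comes from the terminal cost, for which only half of the gradient is bounded by M₀.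
Freezing the measure outside [0, T] makes the running cost continuous on the whole time line. -/
theorem costData_flowCost {T M₀ : ℝ} (hT : 0 ≤ T) {L₀ g : Space d → P1 (Space d × Space d) → ℝ}
    (hL₀ : CouplingAssumptions M₀ L₀) (hg : TerminalAssumptions M₀ g)
    {μ : ℝ → P1 (Space d × Space d)} (hμ : ContinuousFlow T μ) :
    CostData (2 * M₀) (flowCost T L₀ μ) (fun x => g x (μ T)) := by
  have hM := hg.half_le
  refine ⟨by linarith, continuous_iff_seqContinuous.2 fun p q hpq => ?_,
    fun s => hL₀.contDiff _, fun s x y => ?_, hg.contDiff _, fun x y => ?_⟩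
  · refine hL₀.continuous _ _ _ _ ((continuous_snd.tendsto q).comp hpq) ?_
    refine (hμ _ (clampTime_mem hT q.1)).comp (tendsto_nhdsWithin_iff.2
      ⟨?_, Eventually.of_forall fun n => clampTime_mem hT _⟩)
    exact (((continuous_clampTime T).comp continuous_fst).tendsto q).comp hpq
  · exact abs_sub_le_of_norm_gradient_le ((hL₀.contDiff _).differentiable one_ne_zero)
      (fun z => (hL₀.gradient_bound z _).trans (by linarith)) x y
  · exact abs_sub_le_of_norm_gradient_le ((hg.contDiff _).differentiable one_ne_zero)
      (fun z => by linarith [hg.gradient_bound z (μ T)]) x y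

theorem IsC1.isC1Curve {γ w : ℝ → Space d} (h : IsC1 γ w) (T : ℝ) : IsC1Curve T γ w :=
  ⟨fun s _ => (h.hasDerivAt s).hasDerivWithinAt, h.continuous_velocity.continuousOn⟩

/-- Curves are continued with constant velocity beyond [0, T], which removes one-sided derivatives
from all variational arguments. -/
theorem IsC1Curve.exists_isC1 {T : ℝ} (hT : 0 ≤ T) {γ w : ℝ → Space d} (h : IsC1Curve T γ w) :
    ∃ γ' w', IsC1 γ' w' ∧ ∀ s ∈ Icc 0 T, γ' s = γ s ∧ w' s = w s := by
  have hw : Continuous fun s => w (clampTime T s) :=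
    h.continuousOn.comp_continuous (continuous_clampTime T) (clampTime_mem hT)
  refine ⟨_, _, IsC1.of_integral hw 0 (γ 0), fun s hs => ⟨?_, ?_⟩⟩
  · have hγc : ContinuousOn γ (Icc 0 T) := fun r hr => (h.hasDerivWithinAt r hr).continuousWithinAt
    rw [intervalIntegral.integral_eq_sub_of_hasDeriv_right_of_le hs.1
      (hγc.mono (Icc_subset_Icc_right hs.2)) (fun r hr => ?_) (hw.intervalIntegrable _ _)]
    · abel
    · have hrI : r ∈ Icc 0 T := ⟨hr.1.le, hr.2.le.trans hs.2⟩
      rw [clampTime_of_mem hrI]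
      exact ((h.hasDerivWithinAt r hrI).hasDerivAt
        (Icc_mem_nhds hr.1 (hr.2.trans_le hs.2))).hasDerivWithinAt
  · simp only [clampTime_of_mem hs]

theorem IsH2.isH2Curve {T : ℝ} {γ w a : ℝ → Space d} (h : IsH2 T γ w a) : IsH2Curve T γ w a :=
  ⟨h.isC1.isC1Curve T, h.memLp, h.velocity_eq⟩

theorem IsH2Curve.exists_isH2 {T : ℝ} (hT : 0 ≤ T) {γ w a : ℝ → Space d}
    (h : IsH2Curve T γ w a) :
    ∃ γ' w', IsH2 T γ' w' a ∧ ∀ s ∈ Icc 0 T, γ' s = γ s ∧ w' s = w s := by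
  obtain ⟨γ', w', h1, h2⟩ := h.isC1Curve.exists_isC1 hT
  refine ⟨γ', w', ⟨h1, h.memLp, fun s hs => ?_⟩, h2⟩
  rw [(h2 s hs).2, (h2 0 ⟨le_rfl, hT⟩).2, h.velocity_eq s hs]

section Value

variable {T M₀ ε : ℝ} {L₀ g : Space d → P1 (Space d × Space d) → ℝ}
  {μ : ℝ → P1 (Space d × Space d)}

theorem lagCost_flowCost {t : ℝ} (ht : t ∈ Icc 0 T) {γ w γ' w' : ℝ → Space d}
    (h : ∀ s ∈ Icc 0 T, γ' s = γ s ∧ w' s = w s) :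
    lagCost T (flowCost T L₀ μ) (fun x => g x (μ T)) t γ' w'
      = (∫ s in t..T, (1 / 2 * ‖w s‖ ^ 2 + L₀ (γ s) (μ s))) + g (γ T) (μ T) := by
  have hT := ht.1.trans ht.2
  rw [lagCost, (h T ⟨hT, le_rfl⟩).1]
  congr 1
  refine intervalIntegral.integral_congr fun s hs => ?_
  rw [uIcc_of_le ht.2] at hs
  have hs' : s ∈ Icc 0 T := ⟨ht.1.trans hs.1, hs.2⟩
  simp only [(h s hs').1, (h s hs').2, flowCost_of_mem L₀ μ hs']

/-- Coercivity bounds the set of costs from below, so the real infimum is a true greatest lower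
bound and not a default value. -/
theorem isValue_limitValue (hT : 0 ≤ T) (hL₀ : CouplingAssumptions M₀ L₀)
    (hg : TerminalAssumptions M₀ g) (hμ : ContinuousFlow T μ) :
    IsValue T (flowCost T L₀ μ) (fun x => g x (μ T)) (limitValue T L₀ g μ) := by
  intro t ht x
  have hset : {c | ∃ γ w : ℝ → Space d, IsC1 γ w ∧ γ t = x ∧
        c = lagCost T (flowCost T L₀ μ) (fun x => g x (μ T)) t γ w}
      = {c | ∃ γ w : ℝ → Space d, IsC1Curve T γ w ∧ γ t = x ∧
        c = (∫ s in t..T, (1 / 2 * ‖w s‖ ^ 2 + L₀ (γ s) (μ s))) + g (γ T) (μ T)} := by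
    ext c
    constructor
    · rintro ⟨γ, w, h1, h2, rfl⟩
      exact ⟨γ, w, h1.isC1Curve T, h2, lagCost_flowCost ht fun _ _ => ⟨rfl, rfl⟩⟩
    · rintro ⟨γ, w, h1, h2, rfl⟩
      obtain ⟨γ', w', h3, h4⟩ := h1.exists_isC1 hT
      exact ⟨γ', w', h3, (h4 t ht).1.trans h2, (lagCost_flowCost ht h4).symm⟩
  have hb := (costData_flowCost hT hL₀ hg hμ).lagCost_bddBelow ht x
  rw [limitValue, ← hset]
  exact isGLB_csInf ⟨_, _, _, IsC1.line t x 0, by simp, rfl⟩ hb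

theorem isAccValue_accValue (hT : 0 ≤ T) (hε : 0 ≤ ε) (hL₀ : CouplingAssumptions M₀ L₀)
    (hg : TerminalAssumptions M₀ g) (hμ : ContinuousFlow T μ) :
    IsAccValue T ε (flowCost T L₀ μ) (fun x => g x (μ T)) (accValue T L₀ g ε μ) := by
  intro t ht x v
  have H := costData_flowCost hT hL₀ hg hμ
  have hTT : T ∈ Icc 0 T := ⟨hT, le_rfl⟩
  have hcost : ∀ γ w a γ' w' : ℝ → Space d, IsH2 T γ' w' a → (∀ s ∈ Icc 0 T, γ' s = γ s ∧ w' s = w s) →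
      (∫ s in t..T, (ε / 2 * ‖a s‖ ^ 2 + 1 / 2 * ‖w s‖ ^ 2 + L₀ (γ s) (μ s))) + g (γ T) (μ T)
        = ε / 2 * (∫ s in t..T, ‖a s‖ ^ 2)
          + lagCost T (flowCost T L₀ μ) (fun x => g x (μ T)) t γ' w' := by
    intro γ w a γ' w' h1 h2
    have hc := (H.continuous_integrand h1.isC1).intervalIntegrable (μ := volume) t T
    rw [lagCost, (h2 T hTT).1, ← add_assoc, ← intervalIntegral.integral_const_mul,
      ← intervalIntegral.integral_add ((h1.intervalIntegrable_sq ht hTT).const_mul _) hc]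
    congr 1
    refine intervalIntegral.integral_congr fun s hs => ?_
    rw [uIcc_of_le ht.2] at hs
    have hs' : s ∈ Icc 0 T := ⟨ht.1.trans hs.1, hs.2⟩
    simp only [(h2 s hs').1, (h2 s hs').2, flowCost_of_mem L₀ μ hs', add_assoc]
  have hset : {c | ∃ γ w a : ℝ → Space d, IsH2 T γ w a ∧ γ t = x ∧ w t = v ∧
        c = ε / 2 * (∫ s in t..T, ‖a s‖ ^ 2)
          + lagCost T (flowCost T L₀ μ) (fun x => g x (μ T)) t γ w}
      = {c | ∃ γ w a : ℝ → Space d, IsH2Curve T γ w a ∧ γ t = x ∧ w t = v ∧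
        c = (∫ s in t..T, (ε / 2 * ‖a s‖ ^ 2 + 1 / 2 * ‖w s‖ ^ 2 + L₀ (γ s) (μ s)))
          + g (γ T) (μ T)} := by
    ext c
    constructor
    · rintro ⟨γ, w, a, h1, h2, h3, rfl⟩
      exact ⟨γ, w, a, h1.isH2Curve, h2, h3, (hcost γ w a γ w h1 fun _ _ => ⟨rfl, rfl⟩).symm⟩
    · rintro ⟨γ, w, a, h1, h2, h3, rfl⟩
      obtain ⟨γ', w', h4, h5⟩ := h1.exists_isH2 hT
      exact ⟨γ', w', a, h4, (h5 t ht).1.trans h2, (h5 t ht).2.trans h3, hcost γ w a γ' w' h4 h5⟩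
  obtain ⟨B, hB⟩ := H.lagCost_bddBelow ht x
  rw [accValue, ← hset]
  refine isGLB_csInf ⟨_, _, _, _, IsH2.line T t x v, by simp, rfl, rfl⟩ ⟨B, ?_⟩
  rintro _ ⟨γ, w, a, h1, h2, -, rfl⟩
  have h3 := hB ⟨γ, w, h1.isC1, h2, rfl⟩
  have h4 : 0 ≤ ε / 2 * ∫ s in t..T, ‖a s‖ ^ 2 :=
    mul_nonneg (by positivity) (intervalIntegral.integral_nonneg ht.2 fun _ _ => sq_nonneg _)
  linarith

/-- Feedback trajectories are optimal. -/
theorem IsFeedbackTrajectory.exists_isH2 (hT : 0 < T) (hε : 0 < ε)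
    (hL₀ : CouplingAssumptions M₀ L₀) (hg : TerminalAssumptions M₀ g) (hμ : ContinuousFlow T μ)
    {x v : Space d} {γ w : ℝ → Space d}
    (h : IsFeedbackTrajectory T ε (accValue T L₀ g ε μ) x v γ w) :
    ∃ γ' w' a, IsH2 T γ' w' a ∧ (∀ s ∈ Icc 0 T, γ' s = γ s ∧ w' s = w s) ∧ γ' 0 = x ∧ w' 0 = v ∧
      ε / 2 * (∫ s in 0..T, ‖a s‖ ^ 2)
        + lagCost T (flowCost T L₀ μ) (fun x => g x (μ T)) 0 γ' w' ≤ accValue T L₀ g ε μ 0 x v := by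
  have H := costData_flowCost hT.le hL₀ hg hμ
  have hU := isAccValue_accValue hT.le hε.le hL₀ hg hμ
  set U := accValue T L₀ g ε μ with hUdef
  obtain ⟨γ', w', h1, h2⟩ := h.isC1Curve.exists_isC1 hT.le
  have h0 : (0 : ℝ) ∈ Icc 0 T := ⟨le_rfl, hT.le⟩
  have hγ0 : γ' 0 = x := (h2 0 h0).1.trans h.position_zero
  have hw0 : w' 0 = v := (h2 0 h0).2.trans h.velocity_zero
  have hgr : ∀ s ∈ Icc 0 T, gradient (U s (γ' s)) (w' s) = gradient (fun v' => U s (γ s) v') (w s) :=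
    fun s hs => by rw [(h2 s hs).1, (h2 s hs).2]
  have hd : ∀ᵐ s ∂(volume.restrict (Icc 0 T)), DifferentiableAt ℝ (U s (γ' s)) (w' s) := by
    filter_upwards [h.differentiable, ae_restrict_mem measurableSet_Icc] with s hs hsI
    rw [(h2 s hsI).1, (h2 s hsI).2]; exact hs
  have hi : IntervalIntegrable (fun s => gradient (U s (γ' s)) (w' s)) volume 0 T :=
    h.integrable.congr fun s hs => by
      rw [uIoc_of_le hT.le] at hs
      exact (hgr s (Ioc_subset_Icc_self hs)).symm
  have hv : ∀ t ∈ Icc 0 T,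
      w' t = w' 0 + ∫ s in 0..t, -((1 / ε) • gradient (U s (γ' s)) (w' s)) := fun t ht => by
    rw [(h2 t ht).2, hw0, h.velocity_eq t ht]
    congr 1
    refine intervalIntegral.integral_congr fun s hs => ?_
    rw [uIcc_of_le ht.1] at hs
    simp only [hgr s ⟨hs.1, hs.2.trans ht.2⟩]
  have h3 := hU.cost_le_of_feedback H hε hT h1 hd hi hv
  rw [hγ0, hw0] at h3
  exact ⟨γ', w', _, (hU.isH2_of_feedback H hε hT.le h1 hi hv).1, h2, hγ0, hw0, h3⟩

end Value

end

/-! ### Optimal curves with small ε are almost minimizers of the limit problem. -/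

section

variable {d : ℕ}

section NearMinimality

variable {M T : ℝ} {ℓ : ℝ → Space d → ℝ} {h : Space d → ℝ}

/-- Minimizers are of class `H²`. -/
theorem IsMinimizer.isH2 {γ w : ℝ → Space d} (hγ : IsMinimizer T ℓ h γ w) (H : CostData M ℓ h)
    (hT : 0 < T) : IsH2 T γ w (fun s => gradient (ℓ s) (γ s)) := by
  have hc := hγ.isC1.continuous
  refine ⟨hγ.isC1, MemLp.of_bound (H.measurable_gradient_comp hc).aestronglyMeasurable M
    (Eventually.of_forall fun s => H.norm_gradient_le _ _), fun s hs => ?_⟩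
  rw [H.velocity_eq hT hγ hs, H.velocity_eq hT hγ ⟨le_rfl, hT.le⟩, eulerVelocity, eulerVelocity,
    ← intervalIntegral.integral_add_adjacent_intervals
      (H.intervalIntegrable_gradient hc 0 s) (H.intervalIntegrable_gradient hc s T)]
  abel

/-- Prescribing the initial velocity does not change the infimum. -/
theorem IsValue.exists_isH2_lt {V : ℝ → Space d → ℝ} (hV : IsValue T ℓ h V) (H : CostData M ℓ h)
    (hT : 0 < T) (x v : Space d) {η : ℝ} (hη : 0 < η) :
    ∃ σ u α, IsH2 T σ u α ∧ σ 0 = x ∧ u 0 = v ∧ lagCost T ℓ h 0 σ u < V 0 x + η := by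
  obtain ⟨γ, w, hmin, rfl⟩ := H.exists_minimizer hT.le x
  have hH2 := hmin.isH2 H hT
  obtain ⟨C, hC⟩ := H.lagCost_exp_bump_le hmin.isC1 (T := T) (t := 0) ⟨le_rfl, hT.le⟩ (v - w 0)
  set δ := η / (|C| + 1) with hδ
  have hδ0 : 0 < δ := by positivity
  have hCδ : C * δ < η := by
    have : (|C| + 1) * δ = η := by rw [hδ]; field_simp
    have := mul_le_mul_of_nonneg_right (le_abs_self C) hδ0.le
    linarith
  -- An initial layer of width δ switches from `v` to the velocity of the minimizer. Its
  -- acceleration is of order 1/δ, but δ depends on η only, so the curve is a fixed H² competitor.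
  set κ : ℝ → ℝ := fun s => Real.exp (-(s - 0) / δ) with hκ
  set κ' : ℝ → ℝ := fun s => Real.exp (-(s - 0) / δ) * (-1 / δ) with hκ'
  have hκc : Continuous κ := by fun_prop
  have hκc' : Continuous κ' := by fun_prop
  have hderiv : ∀ s, HasDerivAt κ (κ' s) s := fun s =>
    ((((hasDerivAt_id s).sub_const 0).neg).div_const δ).exp
  obtain ⟨B, hB⟩ := (isCompact_Icc (a := (0 : ℝ)) (b := T)).exists_bound_of_continuousOn
    hκc'.continuousOn
  have hκ2 : MemLp κ' 2 (volume.restrict (Icc 0 T)) := MemLp.of_bound hκc'.aestronglyMeasurable B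
    ((ae_restrict_mem measurableSet_Icc).mono hB)
  have h1 := hH2.add_bump hκc hκ2 (fun s _ => by
    rw [intervalIntegral.integral_eq_sub_of_hasDerivAt (fun r _ => hderiv r)
      (hκc'.intervalIntegrable _ _)]; abel) 0 (v - w 0)
  refine ⟨_, _, _, h1, by simp, by simp [hκ], ?_⟩
  have h2 := hC δ hδ0
  rw [hV.eq_of_isMinimizer hT.le hmin]
  exact h2.trans_lt (by linarith)

variable {ℓk : ℕ → ℝ → Space d → ℝ} {hk : ℕ → Space d → ℝ} {ε : ℕ → ℝ}
  {Uk : ℕ → ℝ → Space d → Space d → ℝ} {γ w a : ℕ → ℝ → Space d}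

theorem IsAccValue.integral_sq_le {ε : ℝ} {U : ℝ → Space d → Space d → ℝ} {γ w a : ℝ → Space d}
    (hU : IsAccValue T ε ℓ h U) (H : CostData M ℓ h) (hε : 0 < ε) (hT : 0 < T)
    (hγ : IsH2 T γ w a)
    (hle : ε / 2 * (∫ s in 0..T, ‖a s‖ ^ 2) + lagCost T ℓ h 0 γ w ≤ U 0 (γ 0) (w 0)) :
    ∫ s in 0..T, ‖w s‖ ^ 2 ≤ 4 * energyBound T M ‖w 0‖ := by
  have h1 := hU.energy_le H ⟨le_rfl, hT.le⟩ hγ (by linarith)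
  have h2 : 0 ≤ ε / 2 * ∫ s in 0..T, ‖a s‖ ^ 2 :=
    mul_nonneg (by positivity) (intervalIntegral.integral_nonneg hT.le fun _ _ => sq_nonneg _)
  linarith

/-- Minimizers of the problems with control of acceleration are almost minimizers of the limit
problem. -/
theorem tendsto_lagCost_of_accMinimizers (hT : 0 < T) (H : CostData M ℓ h)
    (Hk : ∀ k, CostData M (ℓk k) (hk k)) {V : ℝ → Space d → ℝ} (hV : IsValue T ℓ h V)
    (hε : ∀ k, 0 < ε k) (hε0 : Tendsto ε atTop (𝓝 0))
    (hU : ∀ k, IsAccValue T (ε k) (ℓk k) (hk k) (Uk k))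
    (hℓ : ∀ s ∈ Ioc 0 T, ∀ (R : ℝ) (y : ℕ → Space d), (∀ k, ‖y k‖ ≤ R) →
      Tendsto (fun k => ℓ s (y k) - ℓk k s (y k)) atTop (𝓝 0))
    (hh : ∀ y : ℕ → Space d, Tendsto (fun k => h (y k) - hk k (y k)) atTop (𝓝 0))
    {x v : Space d} (hγ : ∀ k, IsH2 T (γ k) (w k) (a k)) (h0 : ∀ k, γ k 0 = x)
    (hw0 : ∀ k, w k 0 = v)
    (hle : ∀ k, ε k / 2 * (∫ s in 0..T, ‖a k s‖ ^ 2) + lagCost T (ℓk k) (hk k) 0 (γ k) (w k)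
      ≤ Uk k 0 x v) :
    Tendsto (fun k => lagCost T ℓ h 0 (γ k) (w k)) atTop (𝓝 (V 0 x)) := by
  have h0T : (0 : ℝ) ∈ Icc 0 T := ⟨le_rfl, hT.le⟩
  have hM := H.nonneg
  have hlow : ∀ k, V 0 x ≤ lagCost T ℓ h 0 (γ k) (w k) := fun k => by
    rw [← h0 k]; exact hV.le h0T (hγ k).isC1
  set Q := 4 * energyBound T M ‖v‖ with hQ
  have hQ0 : 0 ≤ Q := mul_nonneg (by norm_num) (energyBound_nonneg hT.le hM (norm_nonneg _))
  have hen : ∀ k, ∫ s in 0..T, ‖w k s‖ ^ 2 ≤ Q := fun k => by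
    have := (hU k).integral_sq_le (Hk k) (hε k) hT (hγ k) (by rw [h0 k, hw0 k]; exact hle k)
    rwa [hw0 k] at this
  set R := √(T * Q) + ‖x‖ with hR
  have hγR : ∀ k, ∀ s ∈ Icc 0 T, ‖γ k s‖ ≤ R := fun k s hs => by
    have h1 := (hγ k).isC1.norm_sub_le_sqrt (hen k) hs h0T
    rw [h0 k, sub_zero, abs_of_nonneg hs.1] at h1
    have h2 : √(s * Q) ≤ √(T * Q) := Real.sqrt_le_sqrt (mul_le_mul_of_nonneg_right hs.2 hQ0)
    have h3 := norm_sub_norm_le (γ k s) x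
    linarith
  refine tendsto_order.2 ⟨fun b hb => Eventually.of_forall fun k => hb.trans_le (hlow k),
    fun b hb => ?_⟩
  obtain ⟨σ, u, α, hσ, hσ0, hu0, hlt⟩ := hV.exists_isH2_lt H hT x v (sub_pos.2 hb)
  rw [add_sub_cancel] at hlt
  obtain ⟨B, hB⟩ := (isCompact_Icc (a := (0 : ℝ)) (b := T)).exists_bound_of_continuousOn
    hσ.isC1.continuous.continuousOn
  have hcomp : ∀ k, lagCost T (ℓk k) (hk k) 0 (γ k) (w k)
      ≤ ε k / 2 * (∫ s in 0..T, ‖α s‖ ^ 2) + lagCost T (ℓk k) (hk k) 0 σ u := fun k => by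
    have h1 := (hU k).le h0T hσ
    rw [hσ0, hu0] at h1
    have h2 : 0 ≤ ε k / 2 * ∫ s in 0..T, ‖a k s‖ ^ 2 := mul_nonneg (by have := hε k; positivity)
      (intervalIntegral.integral_nonneg hT.le fun _ _ => sq_nonneg _)
    linarith [hle k]
  -- The costs ℓ and ℓk are compared through second differences: by the Lipschitz bounds these are
  -- dominated uniformly in `k`, while ℓ - ℓk has no assumed bound as s → 0, where convergence is
  -- not assumed.
  set f : ℕ → ℝ → ℝ := fun k s =>
    (ℓ s (γ k s) - ℓk k s (γ k s)) - (ℓ s (σ s) - ℓk k s (σ s)) with hf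
  have hfc : ∀ k, Continuous (f k) := fun k =>
    ((H.continuous_comp (hγ k).isC1.continuous).sub
      ((Hk k).continuous_comp (hγ k).isC1.continuous)).sub
    ((H.continuous_comp hσ.isC1.continuous).sub ((Hk k).continuous_comp hσ.isC1.continuous))
  have hflim : Tendsto (fun k => ∫ s in 0..T, f k s) atTop (𝓝 (∫ _ in 0..T, (0 : ℝ))) := by
    refine intervalIntegral.tendsto_integral_filter_of_dominated_convergence
      (fun _ => 2 * (M * (R + B))) (Eventually.of_forall fun k => (hfc k).aestronglyMeasurable)
      (Eventually.of_forall fun k => Eventually.of_forall fun s hs => ?_)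
      intervalIntegrable_const (Eventually.of_forall fun s hs => ?_)
    · rw [uIoc_of_le hT.le] at hs
      have hsI := Ioc_subset_Icc_self hs
      have e1 : M * ‖γ k s - σ s‖ ≤ M * (R + B) := mul_le_mul_of_nonneg_left
        ((norm_sub_le _ _).trans (add_le_add (hγR k s hsI) (hB s hsI))) hM
      have e2 := abs_le.1 ((H.lip s (γ k s) (σ s)).trans e1)
      have e3 := abs_le.1 (((Hk k).lip s (γ k s) (σ s)).trans e1)
      rw [Real.norm_eq_abs, abs_le]
      simp only [hf]
      constructor <;> linarith [e2.1, e2.2, e3.1, e3.2]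
    · rw [uIoc_of_le hT.le] at hs
      have hsI := Ioc_subset_Icc_self hs
      have := (hℓ s hs R (fun k => γ k s) fun k => hγR k s hsI).sub
        (hℓ s hs B (fun _ => σ s) fun _ => hB s hsI)
      simpa using this
  rw [intervalIntegral.integral_zero] at hflim
  have hid : ∀ k, lagCost T ℓ h 0 (γ k) (w k) = lagCost T (ℓk k) (hk k) 0 (γ k) (w k)
      + (lagCost T ℓ h 0 σ u - lagCost T (ℓk k) (hk k) 0 σ u) + (∫ s in 0..T, f k s)
      + ((h (γ k T) - hk k (γ k T)) - (h (σ T) - hk k (σ T))) := fun k => by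
    have i1 := (H.continuous_integrand (hγ k).isC1).intervalIntegrable (μ := volume) 0 T
    have i2 := ((Hk k).continuous_integrand (hγ k).isC1).intervalIntegrable (μ := volume) 0 T
    have i3 := (H.continuous_integrand hσ.isC1).intervalIntegrable (μ := volume) 0 T
    have i4 := ((Hk k).continuous_integrand hσ.isC1).intervalIntegrable (μ := volume) 0 T
    have e : ∫ s in 0..T, f k s = ((∫ s in 0..T, (1 / 2 * ‖w k s‖ ^ 2 + ℓ s (γ k s)))
        - ∫ s in 0..T, (1 / 2 * ‖w k s‖ ^ 2 + ℓk k s (γ k s)))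
        - ((∫ s in 0..T, (1 / 2 * ‖u s‖ ^ 2 + ℓ s (σ s)))
        - ∫ s in 0..T, (1 / 2 * ‖u s‖ ^ 2 + ℓk k s (σ s))) := by
      rw [← intervalIntegral.integral_sub i1 i2, ← intervalIntegral.integral_sub i3 i4,
        ← intervalIntegral.integral_sub (i1.sub i2) (i3.sub i4)]
      refine intervalIntegral.integral_congr fun s _ => ?_
      simp only [hf]; ring
    simp only [lagCost]
    linarith
  have hX : Tendsto (fun k => ε k / 2 * (∫ s in 0..T, ‖α s‖ ^ 2) + lagCost T ℓ h 0 σ u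
      + (∫ s in 0..T, f k s) + ((h (γ k T) - hk k (γ k T)) - (h (σ T) - hk k (σ T)))) atTop
      (𝓝 (lagCost T ℓ h 0 σ u)) := by
    have := ((((hε0.div_const 2).mul_const (∫ s in 0..T, ‖α s‖ ^ 2)).add_const
      (lagCost T ℓ h 0 σ u)).add hflim).add ((hh fun k => γ k T).sub (hh fun _ => σ T))
    simpa using this
  filter_upwards [hX.eventually (gt_mem_nhds hlt)] with k hk'
  linarith [hid k, hcomp k]

end NearMinimality

end

/-! ### Functionals of curves with the same limit at every minimizer. -/

section

variable {d : ℕ}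

section Limits

variable {M T : ℝ} {ℓ : ℝ → Space d → ℝ} {h : Space d → ℝ} {V : ℝ → Space d → ℝ}
  {σ u : ℕ → ℝ → Space d} {x : Space d}

/-- Every subsequence has a further one converging to some minimizer. As the limit `c` is the same
for all minimizers, the whole sequence of values converges without any uniqueness. -/
theorem IsValue.tendsto_of_tendsto_lagCost (hV : IsValue T ℓ h V) (H : CostData M ℓ h) (hT : 0 < T)
    (hσ : ∀ k, IsC1 (σ k) (u k)) (h0 : ∀ k, σ k 0 = x)
    (hlim : Tendsto (fun k => lagCost T ℓ h 0 (σ k) (u k)) atTop (𝓝 (V 0 x))) {Θ : ℕ → ℝ} {c : ℝ}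
    (hΘ : ∀ (φ : ℕ → ℕ) (γ w : ℝ → Space d), IsMinimizer T ℓ h γ w → γ 0 = x →
      TendstoUniformlyOn (fun k => σ (φ k)) γ atTop (Icc 0 T) →
      Tendsto (fun k => ∫ s in 0..T, ‖u (φ k) s - w s‖ ^ 2) atTop (𝓝 0) →
      Tendsto (fun k => Θ (φ k)) atTop (𝓝 c)) : Tendsto Θ atTop (𝓝 c) := by
  refine tendsto_of_subseq_tendsto fun ns hns => ?_
  obtain ⟨φ, -, γ, w, hmin, hγ0, -, hunif, hL2⟩ := H.exists_subseq_minimizer hT.le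
    (fun k => hσ (ns k)) (fun k => h0 (ns k))
    (fun β β' hβ hβ0 => by rw [← hβ0]; exact hV.le ⟨le_rfl, hT.le⟩ hβ) (hlim.comp hns)
  exact ⟨φ, hΘ (fun k => ns (φ k)) γ w hmin hγ0 hunif hL2⟩

/-- The truncated distance to the graph of the minimizers. -/
def graphDist (T : ℝ) (ℓ : ℝ → Space d → ℝ) (h : Space d → ℝ) (q : ℝ × (Space d × Space d)) : ℝ :=
  min (Metric.infDist q (minimizerGraph T ℓ h)) 1

theorem lipschitzWith_graphDist : LipschitzWith 1 (graphDist T ℓ h) :=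
  (Metric.lipschitz_infDist_pt _).min_const 1

theorem graphDist_nonneg (q : ℝ × (Space d × Space d)) : 0 ≤ graphDist T ℓ h q :=
  le_min Metric.infDist_nonneg zero_le_one

theorem graphDist_le_one (q : ℝ × (Space d × Space d)) : graphDist T ℓ h q ≤ 1 :=
  min_le_right _ _

theorem graphDist_le {γ w : ℝ → Space d} (hγ : IsMinimizer T ℓ h γ w) {t : ℝ} (ht : t ∈ Icc 0 T)
    (y v : Space d) : graphDist T ℓ h (t, y, v) ≤ ‖y - γ t‖ + ‖v - w t‖ := by
  have hmem : (t, γ t, w t) ∈ minimizerGraph T ℓ h := ⟨ht, γ, w, hγ, rfl, rfl⟩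
  refine (min_le_left _ _).trans ((Metric.infDist_le_dist_of_mem hmem).trans ?_)
  change max (dist t t) (max (dist y (γ t)) (dist v (w t))) ≤ _
  rw [dist_self, dist_eq_norm, dist_eq_norm]
  exact max_le (by positivity) (max_le (le_add_of_nonneg_right (norm_nonneg _))
    (le_add_of_nonneg_left (norm_nonneg _)))

theorem mem_minimizerGraph_of_graphDist (hV : IsValue T ℓ h V) (H : CostData M ℓ h) (hT : 0 < T)
    {q : ℝ × (Space d × Space d)} (hq : graphDist T ℓ h q = 0) : q ∈ minimizerGraph T ℓ h := by
  obtain ⟨γ, w, hγ, -⟩ := H.exists_minimizer hT.le 0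
  -- The distance to the empty set is 0 by convention, so nonemptiness has to be supplied.
  have hne : (minimizerGraph T ℓ h).Nonempty :=
    ⟨(0, γ 0, w 0), ⟨le_rfl, hT.le⟩, γ, w, hγ, rfl, rfl⟩
  rw [(isClosed_minimizerGraph hV H hT).mem_iff_infDist_zero hne]
  rcases min_choice (Metric.infDist q (minimizerGraph T ℓ h)) 1 with h1 | h1
  · rw [← h1]; exact hq
  · rw [graphDist, h1] at hq; norm_num at hq

/-- The distance to the graph is at most that to any single limit minimizer, which tends to 0 in L¹
along the subsequence. -/
theorem IsValue.tendsto_integral_graphDist (hV : IsValue T ℓ h V) (H : CostData M ℓ h) (hT : 0 < T)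
    (hσ : ∀ k, IsC1 (σ k) (u k)) (h0 : ∀ k, σ k 0 = x)
    (hlim : Tendsto (fun k => lagCost T ℓ h 0 (σ k) (u k)) atTop (𝓝 (V 0 x))) :
    Tendsto (fun k => ∫ t in 0..T, graphDist T ℓ h (t, σ k t, u k t)) atTop (𝓝 0) := by
  refine hV.tendsto_of_tendsto_lagCost H hT hσ h0 hlim fun φ γ w hγ _ hunif hL2 => ?_
  have hc1 : ∀ k, Continuous fun t => ‖σ (φ k) t - γ t‖ := fun k =>
    ((hσ _).continuous.sub hγ.isC1.continuous).norm
  have hc2 : ∀ k, Continuous fun t => ‖u (φ k) t - w t‖ := fun k =>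
    ((hσ _).continuous_velocity.sub hγ.isC1.continuous_velocity).norm
  have h1 : Tendsto (fun k => ∫ t in 0..T, ‖σ (φ k) t - γ t‖) atTop (𝓝 (∫ _ in 0..T, (0 : ℝ))) := by
    refine intervalIntegral.tendsto_integral_filter_of_dominated_convergence (fun _ => 1)
      (Eventually.of_forall fun k => (hc1 k).aestronglyMeasurable) ?_ intervalIntegrable_const
      (Eventually.of_forall fun t ht => ?_)
    · filter_upwards [Metric.tendstoUniformlyOn_iff.1 hunif 1 one_pos] with k hk
      refine Eventually.of_forall fun t ht => ?_
      rw [uIoc_of_le hT.le] at ht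
      have := hk t (Ioc_subset_Icc_self ht)
      rw [dist_comm, dist_eq_norm] at this
      rw [norm_norm]; exact this.le
    · rw [uIoc_of_le hT.le] at ht
      have := ((hunif.tendsto_at (Ioc_subset_Icc_self ht)).sub_const (γ t)).norm
      simpa using this
  rw [intervalIntegral.integral_zero] at h1
  have h2 : Tendsto (fun k => √(T * ∫ s in 0..T, ‖u (φ k) s - w s‖ ^ 2)) atTop (𝓝 0) := by
    have := (Real.continuous_sqrt.tendsto _).comp (hL2.const_mul T)
    rwa [mul_zero, Real.sqrt_zero] at this
  have h12 := h1.add h2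
  rw [add_zero] at h12
  refine squeeze_zero (fun k => intervalIntegral.integral_nonneg hT.le fun t _ =>
    graphDist_nonneg _) (fun k => ?_) h12
  have h3 := IsC1.integral_norm_le_sqrt ((hσ (φ k)).continuous_velocity.sub
    hγ.isC1.continuous_velocity) hT.le
  rw [sub_zero] at h3
  simp only [Pi.sub_apply] at h3
  refine le_trans ?_ (add_le_add_right h3 _)
  rw [← intervalIntegral.integral_add ((hc1 k).intervalIntegrable _ _)
    ((hc2 k).intervalIntegrable _ _)]
  refine intervalIntegral.integral_mono_on hT.le (Continuous.intervalIntegrable ?_ _ _)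
    (((hc1 k).add (hc2 k)).intervalIntegrable _ _) fun t ht => graphDist_le hγ ht _ _
  exact lipschitzWith_graphDist.continuous.comp (continuous_id.prodMk
    ((hσ _).continuous.prodMk (hσ _).continuous_velocity))

/-- The derivative of `ψ` along a motion with velocity `v`, truncated for large velocities. -/
def transportTest (ψ : ℝ × Space d → ℝ) (χ : Space d → ℝ) (q : ℝ × (Space d × Space d)) : ℝ :=
  χ q.2.2 * fderiv ℝ ψ (q.1, q.2.1) (1, q.2.2)

section TransportTest

variable {ψ : ℝ × Space d → ℝ} {χ : Space d → ℝ}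

theorem contDiff_transportTest (hψ : ContDiff ℝ ∞ ψ) (hχ : ContDiff ℝ ∞ χ) :
    ContDiff ℝ 1 (transportTest ψ χ) := by
  have h1 : ContDiff ℝ 1 (fderiv ℝ ψ) := hψ.fderiv_right (by norm_cast)
  have h2 : ContDiff ℝ 1 χ := hχ.of_le (by norm_cast)
  exact (h2.comp (by fun_prop)).mul ((h1.comp (by fun_prop)).clm_apply (by fun_prop))

theorem hasCompactSupport_transportTest (hψ : HasCompactSupport ψ) (hχ : HasCompactSupport χ) :
    HasCompactSupport (transportTest ψ χ) := by
  have h1 : HasCompactSupport (fderiv ℝ ψ) := hψ.fderiv ℝ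
  have hK : IsCompact ((Homeomorph.prodAssoc ℝ (Space d) (Space d)) ''
      (tsupport (fderiv ℝ ψ) ×ˢ tsupport χ)) :=
    (h1.isCompact.prod hχ.isCompact).image (Homeomorph.continuous _)
  refine HasCompactSupport.intro hK fun q hq => ?_
  by_contra hne
  refine hq ⟨((q.1, q.2.1), q.2.2), ⟨subset_tsupport _ ?_, subset_tsupport _ ?_⟩, rfl⟩
  · intro h0
    exact hne (by simp only [transportTest, h0]; simp)
  · intro h0
    exact hne (by simp only [transportTest, h0, zero_mul])

theorem hasDerivAt_comp_curve (hψ : ContDiff ℝ ∞ ψ) {γ w : ℝ → Space d} (hγ : IsC1 γ w) (t : ℝ) :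
    HasDerivAt (fun s => ψ (s, γ s)) (fderiv ℝ ψ (t, γ t) (1, w t)) t :=
  ((hψ.differentiable (by simp)) (t, γ t)).hasFDerivAt.comp_hasDerivAt t
    ((hasDerivAt_id t).prodMk (hγ.hasDerivAt t))

theorem continuous_fderiv_comp_curve (hψ : ContDiff ℝ ∞ ψ) {γ w : ℝ → Space d} (hγ : IsC1 γ w) :
    Continuous fun t => fderiv ℝ ψ (t, γ t) (1, w t) :=
  ((hψ.continuous_fderiv (by simp)).comp (continuous_id.prodMk hγ.continuous)).clm_apply
    (continuous_const.prodMk hγ.continuous_velocity)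

theorem integral_fderiv_comp_curve (hψ : ContDiff ℝ ∞ ψ) {γ w : ℝ → Space d} (hγ : IsC1 γ w)
    (hψT : ψ (T, γ T) = 0) : ∫ t in 0..T, fderiv ℝ ψ (t, γ t) (1, w t) = -ψ (0, γ 0) := by
  rw [intervalIntegral.integral_eq_sub_of_hasDerivAt (fun t _ => hasDerivAt_comp_curve hψ hγ t)
    ((continuous_fderiv_comp_curve hψ hγ).intervalIntegrable _ _), hψT, zero_sub]

/-- Without the cutoff the integral equals -ψ(0, x) for every `k`. The cutoff acts only at speeds
beyond M(T + 1) + 1, hence at distance at least 1 from the velocity of the limit minimizer, and the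
error is bounded by a multiple of ‖u - w‖². -/
theorem IsValue.tendsto_integral_transportTest (hV : IsValue T ℓ h V) (H : CostData M ℓ h)
    (hT : 0 < T) (hσ : ∀ k, IsC1 (σ k) (u k)) (h0 : ∀ k, σ k 0 = x)
    (hlim : Tendsto (fun k => lagCost T ℓ h 0 (σ k) (u k)) atTop (𝓝 (V 0 x)))
    (hψ : ContDiff ℝ ∞ ψ) (hψc : HasCompactSupport ψ) (hψT : ∀ y, ψ (T, y) = 0)
    (hχ : ContDiff ℝ ∞ χ) (hχ1 : ∀ v, ‖v‖ ≤ M * (T + 1) + 1 → χ v = 1) (hχ0 : ∀ v, χ v ∈ Icc 0 1) :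
    Tendsto (fun k => ∫ t in 0..T, transportTest ψ χ (t, σ k t, u k t)) atTop
      (𝓝 (-ψ (0, x))) := by
  have hM := H.nonneg
  set R := M * (T + 1) with hR
  have hR0 : 0 ≤ R := by positivity
  obtain ⟨C, hC⟩ := (hψc.fderiv ℝ).exists_bound_of_continuous (hψ.continuous_fderiv (by simp))
  have hC0 : 0 ≤ C := (norm_nonneg _).trans (hC (0, 0))
  refine hV.tendsto_of_tendsto_lagCost H hT hσ h0 hlim fun φ γ w hγ _ hunif hL2 => ?_
  have hc1 : ∀ k, Continuous fun t => transportTest ψ χ (t, σ k t, u k t) := fun k =>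
    (contDiff_transportTest hψ hχ).continuous.comp (continuous_id.prodMk
      ((hσ k).continuous.prodMk (hσ k).continuous_velocity))
  have hlim0 := hL2.const_mul (C * (2 + R))
  rw [mul_zero] at hlim0
  rw [tendsto_iff_norm_sub_tendsto_zero]
  refine squeeze_zero (fun k => norm_nonneg _) (fun k => ?_) hlim0
  rw [← h0 (φ k), ← integral_fderiv_comp_curve hψ (hσ (φ k)) (hψT _),
    ← intervalIntegral.integral_sub ((hc1 _).intervalIntegrable _ _)
      ((continuous_fderiv_comp_curve hψ (hσ _)).intervalIntegrable _ _),
    ← intervalIntegral.integral_const_mul]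
  refine (intervalIntegral.norm_integral_le_integral_norm hT.le).trans
    (intervalIntegral.integral_mono_on hT.le
      (((hc1 _).sub (continuous_fderiv_comp_curve hψ (hσ _))).norm.intervalIntegrable _ _)
      ((((hσ _).continuous_velocity.sub hγ.isC1.continuous_velocity).norm.pow 2).const_mul
        _ |>.intervalIntegrable _ _) fun t ht => ?_)
  have hw := H.norm_velocity_le hT hγ ht
  set v := u (φ k) t
  have hv0 : 0 ≤ C * (2 + R) * ‖v - w t‖ ^ 2 := by positivity
  simp only [transportTest]
  by_cases hv : ‖v‖ ≤ R + 1
  · rw [hχ1 v hv, one_mul, sub_self, norm_zero]; exact hv0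
  · have e1 : χ v * fderiv ℝ ψ (t, σ (φ k) t) (1, v) - fderiv ℝ ψ (t, σ (φ k) t) (1, v)
        = -((1 - χ v) * fderiv ℝ ψ (t, σ (φ k) t) (1, v)) := by ring
    have e2 : ‖((1 : ℝ), v)‖ ≤ 1 + ‖v‖ := by
      rw [Prod.norm_def, norm_one]
      exact max_le (by linarith [norm_nonneg v]) (by linarith)
    have e3 : ‖fderiv ℝ ψ (t, σ (φ k) t) (1, v)‖ ≤ C * (1 + ‖v‖) :=
      (ContinuousLinearMap.le_of_opNorm_le _ (hC _) _).trans (mul_le_mul_of_nonneg_left e2 hC0)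
    have e4 : 1 ≤ ‖v - w t‖ := by
      have := norm_sub_norm_le v (w t)
      linarith
    have e5 : ‖v‖ ≤ R + ‖v - w t‖ := by
      have := norm_sub_norm_le v (w t)
      linarith
    have e6 : 1 + ‖v‖ ≤ (2 + R) * ‖v - w t‖ ^ 2 := by
      have e7 : ‖v - w t‖ ≤ ‖v - w t‖ ^ 2 := by nlinarith
      nlinarith
    rw [e1, norm_neg, norm_mul, Real.norm_of_nonneg (by linarith [(hχ0 v).2])]
    calc (1 - χ v) * ‖fderiv ℝ ψ (t, σ (φ k) t) (1, v)‖
        ≤ 1 * ‖fderiv ℝ ψ (t, σ (φ k) t) (1, v)‖ :=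
          mul_le_mul_of_nonneg_right (by linarith [(hχ0 v).1]) (norm_nonneg _)
      _ ≤ C * (1 + ‖v‖) := by rw [one_mul]; exact e3
      _ ≤ C * (2 + R) * ‖v - w t‖ ^ 2 := by
          rw [mul_assoc]; exact mul_le_mul_of_nonneg_left e6 hC0

end TransportTest

end Limits

end

/-! ### The Kantorovich-Rubinstein distance and Lipschitz test functions. -/

section

open scoped NNReal

section Kantorovich

variable {X : Type*} [MetricSpace X] [MeasurableSpace X]

theorem d1_nonneg (m m' : P1 X) : 0 ≤ d1 m m' :=
  Real.sInf_nonneg (by rintro _ ⟨π, -, rfl⟩; exact integral_nonneg fun _ => dist_nonneg)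

theorem couplings_nonempty (m m' : P1 X) : (couplings m.toMeasure m'.toMeasure).Nonempty := by
  have := m.isProbabilityMeasure
  have := m'.isProbabilityMeasure
  exact ⟨m.toMeasure.prod m'.toMeasure, inferInstance, by simp, by simp⟩

theorem d1_le {m m' : P1 X} {π : Measure (X × X)} (hπ : π ∈ couplings m.toMeasure m'.toMeasure) :
    d1 m m' ≤ ∫ z, dist z.1 z.2 ∂π :=
  csInf_le ⟨0, by rintro _ ⟨π, -, rfl⟩; exact integral_nonneg fun _ => dist_nonneg⟩ ⟨π, hπ, rfl⟩

variable [BorelSpace X]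

theorem P1.integrable_of_lipschitzWith (m : P1 X) {K : ℝ≥0} {f : X → ℝ} (hf : LipschitzWith K f) :
    Integrable f m.toMeasure := by
  have := m.isProbabilityMeasure
  obtain ⟨x₀, h0⟩ := m.integrable_dist
  refine ((integrable_const ‖f x₀‖).add (h0.const_mul (K : ℝ))).mono'
    hf.continuous.aestronglyMeasurable (Eventually.of_forall fun x => ?_)
  have h1 := hf.dist_le_mul x x₀
  rw [dist_eq_norm, dist_comm] at h1
  have h2 := norm_sub_norm_le (f x) (f x₀)
  simp only [Pi.add_apply]
  linarith

variable [SecondCountableTopology X]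

/-- This is the easy half of Kantorovich duality, by integration against an almost optimal coupling.
-/
theorem abs_integral_sub_le_d1 (m m' : P1 X) {K : ℝ≥0} {f : X → ℝ} (hf : LipschitzWith K f) :
    |(∫ x, f x ∂m.toMeasure) - ∫ x, f x ∂m'.toMeasure| ≤ K * d1 m m' := by
  refine le_of_forall_pos_le_add fun η hη => ?_
  obtain ⟨_, ⟨π, ⟨hπ, h1, h2⟩, rfl⟩, hlt⟩ := Real.lt_sInf_add_pos
    ((couplings_nonempty m m').image fun π : Measure (X × X) => ∫ z, dist z.1 z.2 ∂π)
    (show 0 < η / (K + 1) by positivity)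
  have hmap : ∀ {g : X → ℝ}, Continuous g → (∫ x, g x ∂m.toMeasure = ∫ z, g z.1 ∂π) ∧
      (∫ x, g x ∂m'.toMeasure = ∫ z, g z.2 ∂π) := fun hg => by
    rw [← h1, ← h2]
    exact ⟨integral_map measurable_fst.aemeasurable hg.aestronglyMeasurable,
      integral_map measurable_snd.aemeasurable hg.aestronglyMeasurable⟩
  have hint1 : ∀ {g : X → ℝ} {C : ℝ≥0}, LipschitzWith C g → Integrable (fun z => g z.1) π :=
    fun hg => by
      have := m.integrable_of_lipschitzWith hg
      rw [← h1] at this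
      exact this.comp_measurable measurable_fst
  have hint2 : ∀ {g : X → ℝ} {C : ℝ≥0}, LipschitzWith C g → Integrable (fun z => g z.2) π :=
    fun hg => by
      have := m'.integrable_of_lipschitzWith hg
      rw [← h2] at this
      exact this.comp_measurable measurable_snd
  obtain ⟨x₀, -⟩ := m.integrable_dist
  have hdist : Integrable (fun z : X × X => dist z.1 z.2) π := by
    refine ((hint1 (LipschitzWith.dist_left x₀)).add
      (hint2 (LipschitzWith.dist_left x₀))).mono' (by fun_prop)
      (Eventually.of_forall fun z => ?_)
    rw [Real.norm_of_nonneg dist_nonneg]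
    exact dist_triangle_right _ _ _
  rw [(hmap hf.continuous).1, (hmap hf.continuous).2, ← integral_sub (hint1 hf) (hint2 hf)]
  calc |∫ z, (f z.1 - f z.2) ∂π| ≤ ∫ z, |f z.1 - f z.2| ∂π := abs_integral_le_integral_abs
    _ ≤ ∫ z, K * dist z.1 z.2 ∂π := integral_mono ((hint1 hf).sub (hint2 hf)).abs
        (hdist.const_mul _) fun z => hf.dist_le_mul _ _
    _ = K * ∫ z, dist z.1 z.2 ∂π := integral_const_mul _ _
    _ ≤ K * (d1 m m' + η / (K + 1)) := mul_le_mul_of_nonneg_left hlt.le K.2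
    _ ≤ K * d1 m m' + η := by
      have : (K : ℝ) * (η / (K + 1)) ≤ η := by
        rw [mul_div_assoc', div_le_iff₀ (by positivity)]
        nlinarith [K.2]
      linarith

theorem ContinuousFlow.continuousOn_integral {T : ℝ} {m : ℝ → P1 X} (hm : ContinuousFlow T m)
    {K : ℝ≥0} {F : ℝ × X → ℝ} (hF : LipschitzWith K F) :
    ContinuousOn (fun t => ∫ x, F (t, x) ∂(m t).toMeasure) (Icc 0 T) := by
  intro t ht
  have hlip : ∀ s, LipschitzWith K fun x => F (s, x) := fun s => by
    have := hF.comp (LipschitzWith.prodMk_left s)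
    rwa [mul_one] at this
  have h1 : Tendsto (fun s => K * |s - t| + K * d1 (m s) (m t)) (𝓝[Icc 0 T] t) (𝓝 0) := by
    have e1 : Tendsto (fun s : ℝ => |s - t|) (𝓝[Icc 0 T] t) (𝓝 0) := by
      have : Continuous fun s : ℝ => |s - t| := by fun_prop
      have h := this.tendsto t
      rw [sub_self, abs_zero] at h
      exact h.mono_left nhdsWithin_le_nhds
    simpa using (e1.const_mul (K : ℝ)).add ((hm t ht).const_mul (K : ℝ))
  rw [ContinuousWithinAt, tendsto_iff_norm_sub_tendsto_zero]
  refine squeeze_zero (fun _ => norm_nonneg _) (fun s => ?_) h1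
  have := (m s).isProbabilityMeasure
  have e2 := abs_integral_sub_le_d1 (m s) (m t) (hlip t)
  have e3 : |(∫ x, F (s, x) ∂(m s).toMeasure) - ∫ x, F (t, x) ∂(m s).toMeasure| ≤ K * |s - t| := by
    rw [← integral_sub ((m s).integrable_of_lipschitzWith (hlip s))
      ((m s).integrable_of_lipschitzWith (hlip t))]
    have := norm_integral_le_of_norm_le_const (μ := (m s).toMeasure) (C := K * |s - t|)
      (f := fun x => F (s, x) - F (t, x)) (Eventually.of_forall fun x => by
        have := hF.dist_le_mul (s, x) (t, x)
        rwa [Prod.dist_eq, dist_self, max_eq_left dist_nonneg, dist_eq_norm, Real.dist_eq] at this)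
    simpa using this
  rw [Real.norm_eq_abs]
  exact (abs_sub_le _ _ _).trans (add_le_add e3 e2)

end Kantorovich

section Marginal

variable {d : ℕ}

theorem integral_spaceMarginal (m : P1 (Space d × Space d)) {E : Type*} [NormedAddCommGroup E]
    [NormedSpace ℝ E] {f : Space d → E}
    (hf : AEStronglyMeasurable f m.spaceMarginal.toMeasure) :
    ∫ x, f x ∂m.spaceMarginal.toMeasure = ∫ z, f z.1 ∂m.toMeasure :=
  integral_map measurable_fst.aemeasurable hf

/-- Couplings project to couplings of the marginals, and the projection is 1-Lipschitz for the
maximum distance. -/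
theorem d1_spaceMarginal_le (m m' : P1 (Space d × Space d)) :
    d1 m.spaceMarginal m'.spaceMarginal ≤ d1 m m' := by
  refine le_csInf ((couplings_nonempty m m').image _) ?_
  rintro _ ⟨π, ⟨hπ, h1, h2⟩, rfl⟩
  have hmeas : Measurable fun z : (Space d × Space d) × (Space d × Space d) => (z.1.1, z.2.1) := by
    fun_prop
  have hmem : π.map (fun z => (z.1.1, z.2.1))
      ∈ couplings m.spaceMarginal.toMeasure m'.spaceMarginal.toMeasure := by
    refine ⟨Measure.isProbabilityMeasure_map hmeas.aemeasurable, ?_, ?_⟩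
    · rw [Measure.map_map measurable_fst hmeas]
      simp only [P1.spaceMarginal]
      rw [← h1, Measure.map_map measurable_fst measurable_fst]
      rfl
    · rw [Measure.map_map measurable_snd hmeas]
      simp only [P1.spaceMarginal]
      rw [← h2, Measure.map_map measurable_fst measurable_snd]
      rfl
  refine (d1_le hmem).trans ?_
  rw [integral_map hmeas.aemeasurable (by fun_prop)]
  have hi : Integrable
      (fun z : (Space d × Space d) × (Space d × Space d) => dist z.1 z.2) π := by
    obtain ⟨z₁, h3⟩ := m.integrable_dist
    obtain ⟨z₂, h4⟩ := m'.integrable_dist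
    rw [← h1] at h3
    rw [← h2] at h4
    refine (((h3.comp_measurable measurable_fst).add (h4.comp_measurable measurable_snd)).add
      (integrable_const (dist z₁ z₂))).mono' (by fun_prop) (Eventually.of_forall fun z => ?_)
    rw [Real.norm_of_nonneg dist_nonneg]
    simp only [Pi.add_apply, Function.comp_apply]
    have e1 := dist_triangle4 z.1 z₁ z₂ z.2
    rw [dist_comm z.1 z₁] at e1
    linarith
  refine integral_mono (hi.mono (by fun_prop) (Eventually.of_forall fun z => ?_)) hi
    fun z => le_max_left _ _
  rw [Real.norm_of_nonneg dist_nonneg, Real.norm_of_nonneg dist_nonneg]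
  exact le_max_left _ _

theorem ContinuousFlow.spaceMarginal {T : ℝ} {m : ℝ → P1 (Space d × Space d)}
    (hm : ContinuousFlow T m) : ContinuousFlow T fun t => (m t).spaceMarginal := fun t ht =>
  squeeze_zero (fun _ => d1_nonneg _ _) (fun _ => d1_spaceMarginal_le _ _) (hm t ht)

end Marginal

end

/-! ### Passage to the limit along flows carried by random curves. -/

section

open scoped NNReal

section Curves

variable {Ω Y : Type*} [MeasurableSpace Ω] {ν : Measure Ω} [IsProbabilityMeasure ν]
  [MetricSpace Y] [MeasurableSpace Y] [BorelSpace Y] {T : ℝ} {X : Ω → ℝ → Y}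

/-- Random continuous curves are jointly measurable. -/
theorem aemeasurable_uncurry_of_continuousOn
    (hc : ∀ᵐ a ∂ν, ContinuousOn (X a) (Icc 0 T))
    (hm : ∀ t ∈ Icc 0 T, AEMeasurable (fun a => X a t) ν) :
    AEMeasurable (fun p : Ω × ℝ => X p.1 p.2) (ν.prod (volume.restrict (Icc 0 T))) := by
  have hex : ∀ n i : ℕ, ∃ f : Ω → Y, Measurable f ∧ ((i : ℝ) / ((n : ℝ) + 1) ∈ Icc 0 T →
      ∀ᵐ a ∂ν, X a ((i : ℝ) / ((n : ℝ) + 1)) = f a) := fun n i => by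
    obtain ⟨a₀⟩ := nonempty_of_isProbabilityMeasure ν
    by_cases h : (i : ℝ) / ((n : ℝ) + 1) ∈ Icc 0 T
    · exact ⟨_, (hm _ h).measurable_mk, fun _ => (hm _ h).ae_eq_mk⟩
    · exact ⟨fun _ => X a₀ 0, measurable_const, fun h' => absurd h' h⟩
  choose f hf hfX using hex
  have hgood : ∀ᵐ a ∂ν, ContinuousOn (X a) (Icc 0 T) ∧ ∀ n i : ℕ,
      (i : ℝ) / ((n : ℝ) + 1) ∈ Icc 0 T → X a ((i : ℝ) / ((n : ℝ) + 1)) = f n i a := by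
    refine hc.and (ae_all_iff.2 fun n => ae_all_iff.2 fun i => ?_)
    by_cases h : (i : ℝ) / ((n : ℝ) + 1) ∈ Icc 0 T
    · filter_upwards [hfX n i h] with a ha _ using ha
    · exact Eventually.of_forall fun a h' => absurd h' h
  -- Each curve is approximated by its values at the grid points ⌊t(n + 1)⌋/(n + 1), which do not
  -- exceed `t` and so stay in [0, T]. Only countably many exceptional null sets occur.
  refine aemeasurable_of_tendsto_metrizable_ae atTop
    (f := fun (n : ℕ) (p : Ω × ℝ) => f n ⌊p.2 * ((n : ℝ) + 1)⌋₊ p.1) (fun n => ?_) ?_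
  · have h1 : Measurable fun q : Ω × ℕ => f n q.2 q.1 :=
      measurable_from_prod_countable_left fun i => hf n i
    exact (h1.comp (measurable_fst.prodMk
      (Nat.measurable_floor.comp (measurable_snd.mul_const _)))).aemeasurable
  · filter_upwards [Measure.quasiMeasurePreserving_fst.ae hgood,
      Measure.quasiMeasurePreserving_snd.ae (ae_restrict_mem measurableSet_Icc)] with p hp ht
    have hmem : ∀ n : ℕ, (⌊p.2 * ((n : ℝ) + 1)⌋₊ : ℝ) / ((n : ℝ) + 1) ∈ Icc 0 T := fun n => by
      refine ⟨by positivity, le_trans ?_ ht.2⟩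
      rw [div_le_iff₀ (by positivity)]
      exact Nat.floor_le (mul_nonneg ht.1 (by positivity))
    have h2 : Tendsto (fun n : ℕ => (⌊p.2 * ((n : ℝ) + 1)⌋₊ : ℝ) / ((n : ℝ) + 1)) atTop
        (𝓝[Icc 0 T] p.2) :=
      tendsto_nhdsWithin_iff.2 ⟨(tendsto_nat_floor_mul_div_atTop ht.1).comp
        (tendsto_atTop_add_const_right _ _ tendsto_natCast_atTop_atTop), Eventually.of_forall hmem⟩
    exact ((hp.1 p.2 ht).tendsto.comp h2).congr fun n => hp.2 n _ (hmem n)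

variable [SecondCountableTopology Y]

theorem integrable_comp_curve (hc : ∀ᵐ a ∂ν, ContinuousOn (X a) (Icc 0 T))
    (hm : ∀ t ∈ Icc 0 T, AEMeasurable (fun a => X a t) ν) {F : ℝ × Y → ℝ} (hF : Continuous F)
    {C : ℝ} (hC : ∀ q, ‖F q‖ ≤ C) :
    Integrable (fun p : Ω × ℝ => F (p.2, X p.1 p.2)) (ν.prod (volume.restrict (Ioc 0 T))) := by
  have h1 := aemeasurable_uncurry_of_continuousOn hc hm
  rw [restrict_Ioc_eq_restrict_Icc]
  exact Integrable.of_bound (hF.measurable.comp_aemeasurable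
    (measurable_snd.aemeasurable.prodMk h1)).aestronglyMeasurable C
    (Eventually.of_forall fun _ => hC _)

theorem integral_intervalIntegral_comp_curve (hT : 0 ≤ T)
    (hc : ∀ᵐ a ∂ν, ContinuousOn (X a) (Icc 0 T))
    (hm : ∀ t ∈ Icc 0 T, AEMeasurable (fun a => X a t) ν) {F : ℝ × Y → ℝ} (hF : Continuous F)
    {C : ℝ} (hC : ∀ q, ‖F q‖ ≤ C) :
    ∫ a, (∫ t in 0..T, F (t, X a t)) ∂ν = ∫ t in 0..T, ∫ a, F (t, X a t) ∂ν := by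
  simp only [intervalIntegral.integral_of_le hT]
  exact integral_integral_swap (integrable_comp_curve hc hm hF hC)

end Curves

/-- Passage to the limit along flows of measures which are carried by random curves. -/
theorem integral_eq_integral_of_curves {Ω Y : Type*} [MeasurableSpace Ω] {ν : Measure Ω}
    [IsProbabilityMeasure ν] [MetricSpace Y] [MeasurableSpace Y] [BorelSpace Y]
    [SecondCountableTopology Y] {T : ℝ} (hT : 0 ≤ T) {X : ℕ → Ω → ℝ → Y}
    (hc : ∀ k, ∀ᵐ a ∂ν, ContinuousOn (X k a) (Icc 0 T))
    (hm : ∀ k, ∀ t ∈ Icc 0 T, AEMeasurable (fun a => X k a t) ν) {μ : ℕ → ℝ → P1 Y}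
    (hμ : ∀ k, ∀ t ∈ Icc 0 T, (μ k t).toMeasure = ν.map fun a => X k a t)
    (hμc : ∀ k, ContinuousFlow T (μ k)) {μlim : ℝ → P1 Y}
    (hlim : ∀ t ∈ Ioc 0 T, Tendsto (fun k => d1 (μ k t) (μlim t)) atTop (𝓝 0))
    {F : ℝ × Y → ℝ} {K : ℝ≥0} (hF : LipschitzWith K F) {C : ℝ} (hC : ∀ q, ‖F q‖ ≤ C) {c : Ω → ℝ}
    (hcl : ∀ᵐ a ∂ν, Tendsto (fun k => ∫ t in 0..T, F (t, X k a t)) atTop (𝓝 (c a))) :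
    ∫ a, c a ∂ν = ∫ t in 0..T, ∫ z, F (t, z) ∂(μlim t).toMeasure := by
  have hFt : ∀ t, LipschitzWith K fun z => F (t, z) := fun t => by
    have := hF.comp (LipschitzWith.prodMk_left t)
    rwa [mul_one] at this
  have h1 : Tendsto (fun k => ∫ a, (∫ t in 0..T, F (t, X k a t)) ∂ν) atTop (𝓝 (∫ a, c a ∂ν)) := by
    refine tendsto_integral_of_dominated_convergence (fun _ => C * T) (fun k => ?_)
      (integrable_const _) (fun k => Eventually.of_forall fun a => ?_) hcl
    · simp only [intervalIntegral.integral_of_le hT]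
      exact (integrable_comp_curve (hc k) (hm k) hF.continuous hC).integral_prod_left.1
    · have := intervalIntegral.norm_integral_le_of_norm_le_const (a := 0) (b := T)
        (f := fun t => F (t, X k a t)) fun t _ => hC _
      rwa [sub_zero, abs_of_nonneg hT] at this
  -- The same averages are now computed from the measures: convergence at each positive time
  -- suffices, because `F` is bounded. Fubini identifies both sequences.
  have h2 : Tendsto (fun k => ∫ t in 0..T, ∫ z, F (t, z) ∂(μ k t).toMeasure) atTop
      (𝓝 (∫ t in 0..T, ∫ z, F (t, z) ∂(μlim t).toMeasure)) := by
    refine intervalIntegral.tendsto_integral_filter_of_dominated_convergence (fun _ => C)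
      (Eventually.of_forall fun k => ?_)
      (Eventually.of_forall fun k => Eventually.of_forall fun t _ => ?_)
      intervalIntegrable_const (Eventually.of_forall fun t ht => ?_)
    · rw [uIoc_of_le hT]
      exact (((hμc k).continuousOn_integral hF).mono Ioc_subset_Icc_self).aestronglyMeasurable
        measurableSet_Ioc
    · have := (μ k t).isProbabilityMeasure
      simpa using norm_integral_le_of_norm_le_const (μ := (μ k t).toMeasure)
        (Eventually.of_forall fun z => hC (t, z))
    · rw [uIoc_of_le hT] at ht
      rw [tendsto_iff_norm_sub_tendsto_zero]
      have := (hlim t ht).const_mul (K : ℝ)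
      rw [mul_zero] at this
      exact squeeze_zero (fun _ => norm_nonneg _)
        (fun k => abs_integral_sub_le_d1 (μ k t) (μlim t) (hFt t)) this
  refine tendsto_nhds_unique h1 (h2.congr fun k => ?_)
  rw [integral_intervalIntegral_comp_curve hT (hc k) (hm k) hF.continuous hC]
  refine intervalIntegral.integral_congr fun t ht => ?_
  rw [uIcc_of_le hT] at ht
  simp only [hμ k t ht]
  exact integral_map (hm k t ht) (hFt t).continuous.aestronglyMeasurable

end

/-! ### Concentration on minimizers and the initial marginal. -/

section

open scoped NNReal

variable {d : ℕ}

/-- Flows of measures carried by curves which are almost minimizers of the limit problem. -/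
structure IsMinimizingFlow (T M : ℝ) (ℓ : ℝ → Space d → ℝ) (h : Space d → ℝ) (V : ℝ → Space d → ℝ)
    (ν : Measure (Space d × Space d)) (X : ℕ → Space d × Space d → ℝ → Space d × Space d)
    (μ : ℕ → ℝ → P1 (Space d × Space d)) (μlim : ℝ → P1 (Space d × Space d)) : Prop where
  pos : 0 < T
  cost : CostData M ℓ h
  value : IsValue T ℓ h V
  isProbabilityMeasure : IsProbabilityMeasure ν
  aemeasurable : ∀ k, ∀ t ∈ Icc 0 T, AEMeasurable (fun z => X k z t) ν
  eq_map : ∀ k, ∀ t ∈ Icc 0 T, (μ k t).toMeasure = ν.map fun z => X k z t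
  continuousFlow : ∀ k, ContinuousFlow T (μ k)
  continuousFlow_lim : ContinuousFlow T μlim
  tendsto : ∀ t ∈ Ioc 0 T, Tendsto (fun k => d1 (μ k t) (μlim t)) atTop (𝓝 0)
  curves : ∃ Q, ∀ᵐ z ∂ν, ∃ σ u : ℕ → ℝ → Space d, (∀ k, IsC1 (σ k) (u k)) ∧
    (∀ k, ∀ s ∈ Icc 0 T, X k z s = (σ k s, u k s)) ∧ (∀ k, σ k 0 = z.1) ∧
    (∀ k, ∫ s in 0..T, ‖u k s‖ ^ 2 ≤ Q) ∧
    Tendsto (fun k => lagCost T ℓ h 0 (σ k) (u k)) atTop (𝓝 (V 0 z.1))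

/-- A function of time and phase which is continuous and nonnegative, and which has zero integral
along a flow of measures, vanishes almost everywhere at each time. -/
theorem ContinuousFlow.ae_eq_zero {Y : Type*} [MetricSpace Y] [MeasurableSpace Y] [BorelSpace Y]
    [SecondCountableTopology Y] {T : ℝ} (hT : 0 < T) {m : ℝ → P1 Y} (hm : ContinuousFlow T m)
    {K : ℝ≥0} {F : ℝ × Y → ℝ} (hF : LipschitzWith K F) (h0 : ∀ q, 0 ≤ F q)
    (hint : ∫ t in 0..T, ∫ z, F (t, z) ∂(m t).toMeasure = 0) {t : ℝ} (ht : t ∈ Icc 0 T) :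
    ∀ᵐ z ∂(m t).toMeasure, F (t, z) = 0 := by
  have hFt : LipschitzWith K fun z => F (t, z) := by
    have := hF.comp (LipschitzWith.prodMk_left t)
    rwa [mul_one] at this
  have h1 : ∫ z, F (t, z) ∂(m t).toMeasure = 0 := by
    by_contra hne
    have h2 : 0 < ∫ z, F (t, z) ∂(m t).toMeasure :=
      lt_of_le_of_ne (integral_nonneg fun z => h0 _) (Ne.symm hne)
    exact (intervalIntegral.integral_pos hT (hm.continuousOn_integral hF)
      (fun s _ => integral_nonneg fun z => h0 _) ⟨t, ht, h2⟩).ne' hint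
  exact (integral_eq_zero_iff_of_nonneg (fun z => h0 _)
    ((m t).integrable_of_lipschitzWith hFt)).1 h1

namespace IsMinimizingFlow

variable {T M : ℝ} {ℓ : ℝ → Space d → ℝ} {h : Space d → ℝ} {V : ℝ → Space d → ℝ}
    {ν : Measure (Space d × Space d)} {X : ℕ → Space d × Space d → ℝ → Space d × Space d}
    {μ : ℕ → ℝ → P1 (Space d × Space d)} {μlim : ℝ → P1 (Space d × Space d)}

theorem ae_continuousOn (D : IsMinimizingFlow T M ℓ h V ν X μ μlim) (k : ℕ) :
    ∀ᵐ z ∂ν, ContinuousOn (X k z) (Icc 0 T) := by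
  obtain ⟨Q, hQ⟩ := D.curves
  filter_upwards [hQ] with z ⟨σ, u, hσ, hX, _⟩
  exact ((hσ k).continuous.prodMk (hσ k).continuous_velocity).continuousOn.congr (hX k)

theorem integral_eq (D : IsMinimizingFlow T M ℓ h V ν X μ μlim)
    {F : ℝ × (Space d × Space d) → ℝ} {K : ℝ≥0} (hF : LipschitzWith K F) {C : ℝ}
    (hC : ∀ q, ‖F q‖ ≤ C) {c : Space d → ℝ}
    (hc : ∀ (x : Space d) (σ u : ℕ → ℝ → Space d), (∀ k, IsC1 (σ k) (u k)) → (∀ k, σ k 0 = x) →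
      Tendsto (fun k => lagCost T ℓ h 0 (σ k) (u k)) atTop (𝓝 (V 0 x)) →
      Tendsto (fun k => ∫ t in 0..T, F (t, σ k t, u k t)) atTop (𝓝 (c x))) :
    ∫ z, c z.1 ∂ν = ∫ t in 0..T, ∫ z, F (t, z) ∂(μlim t).toMeasure := by
  have := D.isProbabilityMeasure
  obtain ⟨Q, hQ⟩ := D.curves
  refine integral_eq_integral_of_curves D.pos.le D.ae_continuousOn D.aemeasurable D.eq_map
    D.continuousFlow D.tendsto hF hC ?_
  filter_upwards [hQ] with z ⟨σ, u, hσ, hX, h0, _, hlim⟩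
  refine (hc z.1 σ u hσ h0 hlim).congr fun k => ?_
  refine intervalIntegral.integral_congr fun t ht => ?_
  rw [uIcc_of_le D.pos.le] at ht
  simp only [hX k t ht]

/-- The truncated distance to the graph is bounded and Lipschitz, so its vanishing along curves
passes to the limit flow. Continuity in time gives every `t`, including 0. -/
theorem ae_mem_minimizerGraph (D : IsMinimizingFlow T M ℓ h V ν X μ μlim) {t : ℝ}
    (ht : t ∈ Icc 0 T) : ∀ᵐ z ∂(μlim t).toMeasure, (t, z) ∈ minimizerGraph T ℓ h := by
  have h1 := D.integral_eq (lipschitzWith_graphDist (T := T) (ℓ := ℓ) (h := h)) (C := 1)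
    (fun q => by rw [Real.norm_of_nonneg (graphDist_nonneg q)]; exact graphDist_le_one q)
    (c := fun _ => 0)
    fun x σ u hσ h0 hlim => D.value.tendsto_integral_graphDist D.cost D.pos hσ h0 hlim
  rw [integral_zero] at h1
  filter_upwards [D.continuousFlow_lim.ae_eq_zero D.pos lipschitzWith_graphDist graphDist_nonneg
    h1.symm ht] with z hz
  exact mem_minimizerGraph_of_graphDist D.value D.cost D.pos hz

/-- Nothing is assumed to converge at time 0, where velocities may jump. Positions are Hölder in
time uniformly in `k`, so one lets k → ∞ at t > 0 and then t → 0 by continuity of the limit flow. -/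
theorem spaceMarginal_zero (D : IsMinimizingFlow T M ℓ h V ν X μ μlim) :
    (μlim 0).spaceMarginal.toMeasure = ν.map Prod.fst := by
  have := D.isProbabilityMeasure
  have hT := D.pos
  obtain ⟨Q, hQ⟩ := D.curves
  have key : ∀ f : Space d → ℝ, (∃ C, ∀ x y, dist (f x) (f y) ≤ C) → (∃ L, LipschitzWith L f) →
      ∫ x, f x ∂(μlim 0).spaceMarginal.toMeasure = ∫ x, f x ∂(ν.map Prod.fst) := by
    rintro f ⟨C, hC⟩ ⟨K, hf⟩
    have hfs : ∀ (m : Measure (Space d)), AEStronglyMeasurable f m := fun m =>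
      hf.continuous.aestronglyMeasurable
    have hF : LipschitzWith K fun q : ℝ × (Space d × Space d) => f q.2.1 := by
      have := hf.comp (LipschitzWith.prod_fst.comp LipschitzWith.prod_snd
        (α := ℝ × (Space d × Space d)))
      rwa [mul_one, mul_one] at this
    have hFt : LipschitzWith K fun z : Space d × Space d => f z.1 := by
      have := hf.comp (LipschitzWith.prod_fst (α := Space d) (β := Space d))
      rwa [mul_one] at this
    rw [integral_spaceMarginal _ (hfs _), integral_map measurable_fst.aemeasurable (hfs _)]
    have hbd : ∀ x, ‖f x‖ ≤ ‖f 0‖ + C := fun x => by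
      have h1 := hC x 0
      rw [dist_eq_norm] at h1
      linarith [norm_sub_norm_le (f x) (f 0)]
    have hk : ∀ k, ∀ t ∈ Ioc 0 T,
        |(∫ z, f z.1 ∂(μ k t).toMeasure) - ∫ z, f z.1 ∂ν| ≤ K * √(t * Q) := fun k t ht => by
      have hm := D.aemeasurable k t (Ioc_subset_Icc_self ht)
      have hfm : AEStronglyMeasurable (fun z => f (X k z t).1) ν :=
        (hf.continuous.measurable.comp_aemeasurable hm.fst).aestronglyMeasurable
      rw [D.eq_map k t (Ioc_subset_Icc_self ht),
        integral_map hm hFt.continuous.aestronglyMeasurable, ← integral_sub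
          (Integrable.of_bound hfm _ (Eventually.of_forall fun z => hbd _))
          (Integrable.of_bound hFt.continuous.aestronglyMeasurable _
            (Eventually.of_forall fun z => hbd _))]
      have h1 := norm_integral_le_of_norm_le_const (μ := ν) (C := K * √(t * Q))
        (f := fun z => f (X k z t).1 - f z.1) ?_
      · simpa using h1
      · filter_upwards [hQ] with z ⟨σ, u, hσ, hX, h0, hen, _⟩
        have h2 := (hσ k).norm_sub_le_sqrt (hen k) (Ioc_subset_Icc_self ht) ⟨le_rfl, hT.le⟩
        rw [sub_zero, abs_of_pos ht.1] at h2
        rw [hX k t (Ioc_subset_Icc_self ht), ← h0 k, ← dist_eq_norm]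
        refine (hf.dist_le_mul _ _).trans (mul_le_mul_of_nonneg_left ?_ K.2)
        rw [dist_eq_norm]; exact h2
    have hlim : ∀ t ∈ Ioc 0 T,
        |(∫ z, f z.1 ∂(μlim t).toMeasure) - ∫ z, f z.1 ∂ν| ≤ K * √(t * Q) := fun t ht => by
      have h1 : Tendsto (fun k => ∫ z, f z.1 ∂(μ k t).toMeasure) atTop
          (𝓝 (∫ z, f z.1 ∂(μlim t).toMeasure)) := by
        rw [tendsto_iff_norm_sub_tendsto_zero]
        have := (D.tendsto t ht).const_mul (K : ℝ)
        rw [mul_zero] at this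
        exact squeeze_zero (fun _ => norm_nonneg _)
          (fun k => abs_integral_sub_le_d1 (μ k t) (μlim t) hFt) this
      exact le_of_tendsto (h1.sub_const _).abs (Eventually.of_forall fun k => hk k t ht)
    have hc := (D.continuousFlow_lim.continuousOn_integral hF) 0 ⟨le_rfl, hT.le⟩
    have hc' : Tendsto (fun t => |(∫ z, f z.1 ∂(μlim t).toMeasure) - ∫ z, f z.1 ∂ν|) (𝓝[>] 0)
        (𝓝 |(∫ z, f z.1 ∂(μlim 0).toMeasure) - ∫ z, f z.1 ∂ν|) := by
      refine ((hc.tendsto.mono_left ?_).sub_const _).abs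
      rw [← nhdsWithin_Ioc_eq_nhdsGT hT]
      exact nhdsWithin_mono _ Ioc_subset_Icc_self
    have hs : Tendsto (fun t => K * √(t * Q)) (𝓝[>] 0) (𝓝 0) := by
      have : Continuous fun t : ℝ => K * √(t * Q) := by fun_prop
      have h1 := this.tendsto 0
      rw [zero_mul, Real.sqrt_zero, mul_zero] at h1
      exact h1.mono_left nhdsWithin_le_nhds
    have h2 := le_of_tendsto_of_tendsto hc' hs (by
      filter_upwards [Ioc_mem_nhdsGT hT] with t ht using hlim t ht)
    exact sub_eq_zero.1 (abs_eq_zero.1 (le_antisymm h2 (abs_nonneg _)))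
  set P : ProbabilityMeasure (Space d) :=
    ⟨(μlim 0).spaceMarginal.toMeasure, (μlim 0).spaceMarginal.isProbabilityMeasure⟩
  set P' : ProbabilityMeasure (Space d) :=
    ⟨ν.map Prod.fst, Measure.isProbabilityMeasure_map measurable_fst.aemeasurable⟩
  -- Bounded Lipschitz functions determine the weak topology on probability measures, which is
  -- Hausdorff; a constant sequence with two limits yields equality.
  have hPP : P = P' := by
    refine tendsto_nhds_unique (f := fun _ : ℕ => P) (l := atTop) tendsto_const_nhds
      (tendsto_iff_forall_lipschitz_integral_tendsto.2 fun f hf hf' => ?_)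
    have e : ∫ x, f x ∂(P : Measure (Space d)) = ∫ x, f x ∂(P' : Measure (Space d)) := key f hf hf'
    rw [← e]
    exact tendsto_const_nhds
  exact congrArg Subtype.val hPP

end IsMinimizingFlow

end

/-! ### The velocity as a gradient, and the continuity equation. -/

section

open scoped NNReal

variable {d : ℕ}

namespace IsMinimizingFlow

variable {T M : ℝ} {ℓ : ℝ → Space d → ℝ} {h : Space d → ℝ} {V : ℝ → Space d → ℝ}
    {ν : Measure (Space d × Space d)} {X : ℕ → Space d × Space d → ℝ → Space d × Space d}
    {μ : ℕ → ℝ → P1 (Space d × Space d)} {μlim : ℝ → P1 (Space d × Space d)}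

theorem ae_norm_le (D : IsMinimizingFlow T M ℓ h V ν X μ μlim) {t : ℝ} (ht : t ∈ Icc 0 T) :
    ∀ᵐ z ∂(μlim t).toMeasure, ‖z.2‖ ≤ M * (T + 1) := by
  filter_upwards [D.ae_mem_minimizerGraph ht] with z ⟨_, γ, w, hmin, _, hw⟩
  rw [← show w t = z.2 from hw]
  exact D.cost.norm_velocity_le D.pos hmin ht

/-- For t > 0 differentiability holds at every point reached by a minimizer. At t = 0 it follows
from Rademacher's theorem, and this is where absolute continuity of the initial measure enters. -/
theorem ae_differentiableAt (D : IsMinimizingFlow T M ℓ h V ν X μ μlim) (hν : ν ≪ volume) {t : ℝ}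
    (ht : t ∈ Icc 0 T) : ∀ᵐ z ∂(μlim t).toMeasure, DifferentiableAt ℝ (V t) z.1 := by
  rcases ht.1.eq_or_lt with rfl | ht0
  · have h1 : (μlim 0).spaceMarginal.toMeasure ≪ volume := by
      rw [D.spaceMarginal_zero]
      exact (hν.map measurable_fst).trans
        (Measure.quasiMeasurePreserving_fst (μ := volume) (ν := volume)).absolutelyContinuous
    exact ae_of_ae_map measurable_fst.aemeasurable
      (h1.ae_le (D.value.lipschitzWith D.cost ht).ae_differentiableAt)
  · filter_upwards [D.ae_mem_minimizerGraph ht] with z ⟨_, γ, w, hmin, hγ, _⟩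
    rw [← show γ t = z.1 from hγ]
    exact (D.value.hasGradientAt D.cost hmin ⟨ht0, ht.2⟩).differentiableAt

theorem ae_eq_gradient (D : IsMinimizingFlow T M ℓ h V ν X μ μlim) (hν : ν ≪ volume) {t : ℝ}
    (ht : t ∈ Icc 0 T) : ∀ᵐ z ∂(μlim t).toMeasure, z.2 = -gradient (V t) z.1 := by
  filter_upwards [D.ae_mem_minimizerGraph ht, D.ae_differentiableAt hν ht]
    with z ⟨_, γ, w, hmin, hγ, hw⟩ hd
  have hγ : γ t = z.1 := hγ
  have hw : w t = z.2 := hw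
  rw [← hγ] at hd ⊢
  rcases ht.1.eq_or_lt with rfl | ht0
  · rw [D.value.gradient_eq D.cost D.pos hmin hd, neg_neg, hw]
  · rw [(D.value.hasGradientAt D.cost hmin ⟨ht0, ht.2⟩).gradient, neg_neg, hw]

theorem measurable_gradient (f : Space d → ℝ) : Measurable (gradient f) :=
  (LinearIsometryEquiv.continuous _).measurable.comp (measurable_fderiv ℝ f)

theorem toMeasure_eq_map (D : IsMinimizingFlow T M ℓ h V ν X μ μlim) (hν : ν ≪ volume) {t : ℝ}
    (ht : t ∈ Icc 0 T) : (μlim t).toMeasure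
      = (μlim t).spaceMarginal.toMeasure.map (fun x => (x, -gradient (V t) x)) := by
  have hm : Measurable fun x => (x, -gradient (V t) x) :=
    measurable_id.prodMk (measurable_gradient _).neg
  simp only [P1.spaceMarginal]
  rw [Measure.map_map hm measurable_fst]
  conv_lhs => rw [← Measure.map_id (μ := (μlim t).toMeasure)]
  refine Measure.map_congr ?_
  filter_upwards [D.ae_eq_gradient hν ht] with z hz
  exact Prod.ext rfl hz

theorem _root_.deriv_add_inner_gradient {ψ : ℝ × Space d → ℝ} (hψ : Differentiable ℝ ψ) (t : ℝ)
    (x v : Space d) : deriv (fun τ => ψ (τ, x)) t + inner ℝ (gradient (fun y => ψ (t, y)) x) v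
      = fderiv ℝ ψ (t, x) (1, v) := by
  have h1 : HasDerivAt (fun τ => ψ (τ, x)) (fderiv ℝ ψ (t, x) (1, 0)) t :=
    (hψ (t, x)).hasFDerivAt.comp_hasDerivAt t ((hasDerivAt_id t).prodMk (hasDerivAt_const t x))
  have h2 : HasFDerivAt (fun y => ψ (t, y))
      ((fderiv ℝ ψ (t, x)).comp (ContinuousLinearMap.inr ℝ ℝ (Space d))) x :=
    (hψ (t, x)).hasFDerivAt.comp x (hasFDerivAt_prodMk_right t x)
  rw [h1.deriv, gradient, InnerProductSpace.toDual_symm_apply, h2.fderiv,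
    ContinuousLinearMap.comp_apply, ContinuousLinearMap.inr_apply, ← map_add]
  simp

/-- The limit flow solves the continuity equation of the optimal feedback. -/
theorem solvesContinuityEquation (D : IsMinimizingFlow T M ℓ h V ν X μ μlim) (hν : ν ≪ volume) :
    SolvesContinuityEquation T (fun t x => -gradient (V t) x) (fun t => (μlim t).spaceMarginal)
      (ν.map Prod.fst) := by
  have hT := D.pos
  have hM := D.cost.nonneg
  have hb : ∀ t, Measurable fun x => -gradient (V t) x := fun t => (measurable_gradient _).neg
  have hI : uIoc 0 T ⊆ Icc 0 T := by rw [uIoc_of_le hT.le]; exact Ioc_subset_Icc_self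
  refine ⟨fun t ht => ?_, ?_, fun ψ hψ hψc hψs => ?_⟩
  · have := (μlim t).spaceMarginal.isProbabilityMeasure
    refine Integrable.of_bound (hb t).aestronglyMeasurable (M * (T + 1))
      (Eventually.of_forall fun x => ?_)
    rw [norm_neg, gradient, LinearIsometryEquiv.norm_map]
    have h1 := norm_fderiv_le_of_lipschitz ℝ (D.value.lipschitzWith D.cost ht) (x₀ := x)
    rwa [Real.coe_toNNReal _ (by positivity)] at h1
  · have hF : LipschitzWith 1 fun q : ℝ × (Space d × Space d) => ‖q.2.2‖ := by
      have := lipschitzWith_one_norm.comp (LipschitzWith.prod_snd.comp LipschitzWith.prod_snd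
        (α := ℝ × (Space d × Space d)))
      rwa [mul_one, mul_one] at this
    have hc := D.continuousFlow_lim.continuousOn_integral hF
    rw [← uIcc_of_le hT.le] at hc
    refine hc.intervalIntegrable.congr fun t ht => ?_
    simp only
    rw [integral_spaceMarginal _ (hb t).norm.aestronglyMeasurable]
    refine integral_congr_ae ?_
    filter_upwards [D.ae_eq_gradient hν (hI ht)] with z hz
    rw [← hz]
  · have hψd : Differentiable ℝ ψ := hψ.differentiable (by simp)
    have hψT : ∀ y, ψ (T, y) = 0 := fun y => by
      by_contra hne
      exact lt_irrefl T (hψs (subset_tsupport _ hne)).1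
    -- The cutoff is 1 at all speeds carried by the limit flow, so it disappears from the limit
    -- equation.
    let χ : ContDiffBump (0 : Space d) :=
      ⟨M * (T + 1) + 1, M * (T + 1) + 2, by positivity, by linarith⟩
    have hχ1 : ∀ v, ‖v‖ ≤ M * (T + 1) + 1 → χ v = 1 := fun v hv =>
      χ.one_of_mem_closedBall (by rwa [mem_closedBall_zero_iff])
    have hcd := contDiff_transportTest hψ χ.contDiff
    have hcs := hasCompactSupport_transportTest hψc χ.hasCompactSupport
    obtain ⟨K, hK⟩ := hcd.lipschitzWith_of_hasCompactSupport hcs one_ne_zero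
    obtain ⟨C, hC⟩ := hcs.exists_bound_of_continuous hcd.continuous
    have h1 := D.integral_eq hK hC (c := fun x => -ψ (0, x)) fun x σ u hσ h0 hlim =>
      D.value.tendsto_integral_transportTest D.cost hT hσ h0 hlim hψ hψc hψT χ.contDiff hχ1
        fun v => ⟨χ.nonneg, χ.le_one⟩
    have hc := D.continuousFlow_lim.continuousOn_integral hK
    rw [← uIcc_of_le hT.le] at hc
    have heq : ∀ t ∈ Icc 0 T, ∫ z, transportTest ψ χ (t, z) ∂(μlim t).toMeasure
        = ∫ x, (deriv (fun τ => ψ (τ, x)) t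
          + inner ℝ (gradient (fun y => ψ (t, y)) x) (-gradient (V t) x))
            ∂(μlim t).spaceMarginal.toMeasure := fun t ht => by
      simp only [deriv_add_inner_gradient hψd]
      rw [integral_spaceMarginal]
      · refine integral_congr_ae ?_
        filter_upwards [D.ae_eq_gradient hν ht, D.ae_norm_le ht] with z hz hz'
        rw [transportTest, hχ1 z.2 (by linarith), one_mul, ← hz]
      · have e1 : Continuous fun p : Space d × Space d => fderiv ℝ ψ (t, p.1) (1, p.2) :=
          ((hψ.continuous_fderiv (by simp)).comp (by fun_prop)).clm_apply (by fun_prop)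
        exact (e1.measurable.comp (measurable_id.prodMk (hb t))).aestronglyMeasurable
    refine ⟨hc.intervalIntegrable.congr fun t ht => heq t (hI ht), ?_⟩
    rw [← intervalIntegral.integral_congr fun t ht => heq t (by rwa [uIcc_of_le hT.le] at ht), ← h1,
      integral_neg, integral_map measurable_fst.aemeasurable (f := fun x => ψ (0, x))
        (hψ.continuous.comp (by fun_prop)).aestronglyMeasurable, neg_add_cancel]

end IsMinimizingFlow

end

/-! ### Application to the mean field game systems. -/

section

variable {d : ℕ}

section Assumptions

variable {T M₀ : ℝ} {L₀ g : Space d → P1 (Space d × Space d) → ℝ}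
  {μ : ℕ → ℝ → P1 (Space d × Space d)} {μlim : ℝ → P1 (Space d × Space d)}

/-- The points may move with `k`; the modulus is uniform on the ball of radius `R`, as θ is
nondecreasing. -/
theorem CouplingAssumptions.tendsto_flowCost_sub (hL₀ : CouplingAssumptions M₀ L₀) {s : ℝ}
    (hs : s ∈ Icc 0 T) (hlim : Tendsto (fun k => d1 (μ k s) (μlim s)) atTop (𝓝 0)) {R : ℝ}
    {y : ℕ → Space d} (hy : ∀ k, ‖y k‖ ≤ R) :
    Tendsto (fun k => flowCost T L₀ μlim s (y k) - flowCost T L₀ (μ k) s (y k)) atTop (𝓝 0) := by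
  obtain ⟨θ, ρ, hθ, hθ0, hρ, hρ0, hρz, hρc, hmod⟩ := hL₀.modulus
  have hR : 0 ≤ R := (norm_nonneg _).trans (hy 0)
  have h1 : Tendsto (fun k => θ R * ρ (d1 (μ k s) (μlim s))) atTop (𝓝 0) := by
    have h2 := hρc.tendsto.comp (tendsto_nhdsWithin_iff.2
      ⟨hlim, Eventually.of_forall fun k => d1_nonneg (μ k s) (μlim s)⟩)
    rw [hρz] at h2
    simpa using h2.const_mul (θ R)
  refine squeeze_zero_norm (fun k => ?_) h1
  rw [flowCost_of_mem _ _ hs, flowCost_of_mem _ _ hs, Real.norm_eq_abs, abs_sub_comm]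
  exact (hmod _ _ _).trans (mul_le_mul_of_nonneg_right (hθ (norm_nonneg _) hR (hy k))
    (hρ0 _ (d1_nonneg _ _)))

theorem TerminalAssumptions.tendsto_sub (hg : TerminalAssumptions M₀ g)
    (hlim : Tendsto (fun k => d1 (μ k T) (μlim T)) atTop (𝓝 0)) (y : ℕ → Space d) :
    Tendsto (fun k => g (y k) (μlim T) - g (y k) (μ k T)) atTop (𝓝 0) := by
  rw [Metric.tendsto_nhds]
  intro η hη
  obtain ⟨δ, hδ, h1⟩ := hg.uniformContinuous η hη
  filter_upwards [hlim.eventually (gt_mem_nhds hδ)] with k hk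
  rw [dist_zero_right, Real.norm_eq_abs, abs_sub_comm]
  exact h1 _ _ _ hk

/-- Solutions of the systems with control of acceleration form a minimizing flow for the limit
problem. -/
theorem exists_isMinimizingFlow (hT : 0 < T) (hL₀ : CouplingAssumptions M₀ L₀)
    (hg : TerminalAssumptions M₀ g) {μ₀ : Measure (Space d × Space d)}
    (hμ₀ : InitialAssumptions μ₀) {ε : ℕ → ℝ} (hε_pos : ∀ k, 0 < ε k)
    (hε : Tendsto ε atTop (𝓝 0)) (hμ : ∀ k, IsAccSolution T L₀ g μ₀ (ε k) (μ k))
    (hμlim : ContinuousFlow T μlim)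
    (hlim : ∀ t ∈ Ioc 0 T, Tendsto (fun k => d1 (μ k t) (μlim t)) atTop (𝓝 0)) :
    ∃ X, IsMinimizingFlow T (2 * M₀) (flowCost T L₀ μlim) (fun x => g x (μlim T))
      (limitValue T L₀ g μlim) μ₀ X μ μlim := by
  choose γ w hfb hmap using fun k => (hμ k).flow
  have H := costData_flowCost hT.le hL₀ hg hμlim
  have Hk := fun k => costData_flowCost hT.le hL₀ hg (hμ k).continuousFlow
  refine ⟨fun k z t => (γ k z t, w k z t), hT, H, isValue_limitValue hT.le hL₀ hg hμlim,
    hμ₀.isProbabilityMeasure, fun k t ht => (hmap k t ht).1, fun k t ht => (hmap k t ht).2,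
    fun k => (hμ k).continuousFlow, hμlim, hlim, ?_⟩
  -- Compact support bounds the initial speeds, which gives one energy bound for almost all
  -- trajectories and all `k`.
  obtain ⟨K, hK, hK0⟩ := hμ₀.compactSupport
  obtain ⟨R, hR⟩ := hK.isBounded.exists_norm_le
  refine ⟨4 * energyBound T (2 * M₀) R, ?_⟩
  have hKae : ∀ᵐ z ∂μ₀, z ∈ K := hK0
  filter_upwards [ae_all_iff.2 hfb, hKae] with z hz hzK
  choose σ u a hσ hagree h0 hu0 hle using fun k =>
    (hz k).exists_isH2 hT (hε_pos k) hL₀ hg (hμ k).continuousFlow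
  have hU := fun k => isAccValue_accValue hT.le (hε_pos k).le hL₀ hg (hμ k).continuousFlow
  refine ⟨σ, u, fun k => (hσ k).isC1, fun k s hs => ?_, h0, fun k => ?_, ?_⟩
  · rw [(hagree k s hs).1, (hagree k s hs).2]
  · refine ((hU k).integral_sq_le (Hk k) (hε_pos k) hT (hσ k)
      (by rw [h0 k, hu0 k]; exact hle k)).trans
      (mul_le_mul_of_nonneg_left (energyBound_mono hT.le H.nonneg (norm_nonneg _) ?_) (by norm_num))
    rw [hu0 k]
    exact (norm_snd_le z).trans (hR z hzK)
  · exact tendsto_lagCost_of_accMinimizers hT H Hk (isValue_limitValue hT.le hL₀ hg hμlim) hε_pos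
      hε hU (fun s hs R y hy => hL₀.tendsto_flowCost_sub (Ioc_subset_Icc_self hs) (hlim s hs) hy)
      (fun y => hg.tendsto_sub (hlim T ⟨hT, le_rfl⟩) y) hσ h0 hu0 hle

end Assumptions

end

end

/-! ### The limit of the solutions. -/

theorem proposition5p5 {d : ℕ} {T M₀ : ℝ} (hT : 0 < T)
    (L₀ g : Space d → P1 (Space d × Space d) → ℝ)
    (hL₀ : CouplingAssumptions M₀ L₀) (hg : TerminalAssumptions M₀ g)
    (μ₀ : Measure (Space d × Space d)) (hμ₀ : InitialAssumptions μ₀)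
    (ε : ℕ → ℝ) (hε_pos : ∀ k, 0 < ε k) (hε : Tendsto ε atTop (𝓝 0))
    (μ : ℕ → ℝ → P1 (Space d × Space d))
    (hμ : ∀ k, IsAccSolution T L₀ g μ₀ (ε k) (μ k))
    (μlim : ℝ → P1 (Space d × Space d)) (hμlim : ContinuousFlow T μlim)
    (hconv : ∀ δ, 0 < δ → δ ≤ T →
      TendstoUniformlyOn (fun k t => d1 (μ k t) (μlim t)) (fun _ => 0) atTop (Icc δ T)) :
    (∀ t ∈ Icc 0 T,
      (∀ᵐ x ∂(μlim t).spaceMarginal.toMeasure,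
        DifferentiableAt ℝ (limitValue T L₀ g μlim t) x) ∧
      (μlim t).toMeasure = (μlim t).spaceMarginal.toMeasure.map
        (fun x => (x, -gradient (limitValue T L₀ g μlim t) x))) ∧
    ContinuousFlow T (fun t => (μlim t).spaceMarginal) ∧
    SolvesContinuityEquation T (fun t x => -gradient (limitValue T L₀ g μlim t) x)
      (fun t => (μlim t).spaceMarginal) (μ₀.map Prod.fst) ∧
    (μlim 0).spaceMarginal.toMeasure = μ₀.map Prod.fst := by
  have hlim : ∀ t ∈ Ioc 0 T, Tendsto (fun k => d1 (μ k t) (μlim t)) atTop (𝓝 0) := fun t ht =>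
    (hconv t ht.1 ht.2).tendsto_at ⟨le_rfl, ht.2⟩
  obtain ⟨X, D⟩ := exists_isMinimizingFlow hT hL₀ hg hμ₀ hε_pos hε hμ hμlim hlim
  have hν := hμ₀.absolutelyContinuous
  refine ⟨fun t ht => ⟨?_, D.toMeasure_eq_map hν ht⟩, hμlim.spaceMarginal,
    D.solvesContinuityEquation hν, D.spaceMarginal_zero⟩
  exact (ae_map_iff measurable_fst.aemeasurable (measurableSet_of_differentiableAt ℝ _)).2
    (D.ae_differentiableAt hν ht)
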